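/- Throughout, a digraph $\Gamma$ has a finite nonempty vertex set $V(\Gamma)$ and arcs that are ordered pairs of distinct vertices. For a strongly connected digraph $\Gamma$ let $\partial_\Gamma(x,y)$ be the length of a shortest path from $x$ to $y$, let $\tilde\partial_\Gamma(x,y)=(\partial_\Gamma(x,y),\partial_\Gamma(y,x))$ be the two-way distance, let $\tilde\partial(\Gamma)=\{\tilde\partial_\Gamma(x,y)\mid x,y\in V(\Gamma)\}$, and let $\Gamma_{\tilde i}=\{(x,y)\mid \tilde\partial_\Gamma(x,y)=\tilde i\}$. The digraph $\Gamma$ is called weakly distance-regular if it is strongly connected and $(V(\Gamma),\{\Gamma_{\tilde i}\}_{\tilde i\in\tilde\partial(\Gamma)})$ is a non-symmetric association scheme (a scheme with at least one relation that differs from its transpose). Its intersection number $p^{\tilde h}_{\tilde i,\tilde j}$ is the number of vertices $z$ with $(x,z)\in\Gamma_{\tilde i}$ and $(z,y)\in\Gamma_{\tilde j}$, for any $(x,y)\in\Gamma_{\tilde h}$; it is understood to be $0$ if one of $\tilde h,\tilde i,\tilde j$ is not in $\tilde\partial(\Gamma)$. The digraph is commutative if $p^{\tilde h}_{\tilde i,\tilde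 j}=p^{\tilde h}_{\tilde j,\tilde i}$ for all $\tilde h,\tilde i,\tilde j\in\tilde\partial(\Gamma)$. The underlying graph of $\Gamma$ joins $x$ and $y$ by an edge whenever $(x,y)$ or $(y,x)$ is an arc. The Johnson graph $J(n,e)$ has as vertices the $e$-subsets of an $n$-set, two of them being adjacent when they meet in $e-1$ elements. The folded Johnson graph $\bar J(2e,e)$ has as vertices the partitions of a $2e$-set into two $e$-sets, two of them being adjacent when their common refinement consists of four sets of sizes $1,e-1,1,e-1$. **Proposition.** Let $\Gamma$ be a commutative weakly distance-regular digraph whose underlying graph is isomorphic to a Johnson graph $J(n,e)$ with $n\ge 2e$ and $e\ge 2$, or to a folded Johnson graph $\bar J(2e,e)$ with $e\ge 4$. Let $T=\{q+1\mid (1,q)\in\tilde\partial(\Gamma)\}$. 1. If $p^{(1,2)}_{(1,3),(1,3)}=0$, then $T=\{3\}$. 2. If $p^{(1,2)}_{(1,3),(1,3)}\neq 0$, then $T=\{3,4\}$ or $T=\{2,3,4\}$. -/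

import Mathlib

/-- `IsAssociationScheme R` says that the relations `R i` (`i : ι`) on the finite set `X` form an
association scheme: they are nonempty, one of them is the diagonal, they partition `X × X`, the
transpose of each is again one of them, and for all `i j l` the number of `z` with
`(x, z) ∈ R i` and `(z, y) ∈ R j` is the same for all `(x, y) ∈ R l`. -/
structure IsAssociationScheme {X ι : Type*} (R : ι → Set (X × X)) : Prop where
  finite : Finite X
  nonempty : ∀ i, (R i).Nonempty
  diagonal : ∃ i, R i = Set.diagonal X
  cover : ⋃ i, R i = Set.univ
  disjoint : ∀ i j, i ≠ j → Disjoint (R i) (R j)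
  transpose : ∀ i, ∃ j, Prod.swap ⁻¹' R i = R j
  regular : ∀ i j l, ∃ p : ℕ, ∀ x y, (x, y) ∈ R l →
    {z | (x, z) ∈ R i ∧ (z, y) ∈ R j}.ncard = p

/-- The intersection number `p^l_{i,j}` of a family of relations: the common value of
`|{z | (x, z) ∈ R i ∧ (z, y) ∈ R j}|` for `(x, y) ∈ R l`.  It is `0` if `R l` is empty. -/
noncomputable def intersectionNumber {X ι : Type*} (R : ι → Set (X × X)) (l i j : ι) : ℕ :=
  sInf {p | ∃ x y, (x, y) ∈ R l ∧ {z | (x, z) ∈ R i ∧ (z, y) ∈ R j}.ncard = p}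

namespace Digraph

variable {V : Type*} (Γ : Digraph V)

/-- There is a path of length `r` from `x` to `y`. -/
def HasPath (r : ℕ) (x y : V) : Prop :=
  ∃ w : ℕ → V, w 0 = x ∧ w r = y ∧ ∀ t < r, Γ.Adj (w t) (w (t + 1))

/-- Strong connectedness. -/
def StronglyConnected : Prop := ∀ x y, ∃ r, Γ.HasPath r x y

/-- The length of a shortest path from `x` to `y`. -/
noncomputable def distance (x y : V) : ℕ := sInf {r | Γ.HasPath r x y}

/-- The two-way distance from `x` to `y`. -/
noncomputable def twoWayDistance (x y : V) : ℕ × ℕ := (Γ.distance x y, Γ.distance y x)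

/-- The two-way distance set. -/
def twoWayDistanceSet : Set (ℕ × ℕ) := {i | ∃ x y, Γ.twoWayDistance x y = i}

/-- The set of pairs with two-way distance `i`; it is empty if `i` is not a two-way distance. -/
def twoWayRel (i : ℕ × ℕ) : Set (V × V) := {q | Γ.twoWayDistance q.1 q.2 = i}

/-- The relations of the attached scheme, indexed by the two-way distance set. -/
def attachedScheme (i : Γ.twoWayDistanceSet) : Set (V × V) := Γ.twoWayRel i

/-- Weakly distance-regular digraphs: finite, nonempty, loopless, strongly connected digraphs whose
attached scheme is a non-symmetric association scheme. -/
structure IsWeaklyDistanceRegular : Prop where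
  finite : Finite V
  nonempty : Nonempty V
  loopless : ∀ x, ¬ Γ.Adj x x
  stronglyConnected : Γ.StronglyConnected
  isAssociationScheme : IsAssociationScheme Γ.attachedScheme
  nonSymmetric : ∃ i, Prod.swap ⁻¹' Γ.attachedScheme i ≠ Γ.attachedScheme i

/-- Commutativity of the attached scheme: `p^l_{i,j} = p^l_{j,i}` for all `i, j, l`. -/
def IsCommutative : Prop := ∀ l i j,
  intersectionNumber Γ.attachedScheme l i j = intersectionNumber Γ.attachedScheme l j i

/-- The set `T` of all `q + 1` such that `(1, q)` is a two-way distance. -/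
def arcTypeSet : Set ℕ := {t | ∃ q, (1, q) ∈ Γ.twoWayDistanceSet ∧ q + 1 = t}

end Digraph

/-- The Johnson graph `J(n, e)`: the `e`-subsets of an `n`-set, two of them being adjacent when they
meet in `e - 1` elements. -/
def johnsonGraph (n e : ℕ) : SimpleGraph {x : Finset (Fin n) // x.card = e} where
  Adj x y := (x.1 ∩ y.1).card + 1 = e
  symm := ⟨fun x y h => by rwa [Finset.inter_comm]⟩
  loopless := ⟨fun x h => by have := x.2; simp only [Finset.inter_self] at h; omega⟩

/-- The folded Johnson graph of the partitions `{x, xᶜ}` of a `2e`-set into two `e`-sets.  Two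
partitions are adjacent when some part of one meets some part of the other in `e - 1` elements,
that is, when the four sets of the common refinement have sizes `1, e - 1, 1, e - 1`. -/
def foldedJohnsonGraph (e : ℕ) : SimpleGraph
    {P : Finset (Finset (Fin (2 * e))) // ∃ x : Finset (Fin (2 * e)), x.card = e ∧ P = {x, xᶜ}} where
  Adj P Q := P ≠ Q ∧ ∃ x ∈ P.1, ∃ y ∈ Q.1, (x ∩ y).card + 1 = e
  symm := ⟨fun _ _ ⟨hne, x, hx, y, hy, h⟩ =>
    ⟨hne.symm, y, hy, x, hx, by rwa [Finset.inter_comm]⟩⟩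
  loopless := ⟨fun _ h => h.1 rfl⟩

/-! A colour is a function on pairs of vertices that depends only on the two-way distance
(`IsColor`). Colours are closed under products and convolution, and convolution of colours is
commutative. Let S = `skew` be the indicator of arcs minus that of reversed arcs. Both families of
graphs look alike around a vertex: the neighbours of an e-set x are the cells (i, j) of x × xᶜ,
adjacent when they share a row or a column (`LocalCover`). Convolving S with the adjacency function
therefore yields, on the edge from x to (i, j), the sum F = R_i + C_j of the row sum and the column
sum of S at x (`lines_eq`). So F is a skew colour, although R and C need not be colours. Everything
rests on deciding whether the line sums R and C vanish.

If rows and columns differ in length, applying `lines` twice separates R from C, and three points of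
a clique force both to vanish. If the lengths agree, R² + C² is also a colour (`squares_eq`):
reversing an edge negates R + C and preserves R² + C². On a clique this gives the relations of
`LineData`. Suppose that the greatest absolute value m of a line sum is positive. An arc in no
directed cycle of length at most three has F ≥ 2, while F = 0 on symmetric arcs. Hence the points
with sum m dominate their clique, and there are e + 1 - m of them (`BoundedSums.skew_eq_one`,
`card_max`). If m < e, the counts give 2m = e + 1 and leave, up to sign, only the row sums m and -(m
- 1) at an extremal vertex, which is contradictory (`false_of_max_lt`). Thus m = e, and a clique
attaining it has a source and a sink joined by a (1,2) arc, with every other point v giving (1,3)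
arcs from source to v and from v to sink (`source_line`). Then the intersection number is nonzero,
and no arc needs more than three steps back (`structure_of_row`).

If all line sums vanish, every arc lies in a directed cycle of length at most three, so there are no
(1,3) arcs, and 3 ∈ T because the scheme is not symmetric. It remains to exclude symmetric arcs. At
x the function S is a matrix with entries 0, 1, -1 and vanishing row and column sums, whose zeros
are the symmetric arcs. A two by two block lists the common neighbours of x and a vertex at distance
two, so its number of zeros and its sum obey `BlockLaw`. If no block has exactly one zero, the zeros
fill one line at each vertex, against `not_all_rows`. Otherwise each row and column has exactly one
zero, the matrix is at most three by three (`card_le_three`), parity leaves the 3-subsets of a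
6-set, and `false_of_matching` ends the argument. In the folded graph with e = 4 two vertices at
distance two have eight common neighbours, forming two complementary blocks; `OctadCover` treats
this case. -/

namespace Digraph

variable {V : Type*} {Γ : Digraph V}

/-! ### Directed paths and distances -/

section Distance

theorem HasPath.trans {r s : ℕ} {x y z : V} (h : Γ.HasPath r x y) (h' : Γ.HasPath s y z) :
    Γ.HasPath (r + s) x z := by
  obtain ⟨w, hw0, hwr, hw⟩ := h
  obtain ⟨u, hu0, hus, hu⟩ := h'
  refine ⟨fun t => if t ≤ r then w t else u (t - r), by simpa using hw0, ?_, fun t ht => ?_⟩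
  · by_cases hs : s = 0
    · subst hs; simp [hwr, ← hus, hu0]
    · simp [hs, hus]
  · rcases lt_trichotomy t r with h | h | h
    · simpa [h.le, Nat.succ_le_of_lt h] using hw t h
    · subst h
      simpa [hwr, ← hu0] using hu 0 (by omega)
    · have := hu (t - r) (by omega)
      rw [show t - r + 1 = t + 1 - r by omega] at this
      simpa [h.not_ge, (show ¬ t + 1 ≤ r by omega)] using this

theorem hasPath_zero (x : V) : Γ.HasPath 0 x x := ⟨fun _ => x, rfl, rfl, by simp⟩

theorem hasPath_one {x y : V} (h : Γ.Adj x y) : Γ.HasPath 1 x y :=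
  ⟨fun t => if t = 0 then x else y, by simp, by simp, fun t ht => by
    obtain rfl : t = 0 := by omega
    simpa using h⟩

theorem distance_le {r : ℕ} {x y : V} (h : Γ.HasPath r x y) : Γ.distance x y ≤ r := Nat.sInf_le h

theorem distance_self (x : V) : Γ.distance x x = 0 := by
  simpa using distance_le (hasPath_zero (Γ := Γ) x)

theorem StronglyConnected.hasPath (h : Γ.StronglyConnected) (x y : V) :
    Γ.HasPath (Γ.distance x y) x y := Nat.sInf_mem (h x y)

theorem StronglyConnected.distance_triangle (h : Γ.StronglyConnected) (x y z : V) :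
    Γ.distance x z ≤ Γ.distance x y + Γ.distance y z :=
  distance_le ((h.hasPath x y).trans (h.hasPath y z))

theorem StronglyConnected.distance_eq_zero (h : Γ.StronglyConnected) {x y : V} :
    Γ.distance x y = 0 ↔ x = y := by
  refine ⟨fun h0 => ?_, fun h0 => h0 ▸ distance_self x⟩
  obtain ⟨w, h1, h2, -⟩ := h0 ▸ h.hasPath x y
  rw [← h1, ← h2]

theorem StronglyConnected.exists_of_distance (h : Γ.StronglyConnected) {x y : V}
    (hd : Γ.distance x y = 2) : ∃ v, Γ.Adj x v ∧ Γ.Adj v y := by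
  obtain ⟨w, h1, h2, h3⟩ := hd ▸ h.hasPath x y
  exact ⟨w 1, h1 ▸ h3 0 (by omega), h2 ▸ h3 1 (by omega)⟩

theorem IsWeaklyDistanceRegular.distance_eq_one (h : Γ.IsWeaklyDistanceRegular) {x y : V} :
    Γ.distance x y = 1 ↔ Γ.Adj x y := by
  constructor
  · intro hd
    obtain ⟨w, h1, h2, h3⟩ := hd ▸ h.stronglyConnected.hasPath x y
    exact h1 ▸ h2 ▸ h3 0 (by omega)
  · intro ha
    have h1 := distance_le (hasPath_one ha)
    have h0 : Γ.distance x y ≠ 0 := fun h0 => by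
      rw [h.stronglyConnected.distance_eq_zero] at h0
      exact h.loopless x (h0 ▸ ha)
    omega

end Distance

/-! ### Colours: functions of the two-way distance -/

/-- Commutative weakly distance-regular digraphs. -/
structure IsCWDR (Γ : Digraph V) : Prop where
  wdr : Γ.IsWeaklyDistanceRegular
  comm : Γ.IsCommutative

/-- A function on pairs of vertices that depends only on the two-way distance. -/
def IsColor (Γ : Digraph V) (φ : V → V → ℤ) : Prop :=
  ∀ x y x' y', Γ.twoWayDistance x y = Γ.twoWayDistance x' y' → φ x y = φ x' y'

theorem twoWayDistance_swap (x y : V) : Γ.twoWayDistance y x = (Γ.twoWayDistance x y).swap := rfl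

theorem twoWayDistance_eq_iff {x y x' y' : V} :
    Γ.twoWayDistance x y = Γ.twoWayDistance x' y' ↔
      Γ.distance x y = Γ.distance x' y' ∧ Γ.distance y x = Γ.distance y' x' := by
  simp [twoWayDistance]

theorem IsColor.swap {φ : V → V → ℤ} (h : Γ.IsColor φ) : Γ.IsColor fun x y => φ y x :=
  fun x y x' y' hd => h _ _ _ _ (by
    rw [twoWayDistance_swap x y, twoWayDistance_swap x' y', hd])

theorem isColor_const (c : ℤ) : Γ.IsColor fun _ _ => c := fun _ _ _ _ _ => rfl

theorem IsColor.map₂ {φ ψ : V → V → ℤ} (f : ℤ → ℤ → ℤ) (hφ : Γ.IsColor φ) (hψ : Γ.IsColor ψ) :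
    Γ.IsColor fun x y => f (φ x y) (ψ x y) :=
  fun x y x' y' hd => by
    change f (φ x y) (ψ x y) = f (φ x' y') (ψ x' y')
    rw [hφ x y x' y' hd, hψ x y x' y' hd]

theorem IsColor.add {φ ψ : V → V → ℤ} (hφ : Γ.IsColor φ) (hψ : Γ.IsColor ψ) :
    Γ.IsColor fun x y => φ x y + ψ x y := hφ.map₂ (· + ·) hψ

theorem IsColor.sub {φ ψ : V → V → ℤ} (hφ : Γ.IsColor φ) (hψ : Γ.IsColor ψ) :
    Γ.IsColor fun x y => φ x y - ψ x y := hφ.map₂ (· - ·) hψ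

theorem IsColor.mul {φ ψ : V → V → ℤ} (hφ : Γ.IsColor φ) (hψ : Γ.IsColor ψ) :
    Γ.IsColor fun x y => φ x y * ψ x y := hφ.map₂ (· * ·) hψ

theorem IsColor.const_mul {φ : V → V → ℤ} (c : ℤ) (hφ : Γ.IsColor φ) :
    Γ.IsColor fun x y => c * φ x y := (isColor_const c).mul hφ

/-- Factoring through the two-way distance allows sums over vertices to be regrouped by relations.
The default 0 on pairs that are not two-way distances is never reached. -/
theorem IsColor.exists_eq {φ : V → V → ℤ} (h : Γ.IsColor φ) :
    ∃ c : ℕ × ℕ → ℤ, ∀ x y, φ x y = c (Γ.twoWayDistance x y) := by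
  classical
  refine ⟨fun p => if hp : ∃ q : V × V, Γ.twoWayDistance q.1 q.2 = p then
    φ hp.choose.1 hp.choose.2 else 0, fun x y => ?_⟩
  have hp : ∃ q : V × V, Γ.twoWayDistance q.1 q.2 = Γ.twoWayDistance x y := ⟨(x, y), rfl⟩
  refine Eq.trans ?_ (dif_pos hp).symm
  exact h _ _ _ _ hp.choose_spec.symm

/-- The indicator function of a relation of the scheme. -/
noncomputable def ind (Γ : Digraph V) (a : ℕ × ℕ) (x y : V) : ℤ :=
  if Γ.twoWayDistance x y = a then 1 else 0

theorem isColor_ind (a : ℕ × ℕ) : Γ.IsColor (Γ.ind a) := fun x y x' y' h => by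
  simp [ind, h]

/-- The indicator function of the arcs. -/
noncomputable def arc (Γ : Digraph V) (x y : V) : ℤ := if Γ.distance x y = 1 then 1 else 0

theorem isColor_arc : Γ.IsColor Γ.arc := fun x y x' y' h => by
  simp [arc, (twoWayDistance_eq_iff.1 h).1]

/-- The skew adjacency function. -/
noncomputable def skew (Γ : Digraph V) (x y : V) : ℤ := Γ.arc x y - Γ.arc y x

theorem isColor_skew : Γ.IsColor Γ.skew := isColor_arc.sub isColor_arc.swap

theorem skew_swap (x y : V) : Γ.skew y x = -Γ.skew x y := by simp [skew]

/-- The indicator function of the symmetric arcs. -/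
noncomputable def sym (Γ : Digraph V) (x y : V) : ℤ := Γ.arc x y * Γ.arc y x

theorem isColor_sym : Γ.IsColor Γ.sym := isColor_arc.mul isColor_arc.swap

theorem sym_swap (x y : V) : Γ.sym y x = Γ.sym x y := by simp [sym, mul_comm]

/-- The adjacency function of the underlying graph. -/
noncomputable def adjm (Γ : Digraph V) (x y : V) : ℤ := Γ.arc x y + Γ.arc y x - Γ.sym x y

theorem isColor_adjm : Γ.IsColor Γ.adjm := (isColor_arc.add isColor_arc.swap).sub isColor_sym

theorem adjm_swap (x y : V) : Γ.adjm y x = Γ.adjm x y := by simp [adjm, sym_swap x y]; ring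

/-! ### Convolution of colours -/

section Convolution

variable [Fintype V]

/-- The product of two functions on pairs of vertices. -/
def conv (φ ψ : V → V → ℤ) (x y : V) : ℤ := ∑ v, φ x v * ψ v y

/-- The scheme is indexed by actual two-way distances only; for any other a or b both sets are
empty. -/
theorem IsCWDR.card_eq (h : Γ.IsCWDR) {x y x' y' : V}
    (hd : Γ.twoWayDistance x y = Γ.twoWayDistance x' y') (a b : ℕ × ℕ) :
    Fintype.card {v // Γ.twoWayDistance x v = a ∧ Γ.twoWayDistance v y = b} =
      Fintype.card {v // Γ.twoWayDistance x' v = a ∧ Γ.twoWayDistance v y' = b} := by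
  by_cases hab : a ∈ Γ.twoWayDistanceSet ∧ b ∈ Γ.twoWayDistanceSet
  · obtain ⟨p, hp⟩ := h.wdr.isAssociationScheme.regular ⟨a, hab.1⟩ ⟨b, hab.2⟩
      ⟨Γ.twoWayDistance x y, x, y, rfl⟩
    have h1 := hp x y rfl
    have h2 := hp x' y' hd.symm
    rw [← Nat.card_coe_set_eq] at h1 h2
    rw [← Nat.card_eq_fintype_card, ← Nat.card_eq_fintype_card]
    exact h1.trans h2.symm
  · have : ∀ u v : V, IsEmpty {z // Γ.twoWayDistance u z = a ∧ Γ.twoWayDistance z v = b} :=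
      fun u v => ⟨fun z => hab ⟨⟨u, z, z.2.1⟩, ⟨z, v, z.2.2⟩⟩⟩
    have i1 := this x y
    have i2 := this x' y'
    rw [Fintype.card_eq_zero_iff.2 i1, Fintype.card_eq_zero_iff.2 i2]

theorem IsCWDR.card_comm (h : Γ.IsCWDR) (x y : V) (a b : ℕ × ℕ) :
    Fintype.card {v // Γ.twoWayDistance x v = a ∧ Γ.twoWayDistance v y = b} =
      Fintype.card {v // Γ.twoWayDistance x v = b ∧ Γ.twoWayDistance v y = a} := by
  by_cases hab : a ∈ Γ.twoWayDistanceSet ∧ b ∈ Γ.twoWayDistanceSet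
  · have key : ∀ i j : Γ.twoWayDistanceSet,
        intersectionNumber Γ.attachedScheme ⟨Γ.twoWayDistance x y, x, y, rfl⟩ i j =
        Fintype.card {v // Γ.twoWayDistance x v = i.1 ∧ Γ.twoWayDistance v y = j.1} := by
      intro i j
      obtain ⟨p, hp⟩ := h.wdr.isAssociationScheme.regular i j
        ⟨Γ.twoWayDistance x y, x, y, rfl⟩
      have h1 := hp x y rfl
      -- Regularity makes the set inside the infimum a singleton, so the infimum is the actual
      -- count.
      have h2 : {q | ∃ u v, (u, v) ∈ Γ.attachedScheme ⟨Γ.twoWayDistance x y, x, y, rfl⟩ ∧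
          {z | (u, z) ∈ Γ.attachedScheme i ∧ (z, v) ∈ Γ.attachedScheme j}.ncard = q} = {p} := by
        ext q
        constructor
        · rintro ⟨u, v, huv, rfl⟩
          exact hp u v huv
        · rintro rfl
          exact ⟨x, y, rfl, h1⟩
      rw [intersectionNumber, h2, csInf_singleton, ← h1, ← Nat.card_coe_set_eq,
        ← Nat.card_eq_fintype_card]
      rfl
    have := h.comm ⟨Γ.twoWayDistance x y, x, y, rfl⟩ ⟨a, hab.1⟩ ⟨b, hab.2⟩
    rwa [key, key] at this
  · have i1 : IsEmpty {z // Γ.twoWayDistance x z = a ∧ Γ.twoWayDistance z y = b} :=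
      ⟨fun z => hab ⟨⟨x, z, z.2.1⟩, ⟨z, y, z.2.2⟩⟩⟩
    have i2 : IsEmpty {z // Γ.twoWayDistance x z = b ∧ Γ.twoWayDistance z y = a} :=
      ⟨fun z => hab ⟨⟨z, y, z.2.2⟩, ⟨x, z, z.2.1⟩⟩⟩
    rw [Fintype.card_eq_zero_iff.2 i1, Fintype.card_eq_zero_iff.2 i2]

theorem conv_eq_sum (c e : ℕ × ℕ → ℤ) (x y : V) :
    ∑ v, c (Γ.twoWayDistance x v) * e (Γ.twoWayDistance v y) =
      ∑ p ∈ (Finset.univ.image fun q : V × V => Γ.twoWayDistance q.1 q.2) ×ˢ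
        (Finset.univ.image fun q : V × V => Γ.twoWayDistance q.1 q.2),
        (Fintype.card {v // Γ.twoWayDistance x v = p.1 ∧ Γ.twoWayDistance v y = p.2} : ℤ) *
          (c p.1 * e p.2) := by
  rw [← Finset.sum_fiberwise_of_maps_to
    (g := fun v => (Γ.twoWayDistance x v, Γ.twoWayDistance v y))]
  · refine Finset.sum_congr rfl fun p _ => ?_
    rw [Finset.sum_congr rfl (g := fun _ => c p.1 * e p.2)]
    · rw [Finset.sum_const, nsmul_eq_mul, Fintype.card_subtype]
      simp only [Prod.ext_iff]
    · intro v hv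
      rw [Finset.mem_filter] at hv
      rw [← hv.2]
  · intro v _
    simp only [Finset.mem_product, Finset.mem_image, Finset.mem_univ, true_and]
    exact ⟨⟨(x, v), rfl⟩, ⟨(v, y), rfl⟩⟩

/-- After grouping the middle vertices by their relations to both ends, only intersection numbers
remain: the closure of the adjacency algebra of the scheme. -/
theorem IsCWDR.isColor_conv (h : Γ.IsCWDR) {φ ψ : V → V → ℤ} (hφ : Γ.IsColor φ)
    (hψ : Γ.IsColor ψ) : Γ.IsColor (conv φ ψ) := by
  obtain ⟨c, hc⟩ := hφ.exists_eq
  obtain ⟨e, he⟩ := hψ.exists_eq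
  intro x y x' y' hd
  simp only [conv, hc, he, conv_eq_sum]
  refine Finset.sum_congr rfl fun p _ => ?_
  rw [h.card_eq hd]

theorem IsCWDR.conv_comm (h : Γ.IsCWDR) {φ ψ : V → V → ℤ} (hφ : Γ.IsColor φ)
    (hψ : Γ.IsColor ψ) (x y : V) : conv φ ψ x y = conv ψ φ x y := by
  obtain ⟨c, hc⟩ := hφ.exists_eq
  obtain ⟨e, he⟩ := hψ.exists_eq
  simp only [conv, hc, he, conv_eq_sum]
  rw [← Finset.sum_equiv (Equiv.prodComm (ℕ × ℕ) (ℕ × ℕ)) (s := _ ×ˢ _)]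
  · intro p
    simp only [Finset.mem_product, Equiv.prodComm_apply, Prod.fst_swap, Prod.snd_swap]
    exact and_comm
  · intro p _
    simp only [Equiv.prodComm_apply, Prod.fst_swap, Prod.snd_swap]
    rw [h.card_comm x y p.1 p.2]
    exact congrArg _ (mul_comm _ _)

/-- Commutation with the all-one function: all row sums and all column sums of a colour share one
value. -/
theorem IsCWDR.sum_row (h : Γ.IsCWDR) {φ : V → V → ℤ} (hφ : Γ.IsColor φ) (x y : V) :
    ∑ v, φ x v = ∑ v, φ v y := by
  simpa [conv] using h.conv_comm hφ (isColor_const 1) x y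

theorem IsCWDR.sum_skew (h : Γ.IsCWDR) (x : V) : ∑ v, Γ.skew x v = 0 := by
  have h1 := h.sum_row isColor_skew x x
  simp only [skew_swap x, Finset.sum_neg_distrib] at h1
  omega

end Convolution

/-! ### Values of the arc functions -/

section Arcs

theorem arc_eq_one (h : Γ.IsCWDR) {x y : V} : Γ.arc x y = 1 ↔ Γ.Adj x y := by
  rw [← h.wdr.distance_eq_one, arc]; split_ifs <;> simp_all

theorem arc_eq_zero (h : Γ.IsCWDR) {x y : V} : Γ.arc x y = 0 ↔ ¬ Γ.Adj x y := by
  rw [← h.wdr.distance_eq_one, arc]; split_ifs <;> simp_all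

theorem arc_eq_or (x y : V) : Γ.arc x y = 0 ∨ Γ.arc x y = 1 := by
  rw [arc]; split_ifs <;> simp

theorem skew_eq_or (x y : V) : Γ.skew x y = 0 ∨ Γ.skew x y = 1 ∨ Γ.skew x y = -1 := by
  rcases Γ.arc_eq_or x y with h | h <;> rcases Γ.arc_eq_or y x with h' | h' <;>
    simp [skew, h, h']

theorem skew_eq_one (h : Γ.IsCWDR) {x y : V} : Γ.skew x y = 1 ↔ Γ.Adj x y ∧ ¬ Γ.Adj y x := by
  rw [← arc_eq_one h, ← arc_eq_zero h, skew]
  rcases Γ.arc_eq_or x y with h | h <;> rcases Γ.arc_eq_or y x with h' | h' <;> simp [h, h']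

theorem skew_eq_neg_one (h : Γ.IsCWDR) {x y : V} :
    Γ.skew x y = -1 ↔ Γ.Adj y x ∧ ¬ Γ.Adj x y := by
  rw [← skew_eq_one h, skew_swap x y]; omega

theorem sym_eq_one (h : Γ.IsCWDR) {x y : V} : Γ.sym x y = 1 ↔ Γ.Adj x y ∧ Γ.Adj y x := by
  rw [← arc_eq_one h, ← arc_eq_one h, sym]
  rcases Γ.arc_eq_or x y with h | h <;> rcases Γ.arc_eq_or y x with h' | h' <;> simp [h, h']

theorem sym_eq_or (x y : V) : Γ.sym x y = 0 ∨ Γ.sym x y = 1 := by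
  rw [sym]
  rcases Γ.arc_eq_or x y with h | h <;> rcases Γ.arc_eq_or y x with h' | h' <;> simp [h, h']

theorem adjm_eq_one (h : Γ.IsCWDR) {x y : V} : Γ.adjm x y = 1 ↔ Γ.Adj x y ∨ Γ.Adj y x := by
  rw [← arc_eq_one h, ← arc_eq_one h, adjm, sym]
  rcases Γ.arc_eq_or x y with h | h <;> rcases Γ.arc_eq_or y x with h' | h' <;> simp [h, h']

theorem adjm_eq_or (x y : V) : Γ.adjm x y = 0 ∨ Γ.adjm x y = 1 := by
  rw [adjm, sym]
  rcases Γ.arc_eq_or x y with h | h <;> rcases Γ.arc_eq_or y x with h' | h' <;> simp [h, h']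

theorem adjm_eq_one_iff (h : Γ.IsCWDR) {x y : V} :
    Γ.adjm x y = 1 ↔ Γ.toSimpleGraphInclusive.Adj x y := by
  rw [adjm_eq_one h, toSimpleGraphInclusive, SimpleGraph.fromRel_adj]
  refine ⟨fun h' => ⟨?_, h'⟩, fun h' => h'.2⟩
  rintro rfl
  exact h.wdr.loopless x (by tauto)

theorem adjm_self (h : Γ.IsCWDR) (v : V) : Γ.adjm v v = 0 := by
  rcases Γ.adjm_eq_or v v with h' | h'
  · exact h'
  · rw [adjm_eq_one h] at h'
    exact absurd h' (by simpa using h.wdr.loopless v)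

end Arcs

end Digraph

open Finset

/-! ### Exchanging one element of a finite set -/

section Exchange

variable {α : Type*} [DecidableEq α]

/-- Replace the element `i` of `x` by `j`. -/
def exchange (x : Finset α) (i j : α) : Finset α := insert j (x.erase i)

theorem mem_exchange {x : Finset α} {i j a : α} :
    a ∈ exchange x i j ↔ a = j ∨ a ≠ i ∧ a ∈ x := by simp [exchange]

theorem card_exchange {x : Finset α} {i j : α} (hi : i ∈ x) (hj : j ∉ x) :
    (exchange x i j).card = x.card := by
  rw [exchange, card_insert_of_notMem (by simp [hj]), card_erase_add_one hi]

theorem exchange_insert {w : Finset α} {i j : α} (hi : i ∉ w) :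
    exchange (insert i w) i j = insert j w := by
  rw [exchange, erase_insert hi]

theorem exchange_exchange_same {x : Finset α} {i j k : α} (hj : j ∉ x) :
    exchange (exchange x i j) j k = exchange x i k := by
  rw [exchange, exchange, erase_insert (by simp [hj]), exchange]

theorem exchange_exchange_col {x : Finset α} {i i' j : α} (hi : i ∈ x) (hi' : i' ∈ x)
    (hne : i' ≠ i) (hj : j ∉ x) : exchange (exchange x i j) i' i = exchange x i' j := by
  ext a
  simp only [mem_exchange]
  grind

theorem exchange_back {x : Finset α} {i j : α} (hi : i ∈ x) (hj : j ∉ x) :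
    exchange (exchange x i j) j i = x := by
  ext a
  simp only [mem_exchange]
  grind

variable [Fintype α]

theorem compl_exchange {x : Finset α} {i j : α} (hi : i ∈ x) (hj : j ∉ x) :
    (exchange xᶜ j i)ᶜ = exchange x i j := by
  ext a
  simp only [mem_exchange, mem_compl]
  grind

end Exchange

/-! ### Local covers by Johnson graphs and their line sums -/

namespace Digraph

variable {V α : Type*} [DecidableEq α] [Fintype α] {Γ : Digraph V}

/-- `π` maps the `e`-subsets onto the vertices, and for each `e`-subset `x` it is an isomorphism
from the neighbourhood of `x` in the Johnson graph to that of `π x` in the underlying graph. -/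
structure LocalCover (Γ : Digraph V) (e : ℕ) (π : Finset α → V) : Prop where
  surj : ∀ v, ∃ x, x.card = e ∧ π x = v
  adj : ∀ x i j, x.card = e → i ∈ x → j ∉ x → Γ.adjm (π x) (π (exchange x i j)) = 1
  lift : ∀ x v, x.card = e → Γ.adjm (π x) v = 1 → ∃ i ∈ x, ∃ j ∉ x, π (exchange x i j) = v
  inj : ∀ x i j i' j', x.card = e → i ∈ x → j ∉ x → i' ∈ x → j' ∉ x →
    π (exchange x i j) = π (exchange x i' j') → i = i' ∧ j = j'
  nonadj : ∀ x i j i' j', x.card = e → i ∈ x → j ∉ x → i' ∈ x → j' ∉ x →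
    Γ.adjm (π (exchange x i j)) (π (exchange x i' j')) = 1 → i = i' ∨ j = j'

/-- The sum of `φ` over the line of the neighbours of `x` that do not contain `i`. -/
def rowSum (φ : V → V → ℤ) (π : Finset α → V) (x : Finset α) (i : α) : ℤ :=
  ∑ j ∈ xᶜ, φ (π x) (π (exchange x i j))

/-- The sum of `φ` over the line of the neighbours of `x` that contain `j`. -/
def colSum (φ : V → V → ℤ) (π : Finset α → V) (x : Finset α) (j : α) : ℤ :=
  ∑ i ∈ x, φ (π x) (π (exchange x i j))

namespace LocalCover

variable {e : ℕ} {π : Finset α → V} (hπ : LocalCover Γ e π)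
include hπ

omit [Fintype α] in
-- The neighbourhood of `π x` is the rook graph on x × xᶜ. The last term corrects the value 2 at
-- equal cells to 0.
theorem adjm_exchange (h : Γ.IsCWDR) {x : Finset α} {i j i' j' : α} (hx : x.card = e)
    (hi : i ∈ x) (hj : j ∉ x) (hi' : i' ∈ x) (hj' : j' ∉ x) :
    Γ.adjm (π (exchange x i j)) (π (exchange x i' j')) =
      (if i = i' then 1 else 0) + (if j = j' then 1 else 0) -
        (if i = i' then 2 else 0) * (if j = j' then 1 else 0) := by
  by_cases h1 : i = i'
  · subst h1
    by_cases h2 : j = j'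
    · subst h2
      simp [adjm_self h]
    · have := hπ.adj (exchange x i j) j j' (by rw [card_exchange hi hj, hx])
        (by simp [mem_exchange]) (by simp [mem_exchange, hj', Ne.symm h2])
      rw [exchange_exchange_same hj] at this
      simp [this, h2]
  · by_cases h2 : j = j'
    · subst h2
      have := hπ.adj (exchange x i j) i' i (by rw [card_exchange hi hj, hx])
        (by simp [mem_exchange, hi', Ne.symm h1]) (by
          simp only [mem_exchange]; rintro (rfl | h'); exacts [hj hi, h'.1 rfl])
      rw [exchange_exchange_col hi hi' (Ne.symm h1) hj] at this
      simp [this, h1]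
    · rcases Γ.adjm_eq_or (π (exchange x i j)) (π (exchange x i' j')) with h' | h'
      · simp [h', h1, h2]
      · have := hπ.nonadj x i j i' j' hx hi hj hi' hj' h'
        tauto

theorem sum_adjm [Fintype V] {x : Finset α} (hx : x.card = e) (G : V → ℤ) :
    ∑ v, Γ.adjm (π x) v * G v = ∑ i ∈ x, ∑ j ∈ xᶜ, G (π (exchange x i j)) := by
  classical
  rw [← sum_product' (f := fun i j => G (π (exchange x i j)))]
  have h1 : ∑ v, Γ.adjm (π x) v * G v = ∑ v ∈ univ.filter (fun v => Γ.adjm (π x) v = 1), G v := by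
    rw [sum_filter]
    refine sum_congr rfl fun v _ => ?_
    rcases Γ.adjm_eq_or (π x) v with h | h <;> simp [h]
  rw [h1]
  symm
  refine sum_bij (fun p _ => π (exchange x p.1 p.2)) ?_ ?_ ?_ ?_
  · intro p hp
    rw [mem_product, mem_compl] at hp
    simpa using hπ.adj x _ _ hx hp.1 hp.2
  · intro p hp q hq hpq
    rw [mem_product, mem_compl] at hp hq
    exact Prod.ext_iff.2 (hπ.inj x _ _ _ _ hx hp.1 hp.2 hq.1 hq.2 hpq)
  · intro v hv
    obtain ⟨i, hi, j, hj, h⟩ := hπ.lift x v hx (by simpa using hv)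
    exact ⟨(i, j), by simp [hi, hj], h⟩
  · intro p _; rfl

end LocalCover

/-- Functions that vanish outside the edges of the underlying graph. -/
def Supported (Γ : Digraph V) (φ : V → V → ℤ) : Prop := ∀ x y, φ x y = Γ.adjm x y * φ x y

theorem supported_skew : Γ.Supported Γ.skew := fun x y => by
  rw [skew, adjm, sym]
  rcases Γ.arc_eq_or x y with h | h <;> rcases Γ.arc_eq_or y x with h' | h' <;> simp [h, h']

theorem supported_sym : Γ.Supported Γ.sym := fun x y => by
  rw [adjm, sym]
  rcases Γ.arc_eq_or x y with h | h <;> rcases Γ.arc_eq_or y x with h' | h' <;> simp [h, h']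

/-- On the edge from `x` to `y` this is the sum of `φ x v` over the two lines through `x, y`. -/
noncomputable def lines [Fintype V] (Γ : Digraph V) (φ : V → V → ℤ) (x y : V) : ℤ :=
  Γ.adjm x y * (conv φ Γ.adjm x y + 2 * φ x y)

section Lines

variable [Fintype V]

theorem supported_lines (φ : V → V → ℤ) : Γ.Supported (Γ.lines φ) := fun x y => by
  rw [lines]
  rcases Γ.adjm_eq_or x y with h | h <;> simp [h]

theorem isColor_lines (h : Γ.IsCWDR) {φ : V → V → ℤ} (hφ : Γ.IsColor φ) : Γ.IsColor (Γ.lines φ) :=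
  isColor_adjm.mul ((h.isColor_conv hφ isColor_adjm).add (hφ.const_mul 2))

/-- Reversing the edge moves φ to the other factor of the convolution; commutativity moves it back.
-/
theorem lines_swap (h : Γ.IsCWDR) {φ : V → V → ℤ} (hφ : Γ.IsColor φ) {c : ℤ}
    (hc : ∀ x y, φ y x = c * φ x y) (x y : V) : Γ.lines φ y x = c * Γ.lines φ x y := by
  have h1 : conv φ Γ.adjm y x = c * conv φ Γ.adjm x y := by
    rw [h.conv_comm hφ isColor_adjm x y, conv, conv, mul_sum]
    refine sum_congr rfl fun v _ => ?_
    rw [hc v y, adjm_swap x v]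
    ring
  rw [lines, lines, h1, hc x y, adjm_swap x y]
  ring

variable {e : ℕ} {π : Finset α → V} (hπ : LocalCover Γ e π)
include hπ

theorem LocalCover.sum_cell (x : Finset α) (hx : x.card = e) {φ : V → V → ℤ}
    (hs : Γ.Supported φ) (G : V → ℤ) :
    ∑ v, φ (π x) v * G v =
      ∑ i ∈ x, ∑ j ∈ xᶜ, φ (π x) (π (exchange x i j)) * G (π (exchange x i j)) := by
  rw [← hπ.sum_adjm hx (fun v => φ (π x) v * G v)]
  refine sum_congr rfl fun v _ => ?_
  rw [← mul_assoc, ← hs]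

/-- The common neighbours of both ends are the other cells of the row i and the column j. The term
`2 * φ x y` of `lines` restores the cell (i, j), once for each line. -/
theorem LocalCover.lines_eq (h : Γ.IsCWDR) {x : Finset α} {i j : α} (hx : x.card = e)
    (hi : i ∈ x) (hj : j ∉ x) {φ : V → V → ℤ} (hs : Γ.Supported φ) :
    Γ.lines φ (π x) (π (exchange x i j)) = rowSum φ π x i + colSum φ π x j := by
  rw [lines, hπ.adj x i j hx hi hj, conv, hπ.sum_cell x hx hs]
  have : ∀ i' ∈ x, ∀ j' ∈ xᶜ, φ (π x) (π (exchange x i' j')) *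
      Γ.adjm (π (exchange x i' j')) (π (exchange x i j)) =
      (if i' = i then φ (π x) (π (exchange x i' j')) else 0) +
      (if j' = j then φ (π x) (π (exchange x i' j')) else 0) -
      (if i' = i then if j' = j then 2 * φ (π x) (π (exchange x i' j')) else 0 else 0) := by
    intro i' hi' j' hj'
    rw [hπ.adjm_exchange h hx hi' (by simpa using hj') hi hj]
    by_cases h1 : i' = i <;> by_cases h2 : j' = j <;> simp [h1, h2]; ring
  rw [sum_congr rfl fun i' hi' => sum_congr rfl (this i' hi')]
  have hj' : j ∈ xᶜ := by simpa using hj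
  simp only [sum_add_distrib, sum_sub_distrib, sum_ite_irrel, sum_const_zero, sum_ite_eq' , hi, hj',
    if_true]
  rw [rowSum, colSum]
  ring

theorem LocalCover.sum_rowSum {x : Finset α} (hx : x.card = e) {φ : V → V → ℤ}
    (hs : Γ.Supported φ) : ∑ i ∈ x, rowSum φ π x i = ∑ v, φ (π x) v := by
  simpa [rowSum] using (hπ.sum_cell x hx hs fun _ => 1).symm

theorem LocalCover.sum_colSum {x : Finset α} (hx : x.card = e) {φ : V → V → ℤ}
    (hs : Γ.Supported φ) : ∑ j ∈ xᶜ, colSum φ π x j = ∑ v, φ (π x) v := by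
  rw [← hπ.sum_rowSum hx hs, sum_congr rfl fun j _ => by rw [colSum], sum_comm]
  rfl

end Lines

/-! ### Complementation -/

section Dual

variable {e : ℕ} {π : Finset α → V}

/-- Complementation exchanges rows and columns, so every later fact about row sums has a twin about
column sums. -/
theorem LocalCover.dual_of_card (hπ : LocalCover Γ e π) {d : ℕ} (hα : Fintype.card α = e + d) :
    LocalCover Γ d fun x => π xᶜ := by
  have hc : ∀ x : Finset α, x.card = d → xᶜ.card = e := fun x hx => by
    rw [card_compl]; omega
  have hex : ∀ {x : Finset α} {i j : α}, i ∈ x → j ∉ x →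
      (exchange x i j)ᶜ = exchange xᶜ j i := fun {x i j} hi hj => by
    rw [← compl_exchange (x := xᶜ) (by simpa using hj) (by simpa using hi), compl_compl]
  have hm : ∀ {x : Finset α} {i : α}, i ∈ x → i ∉ xᶜ := by simp
  have hm' : ∀ {x : Finset α} {i : α}, i ∉ x → i ∈ xᶜ := by simp
  refine ⟨fun v => ?_, ?_, ?_, ?_, ?_⟩
  · obtain ⟨x, hx, rfl⟩ := hπ.surj v
    exact ⟨xᶜ, by rw [card_compl]; omega, by rw [compl_compl]⟩
  · intro x i j hx hi hj
    rw [hex hi hj]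
    exact hπ.adj _ _ _ (hc x hx) (hm' hj) (hm hi)
  · intro x v hx hv
    obtain ⟨i, hi, j, hj, h⟩ := hπ.lift _ v (hc x hx) hv
    rw [mem_compl] at hi
    have hj' : j ∈ x := by simpa using hj
    exact ⟨j, hj', i, hi, by rw [hex hj' hi]; exact h⟩
  · intro x i j i' j' hx hi hj hi' hj' h
    rw [hex hi hj, hex hi' hj'] at h
    exact (hπ.inj _ _ _ _ _ (hc x hx) (hm' hj) (hm hi) (hm' hj') (hm hi') h).symm
  · intro x i j i' j' hx hi hj hi' hj' h
    rw [hex hi hj, hex hi' hj'] at h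
    exact (hπ.nonadj _ _ _ _ _ (hc x hx) (hm' hj) (hm hi) (hm' hj') (hm hi') h).symm

theorem LocalCover.dual (hπ : LocalCover Γ e π) (hα : Fintype.card α = 2 * e) :
    LocalCover Γ e fun x => π xᶜ :=
  hπ.dual_of_card (by omega)

theorem rowSum_dual (φ : V → V → ℤ) {x : Finset α} {i : α} (hi : i ∉ x) :
    rowSum φ (fun x => π xᶜ) xᶜ i = colSum φ π x i := by
  rw [rowSum, colSum, compl_compl]
  exact sum_congr rfl fun j hj => by rw [compl_exchange hj hi]

theorem colSum_dual (φ : V → V → ℤ) {x : Finset α} {i : α} (hi : i ∈ x) :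
    colSum φ (fun x => π xᶜ) xᶜ i = rowSum φ π x i := by
  rw [rowSum, colSum, compl_compl]
  exact sum_congr rfl fun j hj => by rw [compl_exchange hi (by simpa using hj)]

end Dual

/-! ### Line sums along cliques -/

section Cliques

variable [Fintype V] {e : ℕ} {π : Finset α → V} (hπ : LocalCover Γ e π)
include hπ

theorem LocalCover.lines_insert (h : Γ.IsCWDR) {w : Finset α} {i j : α} (hw : w.card + 1 = e)
    (hi : i ∉ w) (hj : j ∉ w) (hij : i ≠ j) {φ : V → V → ℤ} (hs : Γ.Supported φ) :
    Γ.lines φ (π (insert i w)) (π (insert j w)) =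
      rowSum φ π (insert i w) i + colSum φ π (insert i w) j := by
  rw [← hπ.lines_eq h (by rw [card_insert_of_notMem hi, hw]) (by simp)
    (by simp [hj, Ne.symm hij]) hs, exchange_insert hi]

/-- For a skew or symmetric `φ` the sums over the two lines of an edge, seen from both ends. -/
theorem LocalCover.rowSum_add_colSum (h : Γ.IsCWDR) {w : Finset α} {i j : α}
    (hw : w.card + 1 = e) (hi : i ∉ w) (hj : j ∉ w) (hij : i ≠ j) {φ : V → V → ℤ}
    (hφ : Γ.IsColor φ) (hs : Γ.Supported φ) {c : ℤ} (hc : ∀ x y, φ y x = c * φ x y) :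
    rowSum φ π (insert j w) j + colSum φ π (insert j w) i =
      c * (rowSum φ π (insert i w) i + colSum φ π (insert i w) j) := by
  rw [← hπ.lines_insert h hw hi hj hij hs, ← hπ.lines_insert h hw hj hi hij.symm hs,
    lines_swap h hφ hc]

omit [Fintype V] hπ in
-- The left side sums a skew function over all ordered pairs of points of one clique.
theorem sum_rowSum_insert {φ : V → V → ℤ} (hc : ∀ x y, φ y x = -φ x y) (w : Finset α) :
    ∑ i ∈ wᶜ, rowSum φ π (insert i w) i = 0 := by
  have h1 : ∀ i ∈ wᶜ, rowSum φ π (insert i w) i =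
      ∑ j ∈ wᶜ, φ (π (insert i w)) (π (insert j w)) := by
    intro i hi
    have h0 : φ (π (insert i w)) (π (insert i w)) = 0 := by
      have := hc (π (insert i w)) (π (insert i w)); omega
    rw [rowSum, compl_insert, ← add_sum_erase _ _ hi, h0, zero_add]
    exact sum_congr rfl fun j _ => by rw [exchange_insert (by simpa using hi)]
  have h2 := sum_congr rfl h1
  have h3 : ∑ i ∈ wᶜ, ∑ j ∈ wᶜ, φ (π (insert i w)) (π (insert j w)) =
      -∑ i ∈ wᶜ, ∑ j ∈ wᶜ, φ (π (insert i w)) (π (insert j w)) := by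
    conv_lhs => rw [sum_comm]
    simp only [← sum_neg_distrib]
    exact sum_congr rfl fun i _ => sum_congr rfl fun j _ => hc _ _
  omega

/-- A second application of `lines` weights a row sum by the number of columns, and a column sum by
the number of rows. This tells them apart when the numbers differ. -/
theorem LocalCover.rowSum_lines (h : Γ.IsCWDR) {x : Finset α} {i : α} (hx : x.card = e)
    (hi : i ∈ x) {φ : V → V → ℤ} (hs : Γ.Supported φ) :
    rowSum (Γ.lines φ) π x i =
      (xᶜ.card : ℤ) * rowSum φ π x i + ∑ v, φ (π x) v := by
  rw [rowSum, sum_congr rfl fun j hj => hπ.lines_eq h hx hi (by simpa using hj) hs,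
    sum_add_distrib, hπ.sum_colSum hx hs, sum_const, nsmul_eq_mul]

theorem LocalCover.colSum_lines (h : Γ.IsCWDR) {x : Finset α} {j : α} (hx : x.card = e)
    (hj : j ∉ x) {φ : V → V → ℤ} (hs : Γ.Supported φ) :
    colSum (Γ.lines φ) π x j = (e : ℤ) * colSum φ π x j + ∑ v, φ (π x) v := by
  rw [colSum, sum_congr rfl fun i hi => hπ.lines_eq h hx hi hj hs,
    sum_add_distrib, hπ.sum_rowSum hx hs, sum_const, nsmul_eq_mul, hx, add_comm]

end Cliques

end Digraph

namespace Digraph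

variable {V α : Type*} [DecidableEq α] [Fintype α] {Γ : Digraph V} [Fintype V] {e : ℕ}
  {π : Finset α → V}

/-! ### Lines of unequal sizes -/

section Unequal

theorem LocalCover.skew_lines_back (hπ : LocalCover Γ e π) (h : Γ.IsCWDR) {x : Finset α} {i j : α}
    (hx : x.card = e) (hi : i ∈ x) (hj : j ∉ x) {φ : V → V → ℤ} (hs : Γ.Supported φ) :
    Γ.lines φ (π (exchange x i j)) (π x) =
      rowSum φ π (exchange x i j) j + colSum φ π (exchange x i j) i := by
  have := hπ.lines_eq h (x := exchange x i j) (i := j) (j := i) (by rw [card_exchange hi hj, hx])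
    (by simp [mem_exchange]) (by rw [mem_exchange]; rintro (rfl | h'); exacts [hj hi, h'.1 rfl]) hs
  rwa [exchange_back hi hj] at this

/-- If the two kinds of lines have different sizes, all line sums of the skew adjacency function
vanish. -/
theorem LocalCover.skew_sums_eq_zero_of_ne (hπ : LocalCover Γ e π) (h : Γ.IsCWDR) (he : 2 ≤ e)
    (hα : e + 2 ≤ Fintype.card α) (hne : Fintype.card α ≠ 2 * e) {x : Finset α}
    (hx : x.card = e) :
    (∀ i ∈ x, rowSum Γ.skew π x i = 0) ∧ ∀ j ∉ x, colSum Γ.skew π x j = 0 := by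
  have hsw : ∀ u v, Γ.skew v u = (-1) * Γ.skew u v := fun u v => by rw [skew_swap u v]; ring
  have hF := isColor_lines h (isColor_skew (Γ := Γ))
  have hFsw := lines_swap h (isColor_skew (Γ := Γ)) hsw
  have hG := lines_swap h hF hFsw
  have hcc : ∀ x : Finset α, x.card = e → (xᶜ.card : ℤ) = Fintype.card α - e := fun x hx => by
    rw [card_compl, hx]; push_cast [show e ≤ Fintype.card α by omega]; ring
  have hsum : ∀ x : Finset α, ∑ v, Γ.lines Γ.skew (π x) v = Fintype.card V * 0 := by
    intro x
    have h1 := h.sum_row hF (π x) (π x)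
    rw [sum_congr rfl fun v _ => hFsw (π x) v, ← mul_sum] at h1
    omega
  -- Write n for the cardinality of `α`. Both R + C and (n - e) R + e C change sign when the edge is
  -- reversed, since the totals of `skew` vanish. As n - e ≠ e, this holds for R and C separately.
  have key : ∀ x : Finset α, x.card = e → ∀ i ∈ x, ∀ j ∉ x,
      (rowSum Γ.skew π (exchange x i j) j = -rowSum Γ.skew π x i) ∧
      (colSum Γ.skew π (exchange x i j) i = -colSum Γ.skew π x j) := by
    intro x hx i hi j hj
    have hy : (exchange x i j).card = e := by rw [card_exchange hi hj, hx]
    have hiy : i ∉ exchange x i j := by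
      rw [mem_exchange]; rintro (rfl | h'); exacts [hj hi, h'.1 rfl]
    have hjy : j ∈ exchange x i j := by simp [mem_exchange]
    have e1 := hFsw (π x) (π (exchange x i j))
    have e2 := hG (π x) (π (exchange x i j))
    rw [hπ.lines_eq h hx hi hj supported_skew, hπ.skew_lines_back h hx hi hj supported_skew] at e1
    rw [hπ.lines_eq h hx hi hj (supported_lines _),
      hπ.skew_lines_back h hx hi hj (supported_lines _),
      hπ.rowSum_lines h hx hi supported_skew, hπ.colSum_lines h hx hj supported_skew,
      hπ.rowSum_lines h hy hjy supported_skew, hπ.colSum_lines h hy hiy supported_skew,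
      h.sum_skew, h.sum_skew, hcc x hx, hcc _ hy] at e2
    have hne' : (Fintype.card α : ℤ) - 2 * e ≠ 0 := by
      intro h0; apply hne; omega
    constructor
    · apply mul_left_cancel₀ hne'
      linear_combination e2 - (e : ℤ) * e1
    · apply mul_left_cancel₀ hne'
      linear_combination (Fintype.card α - e : ℤ) * e1 - e2
  constructor
  · intro i hi
    -- On three points of one clique the sum changes sign along each of the three edges, so it
    -- equals its own negative.
    obtain ⟨j, hj, k, hk, hjk⟩ := one_lt_card.1
      (show 1 < xᶜ.card by rw [card_compl, hx]; omega)
    rw [mem_compl] at hj hk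
    have h1 := (key x hx i hi j hj).1
    have h2 := (key x hx i hi k hk).1
    have h3 := (key (exchange x i j) (by rw [card_exchange hi hj, hx]) j (by simp [mem_exchange]) k
      (by simp [mem_exchange, hk, Ne.symm hjk])).1
    rw [exchange_exchange_same hj] at h3
    omega
  · intro j hj
    obtain ⟨i, hi, k, hk, hik⟩ := one_lt_card.1 (show 1 < x.card by omega)
    have h1 := (key x hx i hi j hj).2
    have h2 := (key x hx k hk j hj).2
    have h3 := (key (exchange x i j) (by rw [card_exchange hi hj, hx]) k
      (by simp [mem_exchange, hk, Ne.symm hik]) i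
      (by rw [mem_exchange]; rintro (rfl | h'); exacts [hj hi, h'.1 rfl])).2
    rw [exchange_exchange_col hi hk (Ne.symm hik) hj] at h3
    omega

end Unequal

/-! ### Lines of equal sizes: the sum of squares -/

section Equal

/-- On an edge whose lines have equal sizes `e + 1`, this is `e ^ 2` times the sum of the squares of
the two line sums of `φ`. -/
noncomputable def squares (Γ : Digraph V) (e : ℕ) (φ : V → V → ℤ) (u v : V) : ℤ :=
  e * Γ.lines (fun a b => Γ.lines φ a b * Γ.lines φ a b) u v -
    ∑ t, Γ.lines φ u t * Γ.lines φ u t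

theorem sum_const_of_symm (h : Γ.IsCWDR) {φ : V → V → ℤ} (hφ : Γ.IsColor φ)
    (hsy : ∀ x y, φ y x = φ x y) (u v : V) : ∑ t, φ u t = ∑ t, φ v t := by
  rw [h.sum_row hφ u v]
  exact sum_congr rfl fun t _ => hsy _ _

theorem isColor_lines_sq (h : Γ.IsCWDR) {φ : V → V → ℤ} (hφ : Γ.IsColor φ) :
    Γ.IsColor fun a b => Γ.lines φ a b * Γ.lines φ a b :=
  (isColor_lines h hφ).mul (isColor_lines h hφ)

theorem lines_sq_swap (h : Γ.IsCWDR) {φ : V → V → ℤ} (hφ : Γ.IsColor φ)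
    (hc : ∀ x y, φ y x = -φ x y) (x y : V) :
    Γ.lines φ y x * Γ.lines φ y x = Γ.lines φ x y * Γ.lines φ x y := by
  rw [lines_swap h hφ (c := -1) (fun a b => by rw [hc a b]; ring)]
  ring

theorem isColor_squares (h : Γ.IsCWDR) {φ : V → V → ℤ} (hφ : Γ.IsColor φ)
    (hc : ∀ x y, φ y x = -φ x y) : Γ.IsColor (Γ.squares e φ) :=
  ((isColor_lines h (isColor_lines_sq h hφ)).const_mul e).sub fun x _ x' _ _ =>
    sum_const_of_symm h (isColor_lines_sq h hφ) (lines_sq_swap h hφ hc) x x'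

theorem squares_swap (h : Γ.IsCWDR) {φ : V → V → ℤ} (hφ : Γ.IsColor φ)
    (hc : ∀ x y, φ y x = -φ x y) (x y : V) : Γ.squares e φ y x = Γ.squares e φ x y := by
  rw [squares, squares, sum_const_of_symm h (isColor_lines_sq h hφ) (lines_sq_swap h hφ hc) y x,
    lines_swap h (isColor_lines_sq h hφ) (c := 1) (fun a b => by
      rw [one_mul]; exact lines_sq_swap h hφ hc a b), one_mul]

theorem supported_lines_sq (φ : V → V → ℤ) :
    Γ.Supported fun a b => Γ.lines φ a b * Γ.lines φ a b := fun x y => by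
  have := supported_lines (Γ := Γ) φ x y
  rw [← mul_assoc, ← this]

theorem sum_eq_zero_of_skew (h : Γ.IsCWDR) {φ : V → V → ℤ} (hφ : Γ.IsColor φ)
    (hc : ∀ x y, φ y x = -φ x y) (x : V) : ∑ v, φ x v = 0 := by
  have h1 := h.sum_row hφ x x
  rw [sum_congr rfl fun v _ => hc x v, sum_neg_distrib] at h1
  omega

/-- As the R and the C at x have total 0, the mixed terms disappear when (R + C)² is summed over a
line. Equal numbers of rows and columns make the leftover ∑ R² + ∑ C² the one subtracted in
`squares`. -/
theorem LocalCover.squares_eq (hπ : LocalCover Γ e π) (h : Γ.IsCWDR)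
    (hα : Fintype.card α = 2 * e) {x : Finset α} {i j : α} (hx : x.card = e) (hi : i ∈ x)
    (hj : j ∉ x) {φ : V → V → ℤ} (hφ : Γ.IsColor φ) (hs : Γ.Supported φ)
    (hc : ∀ x y, φ y x = -φ x y) :
    Γ.squares e φ (π x) (π (exchange x i j)) =
      (e : ℤ) ^ 2 * (rowSum φ π x i ^ 2 + colSum φ π x j ^ 2) := by
  have hcc : (xᶜ.card : ℤ) = e := by rw [card_compl, hx, hα]; congr 1; omega
  have h0 := sum_eq_zero_of_skew h hφ hc (π x)
  have hR := hπ.sum_rowSum hx hs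
  have hC := hπ.sum_colSum hx hs
  rw [h0] at hR hC
  have h1 : ∀ i ∈ x, rowSum (fun a b => Γ.lines φ a b * Γ.lines φ a b) π x i =
      e * rowSum φ π x i ^ 2 + ∑ k ∈ xᶜ, colSum φ π x k ^ 2 := by
    intro i hi
    rw [rowSum, sum_congr rfl fun k hk => by
      rw [hπ.lines_eq h hx hi (by simpa using hk) hs]]
    rw [sum_congr rfl (g := fun k => rowSum φ π x i ^ 2 + (2 * rowSum φ π x i * colSum φ π x k +
      colSum φ π x k ^ 2)) fun k _ => by ring]
    rw [sum_add_distrib, sum_add_distrib, ← mul_sum, hC, sum_const, nsmul_eq_mul, hcc]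
    ring
  have h2 : colSum (fun a b => Γ.lines φ a b * Γ.lines φ a b) π x j =
      e * colSum φ π x j ^ 2 + ∑ k ∈ x, rowSum φ π x k ^ 2 := by
    rw [colSum, sum_congr rfl fun k hk => by rw [hπ.lines_eq h hx hk hj hs]]
    rw [sum_congr rfl (g := fun k => rowSum φ π x k ^ 2 + (2 * colSum φ π x j * rowSum φ π x k +
      colSum φ π x j ^ 2)) fun k _ => by ring]
    rw [sum_add_distrib, sum_add_distrib, ← mul_sum, hR, sum_const, nsmul_eq_mul, hx]
    ring
  have h3 : ∑ t, Γ.lines φ (π x) t * Γ.lines φ (π x) t =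
      e * ∑ k ∈ x, rowSum φ π x k ^ 2 + e * ∑ k ∈ xᶜ, colSum φ π x k ^ 2 := by
    rw [← hπ.sum_rowSum hx (supported_lines_sq φ), sum_congr rfl h1, sum_add_distrib, ← mul_sum,
      sum_const, nsmul_eq_mul, hx]
  rw [squares, h3, hπ.lines_eq h hx hi hj (supported_lines_sq φ), h1 i hi, h2]
  ring

theorem LocalCover.squares_insert (hπ : LocalCover Γ e π) (h : Γ.IsCWDR)
    (hα : Fintype.card α = 2 * e) {w : Finset α} {i j : α} (hw : w.card + 1 = e)
    (hi : i ∉ w) (hj : j ∉ w) (hij : i ≠ j) {φ : V → V → ℤ} (hφ : Γ.IsColor φ)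
    (hs : Γ.Supported φ) (hc : ∀ x y, φ y x = -φ x y) :
    Γ.squares e φ (π (insert i w)) (π (insert j w)) =
      (e : ℤ) ^ 2 * (rowSum φ π (insert i w) i ^ 2 + colSum φ π (insert i w) j ^ 2) := by
  rw [← hπ.squares_eq h hα (by rw [card_insert_of_notMem hi, hw]) (by simp)
    (by simp [hj, Ne.symm hij]) hφ hs hc, exchange_insert hi]

end Equal

end Digraph

/-! ### Arithmetic of the line sums on one clique -/

/-- The relations between the sums `f i` of a skew function over a clique `P`, seen from its points
`i`, and the sums `g i j` over the other clique containing `i` and `j`, seen from `i`. -/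
structure LineData {α : Type*} [DecidableEq α] (P : Finset α) (f : α → ℤ) (g : α → α → ℤ) :
    Prop where
  anti : ∀ i ∈ P, ∀ j ∈ P, i ≠ j → f j + g j i = -(f i + g i j)
  sq : ∀ i ∈ P, ∀ j ∈ P, i ≠ j → f j ^ 2 + g j i ^ 2 = f i ^ 2 + g i j ^ 2
  sum_cross : ∀ i ∈ P, ∑ j ∈ P.erase i, g i j = 0
  sum_self : ∑ i ∈ P, f i = 0

namespace LineData

variable {α : Type*} [DecidableEq α] {P : Finset α} {f : α → ℤ} {g : α → α → ℤ}

theorem neg (hL : LineData P f g) : LineData P (fun i => -f i) fun i j => -g i j where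
  anti i hi j hj hij := by have := hL.anti i hi j hj hij; omega
  sq i hi j hj hij := by have := hL.sq i hi j hj hij; simpa using this
  sum_cross i hi := by have := hL.sum_cross i hi; simpa using this
  sum_self := by have := hL.sum_self; simpa using this

variable (hL : LineData P f g)
include hL

/-- The pairs (f j, g j i) and (-f i, -g i j) have equal sums and equal sums of squares, so they
agree up to order. The matching f j = -f i is excluded, which leaves the crossed one. -/
theorem cross_of_add_ne {i j : α} (hi : i ∈ P) (hj : j ∈ P) (hij : i ≠ j) (hs : f i + f j ≠ 0) :
    g i j = -f j := by
  have h1 := hL.anti i hi j hj hij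
  have h2 := hL.sq i hi j hj hij
  have h3 : (f i + f j) * (2 * (g i j + f j)) = 0 := by
    have h4 : g j i = -(f i + g i j) - f j := by omega
    rw [h4] at h2
    linear_combination h2
  rcases mul_eq_zero.1 h3 with h | h
  · exact absurd h hs
  · omega

theorem cross_swap {i j : α} (hi : i ∈ P) (hj : j ∈ P) (hij : i ≠ j) (hs : f i + f j = 0) :
    g j i = -g i j := by
  have h1 := hL.anti i hi j hj hij
  omega

/-- Off the fibre f = -v the cross sums are g i j = -f j. Comparing ∑ g i j = 0 with ∑ f = 0 leaves
a condition on that fibre alone. -/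
theorem sum_deficit {i : α} (hi : i ∈ P) {v : ℤ} (hv : v ≠ 0) (hf : f i = v) :
    ∑ j ∈ P with f j = -v, (v - g i j) = v := by
  have h1 := hL.sum_cross i hi
  have h2 := hL.sum_self
  rw [← add_sum_erase _ _ hi] at h2
  have hsub : (P.filter fun j => f j = -v) = (P.erase i).filter fun j => f j = -v := by
    ext j
    simp only [mem_filter, mem_erase]
    constructor
    · rintro ⟨hj, hj'⟩
      exact ⟨⟨fun h => hv (by rw [h] at hj'; omega), hj⟩, hj'⟩
    · rintro ⟨hj, hj'⟩
      exact ⟨hj.2, hj'⟩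
  rw [hsub]
  rw [← sum_filter_add_sum_filter_not _ (fun j => f j = -v)] at h1 h2
  have h3 : ∑ j ∈ (P.erase i).filter (fun j => ¬ f j = -v), g i j =
      -∑ j ∈ (P.erase i).filter (fun j => ¬ f j = -v), f j := by
    rw [← sum_neg_distrib]
    refine sum_congr rfl fun j hj => ?_
    rw [mem_filter, mem_erase] at hj
    exact hL.cross_of_add_ne hi hj.1.2 (Ne.symm hj.1.1) (by rw [hf]; intro h0; exact hj.2 (by omega))
  have h4 : ∑ j ∈ (P.erase i).filter (fun j => f j = -v), (v - g i j) =
      -∑ j ∈ (P.erase i).filter (fun j => f j = -v), f j -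
        ∑ j ∈ (P.erase i).filter (fun j => f j = -v), g i j := by
    rw [← sum_neg_distrib, ← sum_sub_distrib]
    refine sum_congr rfl fun j hj => ?_
    rw [mem_filter] at hj
    omega
  omega

theorem sum_excess {i : α} (hi : i ∈ P) {v : ℤ} (hv : v ≠ 0) (hf : f i = -v) :
    ∑ j ∈ P with f j = v, (v + g i j) = v := by
  have h1 := hL.sum_deficit hi (neg_ne_zero.2 hv) hf
  rw [neg_neg] at h1
  have h2 : ∑ j ∈ P with f j = v, (v + g i j) = -∑ j ∈ P with f j = v, (-v - g i j) := by
    rw [← sum_neg_distrib]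
    exact sum_congr rfl fun _ _ => by ring
  rw [h2, h1, neg_neg]

/-- Double counting of the deficits v - g i j over the pairs with f i = v and f j = -v: each i
contributes v, and, since g j i = -g i j, so does each j. -/
theorem card_eq_card_neg {v : ℤ} (hv : v ≠ 0) :
    (P.filter fun i => f i = v).card = (P.filter fun i => f i = -v).card := by
  have h1 : ∑ i ∈ P with f i = v, ∑ j ∈ P with f j = -v, (v - g i j) =
      (P.filter fun i => f i = v).card * v := by
    rw [sum_congr rfl fun i hi => hL.sum_deficit (mem_filter.1 hi).1 hv (mem_filter.1 hi).2]
    simp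
  have h2 : ∑ j ∈ P with f j = -v, ∑ i ∈ P with f i = v, (v - g i j) =
      (P.filter fun i => f i = -v).card * v := by
    rw [sum_congr rfl (g := fun _ => v)]
    · simp
    · intro j hj
      rw [mem_filter] at hj
      have h3 := hL.sum_deficit hj.1 (neg_ne_zero.2 hv) hj.2
      rw [neg_neg] at h3
      have h4 : ∑ i ∈ P with f i = v, (v - g i j) = -∑ i ∈ P with f i = v, (-v - g j i) := by
        rw [← sum_neg_distrib]
        refine sum_congr rfl fun i hi => ?_
        rw [mem_filter] at hi
        have := hL.cross_swap hi.1 hj.1 (fun h => hv (by rw [h] at hi; omega)) (by omega)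
        omega
      omega
  rw [sum_comm, h2] at h1
  exact_mod_cast (mul_right_cancel₀ hv h1).symm

/-- The deficits are nonnegative and add up to m, so none of them exceeds m. -/
theorem cross_nonneg {m : ℤ} (hm : 0 < m) {i j : α} (hi : i ∈ P) (hj : j ∈ P) (hfi : f i = m)
    (hfj : f j = -m) (hg : ∀ k ∈ P, k ≠ i → g i k ≤ m) : 0 ≤ g i j := by
  have h1 := hL.sum_deficit hi hm.ne' hfi
  have h2 := single_le_sum (s := P.filter fun j => f j = -m) (f := fun j => m - g i j)
    (fun k hk => ?_) (mem_filter.2 ⟨hj, hfj⟩)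
  · simp only [h1] at h2
    omega
  · rw [mem_filter] at hk
    have := hg k hk.1 (fun h => by rw [h] at hk; omega)
    omega

end LineData

namespace Digraph

variable {V α : Type*} [DecidableEq α] [Fintype α] {Γ : Digraph V} {e : ℕ} {π : Finset α → V}

/-- Skew-symmetric functions that depend only on the two-way distance and vanish outside the edges. -/
structure SkewColor (Γ : Digraph V) (φ : V → V → ℤ) : Prop where
  color : Γ.IsColor φ
  supp : Γ.Supported φ
  swap : ∀ x y, φ y x = -φ x y

theorem skewColor_skew : Γ.SkewColor Γ.skew := ⟨isColor_skew, supported_skew, skew_swap⟩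

theorem SkewColor.self {φ : V → V → ℤ} (hφ : Γ.SkewColor φ) (x : V) : φ x x = 0 := by
  have := hφ.swap x x; omega

theorem SkewColor.rowSum_insert {φ : V → V → ℤ} (hφ : Γ.SkewColor φ) {w : Finset α} {i : α}
    (hi : i ∉ w) :
    rowSum φ π (insert i w) i = ∑ j ∈ wᶜ, φ (π (insert i w)) (π (insert j w)) := by
  rw [rowSum, compl_insert, ← add_sum_erase wᶜ _ (mem_compl.2 hi), hφ.self, zero_add]
  exact sum_congr rfl fun j _ => by rw [exchange_insert hi]

variable [Fintype V]

theorem LocalCover.lineData (hπ : LocalCover Γ e π) (h : Γ.IsCWDR) (hα : Fintype.card α = 2 * e)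
    {φ : V → V → ℤ} (hφ : Γ.SkewColor φ) {w : Finset α} (hw : w.card + 1 = e) :
    LineData wᶜ (fun i => rowSum φ π (insert i w) i) fun i j => colSum φ π (insert i w) j where
  anti i hi j hj hij := by
    rw [mem_compl] at hi hj
    have := hπ.rowSum_add_colSum h hw hi hj hij hφ.color hφ.supp (c := -1)
      (fun x y => by rw [hφ.swap x y]; ring)
    simpa using this
  sq i hi j hj hij := by
    rw [mem_compl] at hi hj
    have h1 := hπ.squares_insert h hα hw hi hj hij hφ.color hφ.supp hφ.swap
    have h2 := hπ.squares_insert h hα hw hj hi hij.symm hφ.color hφ.supp hφ.swap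
    rw [squares_swap h hφ.color hφ.swap, h1] at h2
    have he : (e : ℤ) ^ 2 ≠ 0 := by
      rw [← hw]; positivity
    exact (mul_left_cancel₀ he h2).symm
  sum_cross i hi := by
    rw [mem_compl] at hi
    rw [← compl_insert, hπ.sum_colSum (by rw [card_insert_of_notMem hi, hw]) hφ.supp]
    exact sum_eq_zero_of_skew h hφ.color hφ.swap _
  sum_self := sum_rowSum_insert hφ.swap w

/-! ### Arcs in no short directed cycle -/

section Far

/-- An arc from `x` to `y` that lies in no directed cycle of length at most three. -/
def Far (Γ : Digraph V) (x y : V) : Prop :=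
  Γ.Adj x y ∧ ¬ Γ.Adj y x ∧ ∀ t, Γ.Adj y t → ¬ Γ.Adj t x

omit [Fintype V] in
theorem far_iff (h : Γ.IsCWDR) {x y : V} : Γ.Far x y ↔ Γ.Adj x y ∧ 3 ≤ Γ.distance y x := by
  constructor
  · rintro ⟨h1, h2, h3⟩
    refine ⟨h1, ?_⟩
    by_contra hlt
    have hc : Γ.distance y x = 0 ∨ Γ.distance y x = 1 ∨ Γ.distance y x = 2 := by omega
    rcases hc with hc | hc | hc
    · rw [h.wdr.stronglyConnected.distance_eq_zero] at hc
      exact h2 (hc ▸ h1)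
    · exact h2 (h.wdr.distance_eq_one.1 hc)
    · obtain ⟨t, h4, h5⟩ := h.wdr.stronglyConnected.exists_of_distance hc
      exact h3 t h4 h5
  · rintro ⟨h1, h2⟩
    refine ⟨h1, fun h3 => ?_, fun t h3 h4 => ?_⟩
    · rw [← h.wdr.distance_eq_one] at h3; omega
    · have := distance_le ((hasPath_one h3).trans (hasPath_one h4)); omega

omit [Fintype V] [Fintype α] [DecidableEq α] in
/-- The three kinds of arcs. -/
theorem arc_cases (h : Γ.IsCWDR) {x y : V} (hxy : Γ.Adj x y) :
    Γ.twoWayDistance x y = (1, 1) ∨ Γ.twoWayDistance x y = (1, 2) ∨ Γ.Far x y := by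
  have h1 := h.wdr.distance_eq_one.2 hxy
  have h2 : Γ.distance y x ≠ 0 := fun h0 => by
    rw [h.wdr.stronglyConnected.distance_eq_zero] at h0
    exact h.wdr.loopless x (h0 ▸ hxy)
  by_cases h3 : 3 ≤ Γ.distance y x
  · exact Or.inr (Or.inr ((far_iff h).2 ⟨hxy, h3⟩))
  · have : Γ.distance y x = 1 ∨ Γ.distance y x = 2 := by omega
    simp only [twoWayDistance, h1, Prod.mk.injEq, true_and]
    tauto

omit [Fintype V] [Fintype α] in
theorem LocalCover.adjm_insert (hπ : LocalCover Γ e π) {w : Finset α}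
    (hw : w.card + 1 = e) {i j : α} (hi : i ∉ w) (hj : j ∉ w) (hij : i ≠ j) :
    Γ.adjm (π (insert i w)) (π (insert j w)) = 1 := by
  have := hπ.adj (insert i w) i j (by rw [card_insert_of_notMem hi, hw]) (by simp)
    (by simp [hj, hij.symm])
  rwa [exchange_insert hi] at this

omit [Fintype V] in
theorem Far.skew_eq_one (h : Γ.IsCWDR) {x y : V} (hf : Γ.Far x y) : Γ.skew x y = 1 :=
  (Digraph.skew_eq_one h).2 ⟨hf.1, hf.2.1⟩

omit [Fintype V] in
-- No directed triangle contains the arc, so no third point k has a smaller `skew` value seen from i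
-- than seen from j. The points i and j themselves contribute 1 each to the difference.
theorem Far.rowSum_lt (hπ : LocalCover Γ e π) (h : Γ.IsCWDR) {w : Finset α}
    (hw : w.card + 1 = e) {i j : α} (hi : i ∉ w) (hj : j ∉ w) (hij : i ≠ j)
    (hf : Γ.Far (π (insert i w)) (π (insert j w))) :
    rowSum Γ.skew π (insert j w) j + 2 ≤ rowSum Γ.skew π (insert i w) i := by
  rw [skewColor_skew.rowSum_insert hi, skewColor_skew.rowSum_insert hj]
  have h1 : ∑ k ∈ wᶜ, ((if k = i then 1 else 0) + (if k = j then 1 else 0) : ℤ) ≤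
      ∑ k ∈ wᶜ, (Γ.skew (π (insert i w)) (π (insert k w)) -
        Γ.skew (π (insert j w)) (π (insert k w))) := by
    refine sum_le_sum fun k hk => ?_
    rw [mem_compl] at hk
    have hs := hf.skew_eq_one h
    by_cases hki : k = i
    · subst hki
      simp [hij, skewColor_skew.self, skew_swap (π (insert k w)) (π (insert j w)), hs]
    by_cases hkj : k = j
    · subst hkj
      simp [hki, skewColor_skew.self, hs]
    simp only [hki, hkj, if_false, add_zero, sub_nonneg]
    have h2 := (adjm_eq_one h).1 (hπ.adjm_insert hw hi hk (Ne.symm hki))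
    have h3 := (adjm_eq_one h).1 (hπ.adjm_insert hw hj hk (Ne.symm hkj))
    have h4 := hf.2.2 (π (insert k w))
    rcases Γ.skew_eq_or (π (insert j w)) (π (insert k w)) with h5 | h5 | h5 <;>
    rcases Γ.skew_eq_or (π (insert i w)) (π (insert k w)) with h6 | h6 | h6 <;> try omega
    · have h7 := (skew_eq_neg_one h).1 h6
      have : ¬ Γ.Adj (π (insert j w)) (π (insert k w)) := fun h8 => h4 h8 h7.1
      have := (skew_eq_neg_one h).2 ⟨by tauto, this⟩
      omega
    · have h7 := (Digraph.skew_eq_one h).1 h5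
      have : ¬ Γ.Adj (π (insert k w)) (π (insert i w)) := h4 h7.1
      have := (Digraph.skew_eq_one h).2 ⟨by tauto, this⟩
      omega
    · have h7 := (Digraph.skew_eq_one h).1 h5
      have h8 := (skew_eq_neg_one h).1 h6
      exact absurd h8.1 (h4 h7.1)
  rw [sum_sub_distrib, sum_add_distrib] at h1
  simp only [sum_ite_eq', mem_compl, hi, hj, not_false_eq_true, if_true] at h1
  omega

/-- The clique containing an edge of a given clique and lying in the other family. -/
theorem exists_dual_clique (hα : Fintype.card α = 2 * e) {w : Finset α} (hw : w.card + 1 = e)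
    {i j : α} (hi : i ∉ w) (hj : j ∉ w) (hij : i ≠ j) :
    ∃ u : Finset α, u.card + 1 = e ∧ i ∉ u ∧ j ∉ u ∧ insert j u = (insert i w)ᶜ ∧
      insert i u = (insert j w)ᶜ := by
  refine ⟨(insert i (insert j w))ᶜ, ?_, by simp, by simp, ?_, ?_⟩
  · rw [card_compl, card_insert_of_notMem (by simp [hij, hi]), card_insert_of_notMem hj, hα]
    omega
  · ext a; simp only [mem_insert, mem_compl]; grind
  · ext a; simp only [mem_insert, mem_compl]; grind

omit [Fintype V] in
theorem Far.colSum_lt (hπ : LocalCover Γ e π) (h : Γ.IsCWDR) (hα : Fintype.card α = 2 * e)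
    {w : Finset α} (hw : w.card + 1 = e) {i j : α} (hi : i ∉ w) (hj : j ∉ w) (hij : i ≠ j)
    (hf : Γ.Far (π (insert i w)) (π (insert j w))) :
    colSum Γ.skew π (insert j w) i + 2 ≤ colSum Γ.skew π (insert i w) j := by
  obtain ⟨u, hu, hiu, hju, h1, h2⟩ := exists_dual_clique hα hw hi hj hij
  rw [← rowSum_dual Γ.skew (x := insert j w) (i := i) (by simp [hi, hij]),
    ← rowSum_dual Γ.skew (x := insert i w) (i := j) (by simp [hj, hij.symm]), ← h1, ← h2]
  refine Far.rowSum_lt (hπ.dual hα) h hu hju hiu hij.symm ?_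
  simpa [h1, h2] using hf

/-- On arcs that lie in no directed triangle the sums over the lines decrease. -/
theorem Far.two_le_lines (hπ : LocalCover Γ e π) (h : Γ.IsCWDR) (hα : Fintype.card α = 2 * e)
    {w : Finset α} (hw : w.card + 1 = e) {i j : α} (hi : i ∉ w) (hj : j ∉ w) (hij : i ≠ j)
    (hf : Γ.Far (π (insert i w)) (π (insert j w))) :
    2 ≤ Γ.lines Γ.skew (π (insert i w)) (π (insert j w)) := by
  have h1 := Far.rowSum_lt hπ h hw hi hj hij hf
  have h2 := Far.colSum_lt hπ h hα hw hi hj hij hf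
  -- Both sums drop by at least 2 along the arc, while their total only changes sign.
  have h3 := hπ.rowSum_add_colSum h hw hi hj hij isColor_skew supported_skew (c := -1)
    (fun x y => by rw [skew_swap x y]; ring)
  rw [hπ.lines_insert h hw hi hj hij supported_skew]
  omega

omit [Fintype V] [Fintype α] in
theorem LocalCover.exists_insert_of_adjm (hπ : LocalCover Γ e π) {x y : V}
    (hxy : Γ.adjm x y = 1) : ∃ w i j, w.card + 1 = e ∧ i ∉ w ∧ j ∉ w ∧ i ≠ j ∧
      π (insert i w) = x ∧ π (insert j w) = y := by
  obtain ⟨x, hx, rfl⟩ := hπ.surj x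
  obtain ⟨i, hi, j, hj, rfl⟩ := hπ.lift x y hx hxy
  exact ⟨x.erase i, i, j, by rw [card_erase_add_one hi, hx], by simp, by simp [hj],
    fun h => hj (h ▸ hi), by rw [insert_erase hi], rfl⟩

theorem LocalCover.two_le_lines_of_far (hπ : LocalCover Γ e π) (h : Γ.IsCWDR)
    (hα : Fintype.card α = 2 * e) {x y : V} (hf : Γ.Far x y) : 2 ≤ Γ.lines Γ.skew x y := by
  obtain ⟨w, i, j, hw, hi, hj, hij, rfl, rfl⟩ :=
    hπ.exists_insert_of_adjm ((adjm_eq_one h).2 (Or.inl hf.1))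
  exact hf.two_le_lines hπ h hα hw hi hj hij

end Far

end Digraph

theorem sum_sum_eq_zero_of_skew {β : Type*} (s : Finset β) (φ : β → β → ℤ)
    (hφ : ∀ x y, φ y x = -φ x y) : ∑ v ∈ s, ∑ k ∈ s, φ v k = 0 := by
  have h : ∑ v ∈ s, ∑ k ∈ s, φ v k = -∑ v ∈ s, ∑ k ∈ s, φ v k := by
    conv_lhs => rw [sum_comm]
    simp only [← sum_neg_distrib]
    exact sum_congr rfl fun i _ => sum_congr rfl fun j _ => hφ _ _
  omega

/-! ### Cliques attaining the maximal line sum -/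

namespace Digraph

variable {V α : Type*} [DecidableEq α] [Fintype α] {Γ : Digraph V} {e : ℕ} {π : Finset α → V}

/-- The sum of the skew adjacency function over the clique of all `π (insert j w)`, seen from
`π (insert i w)`. -/
noncomputable def lineSum (Γ : Digraph V) (π : Finset α → V) (w : Finset α) (i : α) : ℤ :=
  rowSum Γ.skew π (insert i w) i

/-- The sum of the skew adjacency function over the other clique containing `π (insert i w)` and
`π (insert j w)`, seen from the former. -/
noncomputable def crossSum (Γ : Digraph V) (π : Finset α → V) (w : Finset α) (i j : α) : ℤ :=
  colSum Γ.skew π (insert i w) j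

/-- The number `m` is positive and bounds all line sums of the skew adjacency function. -/
structure BoundedSums (Γ : Digraph V) (e : ℕ) (π : Finset α → V) (m : ℤ) : Prop where
  cwdr : Γ.IsCWDR
  cover : LocalCover Γ e π
  card : Fintype.card α = 2 * e
  two_le : 2 ≤ e
  pos : 0 < m
  row : ∀ x : Finset α, x.card = e → ∀ i ∈ x, |rowSum Γ.skew π x i| ≤ m
  col : ∀ x : Finset α, x.card = e → ∀ j ∉ x, |colSum Γ.skew π x j| ≤ m

namespace BoundedSums

variable {m : ℤ} (H : BoundedSums Γ e π m)
include H

theorem dual : BoundedSums Γ e (fun x => π xᶜ) m where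
  cwdr := H.cwdr
  cover := H.cover.dual H.card
  card := H.card
  two_le := H.two_le
  pos := H.pos
  row x hx i hi := by
    have := H.col xᶜ (by rw [card_compl, hx, H.card]; omega) i (by simpa using hi)
    rwa [← rowSum_dual _ (by simpa using hi), compl_compl] at this
  col x hx i hi := by
    have := H.row xᶜ (by rw [card_compl, hx, H.card]; omega) i (by simpa using hi)
    rwa [← colSum_dual _ (by simpa using hi), compl_compl] at this

variable {w : Finset α} (hw : w.card + 1 = e)
include hw

theorem card_compl_line : (wᶜ).card = e + 1 := by rw [card_compl, H.card]; omega

theorem lineSum_le {i : α} (hi : i ∉ w) : |lineSum Γ π w i| ≤ m :=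
  H.row _ (by rw [card_insert_of_notMem hi, hw]) i (by simp)

theorem crossSum_le {i j : α} (hi : i ∉ w) (hj : j ∉ w) (hij : i ≠ j) :
    |crossSum Γ π w i j| ≤ m :=
  H.col _ (by rw [card_insert_of_notMem hi, hw]) j (by simp [hj, hij.symm])

variable [Fintype V]

theorem lineData : LineData wᶜ (lineSum Γ π w) (crossSum Γ π w) :=
  H.cover.lineData H.cwdr H.card skewColor_skew hw

theorem lines_eq {i j : α} (hi : i ∉ w) (hj : j ∉ w) (hij : i ≠ j) :
    Γ.lines Γ.skew (π (insert i w)) (π (insert j w)) = lineSum Γ π w i + crossSum Γ π w i j :=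
  H.cover.lines_insert H.cwdr hw hi hj hij supported_skew

end BoundedSums

theorem lines_skew_swap [Fintype V] (h : Γ.IsCWDR) (x y : V) :
    Γ.lines Γ.skew y x = -Γ.lines Γ.skew x y := by
  rw [lines_swap h isColor_skew (c := -1) (fun a b => by rw [skew_swap a b]; ring)]
  ring

/-- A (1,1) pair has the colour of its reverse, where the skew function takes the opposite value. -/
theorem lines_skew_eq_zero [Fintype V] (h : Γ.IsCWDR) {x y : V}
    (hxy : Γ.twoWayDistance x y = (1, 1)) : Γ.lines Γ.skew x y = 0 := by
  have h1 := isColor_lines h (isColor_skew (Γ := Γ)) x y y x (by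
    rw [twoWayDistance_swap x y, hxy]; rfl)
  have h2 := lines_skew_swap h x y
  omega

theorem twoWayDistance_of_adj (h : Γ.IsCWDR) {x y : V} (h1 : Γ.Adj x y) (h2 : Γ.Adj y x) :
    Γ.twoWayDistance x y = (1, 1) := by
  rw [twoWayDistance, h.wdr.distance_eq_one.2 h1, h.wdr.distance_eq_one.2 h2]

/-- On an edge with nonzero `lines` value exactly one of the two arcs is present. -/
theorem skew_of_lines_ne_zero [Fintype V] (h : Γ.IsCWDR) {x y : V} (hxy : Γ.adjm x y = 1)
    (hne : Γ.lines Γ.skew x y ≠ 0) : Γ.skew x y = 1 ∨ Γ.skew x y = -1 := by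
  have h1 := (adjm_eq_one h).1 hxy
  have h2 : ¬ (Γ.Adj x y ∧ Γ.Adj y x) := fun h2 =>
    hne (lines_skew_eq_zero h (twoWayDistance_of_adj h h2.1 h2.2))
  rw [skew_eq_one h, skew_eq_neg_one h]
  tauto

namespace BoundedSums

variable {m : ℤ} [Fintype V] (H : BoundedSums Γ e π m) {w : Finset α} (hw : w.card + 1 = e)
include H hw

/-- The points with the maximal line sum dominate the others. -/
theorem skew_eq_one {i j : α} (hi : i ∉ w) (hj : j ∉ w) (hfi : lineSum Γ π w i = m)
    (hfj : lineSum Γ π w j ≠ m) : Γ.skew (π (insert i w)) (π (insert j w)) = 1 := by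
  have h := H.cwdr
  have hL := H.lineData hw
  have hm := H.pos
  have hlt : ∀ k ∉ w, lineSum Γ π w k ≠ m → lineSum Γ π w k ≤ m - 1 := fun k hk hkm => by
    have := (abs_le.1 (H.lineSum_le hw hk)).2; omega
  -- Write F for `lines` of `skew`. If the two line sums are opposite, the cross sum is nonnegative;
  -- otherwise it is the negative of the line sum at k, which is less than m.
  have hpos : ∀ i' ∉ w, lineSum Γ π w i' = m → ∀ k ∉ w, lineSum Γ π w k ≠ m →
      0 < Γ.lines Γ.skew (π (insert i' w)) (π (insert k w)) := by
    intro i' hi' hfi' k hk hkm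
    have hik : i' ≠ k := fun h0 => hkm (h0 ▸ hfi')
    rw [H.lines_eq hw hi' hk hik]
    by_cases hs : lineSum Γ π w k = -m
    · have := hL.cross_nonneg hm (mem_compl.2 hi') (mem_compl.2 hk) hfi' hs fun l hl hli =>
        (abs_le.1 (H.crossSum_le hw hi' (mem_compl.1 hl) hli.symm)).2
      omega
    · rw [hL.cross_of_add_ne (mem_compl.2 hi') (mem_compl.2 hk) hik (by omega)]
      have := hlt k hk hkm
      omega
  have hadj : ∀ k ∉ w, ∀ l ∉ w, k ≠ l → Γ.adjm (π (insert k w)) (π (insert l w)) = 1 :=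
    fun k hk l hl hkl => H.cover.adjm_insert hw hk hl hkl
  have hadj' := fun k hk l hl hkl => (adjm_eq_one h).1 (hadj k hk l hl hkl)
  have hij : i ≠ j := fun h0 => hfj (h0 ▸ hfi)
  have hFij := hpos i hi hfi j hj hfj
  rcases skew_of_lines_ne_zero h (hadj i hi j hj hij) hFij.ne' with h1 | h1
  · exact h1
  exfalso
  have h2 := (skew_eq_neg_one h).1 h1
  -- An arc against the sign of F has type (1,2), because F is 0 on symmetric arcs and at least 2 on
  -- far ones. So F is negative on all (1,2) arcs; arcs with F > 0 are far, and arcs with F = 0 are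
  -- symmetric.
  have h3 : Γ.twoWayDistance (π (insert j w)) (π (insert i w)) = (1, 2) := by
    rcases arc_cases h h2.1 with h3 | h3 | h3
    · have := lines_skew_eq_zero h h3
      have := lines_skew_swap h (π (insert i w)) (π (insert j w))
      omega
    · exact h3
    · have := H.cover.two_le_lines_of_far h H.card h3
      have := lines_skew_swap h (π (insert i w)) (π (insert j w))
      omega
  have h4 : ∀ u v, Γ.twoWayDistance u v = (1, 2) → Γ.lines Γ.skew u v < 0 := by
    intro u v huv
    rw [isColor_lines h isColor_skew u v _ _ (huv.trans h3.symm),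
      lines_skew_swap h (π (insert i w)) (π (insert j w))]
    omega
  have h5 : ∀ u v, Γ.Adj u v → 0 < Γ.lines Γ.skew u v → Γ.Far u v := by
    intro u v huv h0
    rcases arc_cases h huv with h6 | h6 | h6
    · have := lines_skew_eq_zero h h6; omega
    · have := h4 u v h6; omega
    · exact h6
  have h6 : ∀ u v, Γ.Adj u v → Γ.lines Γ.skew u v = 0 → Γ.Adj v u := by
    intro u v huv h0
    rcases arc_cases h huv with h7 | h7 | h7
    · rw [← h.wdr.distance_eq_one]
      exact (Prod.ext_iff.1 h7).2
    · have := h4 u v h7; omega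
    · have := H.cover.two_le_lines_of_far h H.card h7; omega
  have hS : ∀ k ∉ w, k ≠ i → lineSum Γ π w k = m →
      Γ.Adj (π (insert i w)) (π (insert k w)) ∧ Γ.Adj (π (insert k w)) (π (insert i w)) := by
    intro k hk hki hfk
    have h0 : Γ.lines Γ.skew (π (insert i w)) (π (insert k w)) = 0 := by
      rw [H.lines_eq hw hi hk hki.symm, hL.cross_of_add_ne (mem_compl.2 hi) (mem_compl.2 hk)
        hki.symm (by omega)]
      omega
    rcases hadj' i hi k hk hki.symm with h7 | h7
    · exact ⟨h7, h6 _ _ h7 h0⟩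
    · exact ⟨h6 _ _ h7 (by rw [lines_skew_swap h (π (insert i w)), h0, neg_zero]), h7⟩
  set I := (wᶜ).filter fun k => Γ.skew (π (insert i w)) (π (insert k w)) = -1 with hI
  -- The set I consists of the points with a one-way arc to i. An arc from k to v would complete the
  -- cycle v → i → k → v. If k is maximal, its arc from k to v is far; otherwise the arc from i to k
  -- is.
  have hbeat : ∀ v ∈ I, ∀ k ∈ wᶜ \ I, Γ.skew (π (insert v w)) (π (insert k w)) = 1 := by
    intro v hv k hk
    rw [hI, mem_filter, mem_compl] at hv
    rw [hI, mem_sdiff, mem_filter, mem_compl] at hk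
    have hv2 := (skew_eq_neg_one h).1 hv.2
    have hvi : v ≠ i := by
      rintro rfl
      exact h.wdr.loopless _ hv2.1
    have hvm : lineSum Γ π w v ≠ m := fun h0 => hv2.2 (hS v hv.1 hvi h0).1
    have hvk : v ≠ k := by
      rintro rfl; exact hk.2 hv
    by_cases hki : k = i
    · subst hki
      rw [skew_swap (π (insert k w)), hv.2]; rfl
    rw [Digraph.skew_eq_one h]
    suffices hn : ¬ Γ.Adj (π (insert k w)) (π (insert v w)) by
      have := hadj' v hv.1 k hk.1 hvk
      tauto
    intro hkv
    by_cases hkm : lineSum Γ π w k = m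
    · have h7 := h5 _ _ hkv (hpos k hk.1 hkm v hv.1 hvm)
      exact h7.2.2 _ hv2.1 (hS k hk.1 hki hkm).1
    · have h7 := hpos i hi hfi k hk.1 hkm
      rcases skew_of_lines_ne_zero h (hadj i hi k hk.1 (Ne.symm hki)) h7.ne' with h8 | h8
      · have h9 := h5 _ _ ((Digraph.skew_eq_one h).1 h8).1 h7
        exact h9.2.2 _ hkv hv2.1
      · exact hk.2 ⟨hk.1, h8⟩
  have hIs : I ⊆ wᶜ := filter_subset _ _
  have hj' : j ∈ I := by rw [hI, mem_filter]; exact ⟨mem_compl.2 hj, h1⟩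
  -- Within I the skew values cancel, and I beats its complement, so the mean line sum on I is the
  -- size of the complement. It is less than m, whereas the sum m at i needs m points outside I.
  have hsum : ∑ v ∈ I, lineSum Γ π w v = (I.card : ℤ) * ((wᶜ \ I).card : ℤ) := by
    have h7 : ∀ v ∈ I, lineSum Γ π w v = ∑ k ∈ I, Γ.skew (π (insert v w)) (π (insert k w)) +
        (wᶜ \ I).card := by
      intro v hv
      rw [lineSum, skewColor_skew.rowSum_insert (mem_compl.1 (hIs hv)), ← sum_sdiff hIs,
        sum_congr rfl (hbeat v hv), add_comm]
      simp
    rw [sum_congr rfl h7, sum_add_distrib,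
      sum_sum_eq_zero_of_skew I (fun v k => Γ.skew (π (insert v w)) (π (insert k w)))
        (fun x y => skew_swap _ _)]
    simp
  have hle : ∑ v ∈ I, lineSum Γ π w v ≤ (I.card : ℤ) * (m - 1) := by
    rw [← nsmul_eq_mul]
    refine sum_le_card_nsmul _ _ _ fun v hv => hlt v (mem_compl.1 (hIs hv)) fun h0 => ?_
    rw [hI, mem_filter] at hv
    have hv2 := (skew_eq_neg_one h).1 hv.2
    exact hv2.2 (hS v (mem_compl.1 hv.1) (by rintro rfl; exact h.wdr.loopless _ hv2.1) h0).1
  have hIpos : (0 : ℤ) < I.card := by exact_mod_cast card_pos.2 ⟨j, hj'⟩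
  rw [hsum] at hle
  have h8 := le_of_mul_le_mul_left hle hIpos
  have h9 : m ≤ (wᶜ \ I).card := by
    rw [← hfi, lineSum, skewColor_skew.rowSum_insert hi, ← sum_sdiff hIs]
    have h10 : ∑ k ∈ wᶜ \ I, Γ.skew (π (insert i w)) (π (insert k w)) ≤ (wᶜ \ I).card := by
      rw [← nsmul_one, ← sum_const]
      refine sum_le_sum fun k _ => ?_
      rcases Γ.skew_eq_or (π (insert i w)) (π (insert k w)) with h0 | h0 | h0 <;> omega
    have h11 : ∑ k ∈ I, Γ.skew (π (insert i w)) (π (insert k w)) ≤ 0 := by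
      refine sum_nonpos fun k hk => ?_
      rw [hI, mem_filter] at hk
      omega
    omega
  omega

/-- Skew values cancel among the maximal points, and each of these beats all other points of the
clique. With M the set of maximal points, |M| m = |M| (e + 1 - |M|). -/
theorem card_max {i : α} (hi : i ∉ w) (hfi : lineSum Γ π w i = m) :
    (((wᶜ).filter fun k => lineSum Γ π w k = m).card : ℤ) + m = e + 1 := by
  set M := (wᶜ).filter fun k => lineSum Γ π w k = m with hM
  have hMs : M ⊆ wᶜ := filter_subset _ _
  have h1 : ∑ v ∈ M, lineSum Γ π w v = (M.card : ℤ) * ((wᶜ \ M).card : ℤ) := by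
    have h7 : ∀ v ∈ M, lineSum Γ π w v = ∑ k ∈ M, Γ.skew (π (insert v w)) (π (insert k w)) +
        (wᶜ \ M).card := by
      intro v hv
      have hv' := hv
      rw [hM, mem_filter, mem_compl] at hv'
      rw [lineSum, skewColor_skew.rowSum_insert hv'.1, ← sum_sdiff hMs,
        sum_congr rfl (g := fun _ => (1 : ℤ)), add_comm]
      · simp
      · intro k hk
        rw [hM, mem_sdiff, mem_filter, mem_compl] at hk
        exact H.skew_eq_one hw hv'.1 hk.1 hv'.2 fun h0 => hk.2 ⟨hk.1, h0⟩
    rw [sum_congr rfl h7, sum_add_distrib,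
      sum_sum_eq_zero_of_skew M (fun v k => Γ.skew (π (insert v w)) (π (insert k w)))
        (fun x y => skew_swap _ _)]
    simp
  have h2 : ∑ v ∈ M, lineSum Γ π w v = M.card * m := by
    rw [sum_congr rfl (g := fun _ => m) fun v hv => (mem_filter.1 hv).2, sum_const, nsmul_eq_mul]
  have h3 : (M.card : ℤ) ≠ 0 := by
    have : 0 < M.card := card_pos.2 ⟨i, by simp [hM, hi, hfi]⟩
    omega
  have h4 := mul_left_cancel₀ h3 (h2.symm.trans h1)
  have h5 := card_sdiff_add_card_eq_card hMs
  rw [H.card_compl_line hw] at h5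
  omega

end BoundedSums

end Digraph

namespace LineData

variable {α : Type*} [DecidableEq α] {P : Finset α} {f : α → ℤ} {g : α → α → ℤ}

theorem sign (hL : LineData P f g) {s : ℤ} (hs : s = 1 ∨ s = -1) :
    LineData P (fun i => s * f i) fun i j => s * g i j := by
  rcases hs with rfl | rfl
  · simpa using hL
  · simpa using hL.neg

end LineData

/-! ### Consequences for both signs -/

namespace Digraph

variable {V α : Type*} [DecidableEq α] [Fintype α] {Γ : Digraph V} {e : ℕ} {π : Finset α → V}

theorem sign_mul_abs {s a m : ℤ} (hs : s = 1 ∨ s = -1) (ha : |a| ≤ m) :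
    -m ≤ s * a ∧ s * a ≤ m := by
  rw [abs_le] at ha
  rcases hs with rfl | rfl <;> omega

theorem sign_neg {s : ℤ} (hs : s = 1 ∨ s = -1) : -s = 1 ∨ -s = -1 := by omega

namespace BoundedSums

section Maximal

variable {m : ℤ} [Fintype V] (H : BoundedSums Γ e π m) {s : ℤ} (hs : s = 1 ∨ s = -1)
include H hs

section Line

variable {w : Finset α} (hw : w.card + 1 = e)
include hw

/-- By `card_eq_card_neg` the values m and -m are equally frequent on the clique, so attaining one
means attaining both, and `card_max` counts them. -/
theorem card_max_sign {i : α} (hi : i ∉ w) (hfi : s * lineSum Γ π w i = m) :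
    (((wᶜ).filter fun k => s * lineSum Γ π w k = m).card : ℤ) + m = e + 1 ∧
      (((wᶜ).filter fun k => s * lineSum Γ π w k = -m).card : ℤ) + m = e + 1 := by
  have hL := H.lineData hw
  have hm := H.pos
  have h1 := hL.card_eq_card_neg hm.ne'
  have hpos : ∃ k ∉ w, lineSum Γ π w k = m := by
    rcases hs with rfl | rfl
    · exact ⟨i, hi, by omega⟩
    · have : 0 < ((wᶜ).filter fun k => lineSum Γ π w k = m).card := by
        rw [h1]
        exact card_pos.2 ⟨i, by simp only [mem_filter, mem_compl]; exact ⟨hi, by omega⟩⟩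
      obtain ⟨k, hk⟩ := card_pos.1 this
      rw [mem_filter, mem_compl] at hk
      exact ⟨k, hk⟩
  obtain ⟨k, hk, hfk⟩ := hpos
  have h2 := H.card_max hw hk hfk
  have h3 := h2
  rw [h1] at h3
  rcases hs with rfl | rfl
  · simpa using ⟨h2, h3⟩
  · have e1 : ∀ k, (-1 * lineSum Γ π w k = m) = (lineSum Γ π w k = -m) := fun k =>
      propext ⟨fun _ => by omega, fun _ => by omega⟩
    have e2 : ∀ k, (-1 * lineSum Γ π w k = -m) = (lineSum Γ π w k = m) := fun k =>
      propext ⟨fun _ => by omega, fun _ => by omega⟩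
    simp only [e1, e2]
    exact ⟨h3, h2⟩

omit [Fintype V] in
theorem cross_bound {i j : α} (hi : i ∉ w) (hj : j ∉ w) (hij : i ≠ j) :
    -m ≤ s * crossSum Γ π w i j ∧ s * crossSum Γ π w i j ≤ m :=
  sign_mul_abs hs (H.crossSum_le hw hi hj hij)

theorem cross_nonneg {i j : α} (hi : i ∉ w) (hj : j ∉ w) (hfi : s * lineSum Γ π w i = m)
    (hfj : s * lineSum Γ π w j = -m) : 0 ≤ s * crossSum Γ π w i j :=
  ((H.lineData hw).sign hs).cross_nonneg H.pos (mem_compl.2 hi) (mem_compl.2 hj) hfi hfj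
    fun _ hk hki => (H.cross_bound hs hw hi (mem_compl.1 hk) hki.symm).2

/-- The cross sum -m occurs exactly at the maximal points other than i: it is nonnegative at points
of value -m, and elsewhere it is the negative of the line sum. -/
theorem card_cross {i : α} (hi : i ∉ w) (hfi : s * lineSum Γ π w i = m) :
    ((((insert i w)ᶜ).filter fun j => s * crossSum Γ π w i j = -m).card : ℤ) + m = e := by
  have hL := (H.lineData hw).sign hs
  have hm := H.pos
  have h1 := (H.card_max_sign hs hw hi hfi).1
  have h2 : ((insert i w)ᶜ).filter (fun j => s * crossSum Γ π w i j = -m) =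
      ((wᶜ).filter fun k => s * lineSum Γ π w k = m).erase i := by
    ext j
    simp only [mem_filter, mem_erase, mem_compl, mem_insert, not_or]
    constructor
    · rintro ⟨⟨hji, hj⟩, h3⟩
      refine ⟨hji, hj, ?_⟩
      by_cases h4 : s * lineSum Γ π w j = -m
      · have := H.cross_nonneg hs hw hi hj hfi h4
        omega
      · have := hL.cross_of_add_ne (mem_compl.2 hi) (mem_compl.2 hj) (Ne.symm hji)
          (by rw [hfi]; omega)
        omega
    · rintro ⟨hji, hj, h3⟩
      refine ⟨⟨hji, hj⟩, ?_⟩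
      rw [hL.cross_of_add_ne (mem_compl.2 hi) (mem_compl.2 hj) (Ne.symm hji)
        (by rw [hfi, h3]; omega), h3]
  have hmem : i ∈ (wᶜ).filter fun k => s * lineSum Γ π w k = m := by simp [hi, hfi]
  rw [h2, card_erase_of_mem hmem]
  have := card_pos.2 ⟨i, hmem⟩
  omega

end Line

theorem card_col {x : Finset α} (hx : x.card = e) {i : α} (hi : i ∈ x)
    (hR : s * rowSum Γ.skew π x i = m) :
    (((xᶜ).filter fun j => s * colSum Γ.skew π x j = -m).card : ℤ) + m = e := by
  have := H.card_cross hs (w := x.erase i) (by rw [card_erase_add_one hi, hx]) (i := i) (by simp)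
    (by rwa [lineSum, insert_erase hi])
  simpa only [crossSum, insert_erase hi] using this

theorem card_row {x : Finset α} (hx : x.card = e) {j : α} (hj : j ∉ x)
    (hC : s * colSum Γ.skew π x j = m) :
    ((x.filter fun i => s * rowSum Γ.skew π x i = -m).card : ℤ) + m = e := by
  have := H.dual.card_col hs (x := xᶜ) (by rw [card_compl, hx, H.card]; omega) (i := j)
    (by simpa using hj) (by rwa [rowSum_dual _ hj])
  rw [compl_compl] at this
  rw [← this]
  congr 3
  exact filter_congr fun i hi => by rw [colSum_dual _ hi]

theorem exists_col (hme : m < e) {x : Finset α} (hx : x.card = e) {i : α} (hi : i ∈ x)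
    (hR : s * rowSum Γ.skew π x i = m) : ∃ j ∉ x, s * colSum Γ.skew π x j = -m := by
  have h1 := H.card_col hs hx hi hR
  have h2 : 0 < ((xᶜ).filter fun j => s * colSum Γ.skew π x j = -m).card := by omega
  obtain ⟨j, hj⟩ := card_pos.1 h2
  rw [mem_filter, mem_compl] at hj
  exact ⟨j, hj⟩

theorem exists_row (hme : m < e) {x : Finset α} (hx : x.card = e) {j : α} (hj : j ∉ x)
    (hC : s * colSum Γ.skew π x j = m) : ∃ i ∈ x, s * rowSum Γ.skew π x i = -m := by
  have h1 := H.card_row hs hx hj hC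
  have h2 : 0 < (x.filter fun i => s * rowSum Γ.skew π x i = -m).card := by omega
  obtain ⟨i, hi⟩ := card_pos.1 h2
  rw [mem_filter] at hi
  exact ⟨i, hi⟩

/-- If the maximum is less than `e`, a line attaining it has no other values up to sign. -/
theorem line_max (hme : m < e) {w : Finset α} (hw : w.card + 1 = e) {i j : α} (hi : i ∉ w)
    (hj : j ∉ w) (hfi : s * lineSum Γ π w i = m) :
    s * lineSum Γ π w j = m ∨ s * lineSum Γ π w j = -m := by
  by_contra! hne
  have hL := (H.lineData hw).sign hs
  have hm := H.pos
  have h1 := H.card_max_sign hs hw hi hfi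
  have hy : (insert j w).card = e := by rw [card_insert_of_notMem hj, hw]
  -- A point j with a third value has column sum m towards all e + 1 - m minimal points. But a
  -- column sum m brings a row sum -m at j, and then only e - m columns have sum m.
  have hsub : ((wᶜ).filter fun k => s * lineSum Γ π w k = -m) ⊆
      ((insert j w)ᶜ).filter fun k => s * colSum Γ.skew π (insert j w) k = m := by
    intro k hk
    rw [mem_filter] at hk
    have hkj : j ≠ k := by rintro rfl; exact hne.2 hk.2
    have h2 := hL.cross_of_add_ne (mem_compl.2 hj) hk.1 hkj (by have := hk.2; omega)
    rw [mem_compl] at hk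
    rw [mem_filter, mem_compl, mem_insert, not_or]
    exact ⟨⟨hkj.symm, hk.1⟩, by rw [hk.2, neg_neg] at h2; exact h2⟩
  have h3 : 0 < ((wᶜ).filter fun k => s * lineSum Γ π w k = -m).card := by omega
  obtain ⟨k, hk⟩ := card_pos.1 h3
  have hk' := hsub hk
  rw [mem_filter, mem_compl] at hk'
  obtain ⟨l, hl, hRl⟩ := H.exists_row hs hme hy hk'.1 hk'.2
  have h4 := H.card_col (sign_neg hs) hy hl (by rw [neg_mul, hRl, neg_neg])
  simp only [neg_mul, neg_inj] at h4
  have := card_le_card hsub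
  omega

/-- Every point of the clique has value m or -m, and each value is taken e + 1 - m times. -/
theorem two_mul_eq (hme : m < e) {w : Finset α} (hw : w.card + 1 = e) {i : α} (hi : i ∉ w)
    (hfi : s * lineSum Γ π w i = m) : 2 * m = e + 1 := by
  have hm := H.pos
  have h1 := H.card_max_sign hs hw hi hfi
  have h2 : (wᶜ).filter (fun k => ¬ s * lineSum Γ π w k = m) =
      (wᶜ).filter fun k => s * lineSum Γ π w k = -m :=
    filter_congr fun k hk => by
      have := H.line_max hs hme hw hi (mem_compl.1 hk) hfi
      omega
  have h3 := card_filter_add_card_filter_not (s := wᶜ) (fun k => s * lineSum Γ π w k = m)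
  rw [h2, H.card_compl_line hw] at h3
  omega

end Maximal

/-! ### Vertices with row sums of both extreme signs -/

section Mixed

variable {m : ℤ} [Fintype V] (H : BoundedSums Γ e π m)
include H

/-- The row i' produces e - m columns of sum m. They lie among the e + 1 - m minimal points of the
clique of row i and have deficit 0, so the one remaining minimal point j takes the whole deficit m
and has column sum 0. The arc to j is not symmetric, as F = m there, and not far, as the column sums
vanish at both ends. -/
theorem exists_colSum_eq_zero (hme : m < e) {x : Finset α} (hx : x.card = e) {i i' : α}
    (hi : i ∈ x) (hi' : i' ∈ x) (hR : rowSum Γ.skew π x i = m)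
    (hR' : rowSum Γ.skew π x i' = -m) : ∃ j ∉ x, colSum Γ.skew π x j = 0 ∧
      Γ.twoWayDistance (π x) (π (exchange x i j)) = (1, 2) := by
  have hm := H.pos
  have h := H.cwdr
  have h1 : (1 : ℤ) = 1 ∨ (1 : ℤ) = -1 := Or.inl rfl
  set w := x.erase i with hw'
  have hw : w.card + 1 = e := by rw [hw', card_erase_add_one hi, hx]
  have hiw : i ∉ w := by simp [hw']
  have hxw : insert i w = x := insert_erase hi
  have hL := H.lineData hw
  have hfi : lineSum Γ π w i = m := by rwa [lineSum, hxw]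
  have h2 := H.two_mul_eq h1 hme hw hiw (by rw [one_mul, hfi])
  have h3 := H.card_max_sign h1 hw hiw (by rw [one_mul, hfi])
  simp only [one_mul] at h3
  have h4 := H.card_col (s := -1) (Or.inr rfl) hx hi' (by omega)
  have h5 := hL.sum_deficit (mem_compl.2 hiw) hm.ne' hfi
  have hsub : ((xᶜ).filter fun j => -1 * colSum Γ.skew π x j = -m) ⊆
      (wᶜ).filter fun j => lineSum Γ π w j = -m := by
    intro j hj
    rw [mem_filter, mem_compl] at hj
    have hij : i ≠ j := fun h0 => hj.1 (h0 ▸ hi)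
    have hjw : j ∉ w := fun h0 => hj.1 (erase_subset _ _ h0)
    rw [mem_filter, mem_compl]
    refine ⟨hjw, ?_⟩
    by_contra hne
    have h6 := hL.cross_of_add_ne (mem_compl.2 hiw) (mem_compl.2 hjw) hij (by omega)
    rw [crossSum, hxw] at h6
    omega
  have h6 := card_sdiff_add_card_eq_card hsub
  have h7 : (((wᶜ).filter fun j => lineSum Γ π w j = -m) \
      ((xᶜ).filter fun j => -1 * colSum Γ.skew π x j = -m)).card = 1 := by omega
  obtain ⟨j, hj⟩ := card_eq_one.1 h7
  rw [← sum_sdiff hsub, hj, sum_singleton, sum_eq_zero, add_zero] at h5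
  · have hjmem : j ∈ ((wᶜ).filter fun j => lineSum Γ π w j = -m) := by
      have : j ∈ ({j} : Finset α) := by simp
      rw [← hj, mem_sdiff] at this
      exact this.1
    rw [mem_filter, mem_compl] at hjmem
    have hij : i ≠ j := by rintro rfl; omega
    have hjx : j ∉ x := by rw [← hxw, mem_insert]; rintro (h0 | h0); exacts [hij h0.symm, hjmem.1 h0]
    have hg : crossSum Γ π w i j = 0 := by omega
    have hg' : crossSum Γ π w j i = 0 := by
      rw [hL.cross_swap (mem_compl.2 hiw) (mem_compl.2 hjmem.1) hij (by omega), hg, neg_zero]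
    refine ⟨j, hjx, by rw [crossSum, hxw] at hg; exact hg, ?_⟩
    rw [← hxw, exchange_insert hiw]
    have h8 := H.skew_eq_one hw hiw hjmem.1 hfi (by omega)
    rw [Digraph.skew_eq_one h] at h8
    rcases arc_cases h h8.1 with h9 | h9 | h9
    · have := lines_skew_eq_zero h h9
      rw [H.lines_eq hw hiw hjmem.1 hij] at this
      omega
    · exact h9
    · have := Far.colSum_lt H.cover h H.card hw hiw hjmem.1 hij h9
      rw [crossSum] at hg hg'
      omega
  · intro k hk
    rw [mem_filter] at hk
    rw [crossSum, hxw]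
    omega

/-- A vertex does not have row sums of both signs with maximal absolute value less than `e`. -/
theorem not_mixed (hme : m < e) {x : Finset α} (hx : x.card = e) {i i' : α}
    (hi : i ∈ x) (hi' : i' ∈ x) (hR : rowSum Γ.skew π x i = m) :
    rowSum Γ.skew π x i' ≠ -m := by
  intro hR'
  have hm := H.pos
  have h := H.cwdr
  have hxc : (xᶜ).card = e := by rw [card_compl, hx, H.card]; omega
  obtain ⟨j, hj, hCj⟩ := H.exists_col (s := 1) (Or.inl rfl) hme hx hi (by omega)
  obtain ⟨j', hj', hCj'⟩ := H.exists_col (s := -1) (Or.inr rfl) hme hx hi' (by omega)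
  obtain ⟨j0, hj0, hC0, h3⟩ := H.exists_colSum_eq_zero hme hx hi hi' hR hR'
  obtain ⟨i0, hi0, hR0, -⟩ := H.dual.exists_colSum_eq_zero hme hxc
    (mem_compl.2 hj') (mem_compl.2 hj) (by rw [rowSum_dual _ hj']; omega)
    (by rw [rowSum_dual _ hj]; omega)
  rw [mem_compl, not_not] at hi0
  rw [colSum_dual _ hi0] at hR0
  have hF := isColor_lines h (isColor_skew (Γ := Γ))
  -- F equals m on some (1,2) arc, hence on all of them, and it is at least 2 on far arcs. Only
  -- symmetric arcs are left for F = 0.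
  have hS : ∀ u v, Γ.adjm u v = 1 → Γ.lines Γ.skew u v = 0 → Γ.twoWayDistance u v = (1, 1) := by
    intro u v huv h0
    have key : ∀ u v, Γ.Adj u v → Γ.lines Γ.skew u v = 0 → Γ.twoWayDistance u v = (1, 1) := by
      intro u v huv h0
      rcases arc_cases h huv with h4 | h4 | h4
      · exact h4
      · have h5 := hF _ _ _ _ (h4.trans h3.symm)
        rw [H.cover.lines_eq h hx hi hj0 supported_skew] at h5
        omega
      · have := H.cover.two_le_lines_of_far h H.card h4
        omega
    rcases (adjm_eq_one h).1 huv with h4 | h4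
    · exact key u v h4 h0
    · rw [twoWayDistance_swap v u, key v u h4 (by rw [lines_skew_swap h u v]; omega)]
      rfl
  have h5 := hS _ _ (H.cover.adj x i j hx hi hj)
    (by rw [H.cover.lines_eq h hx hi hj supported_skew]; omega)
  have h6 := hS _ _ (H.cover.adj x i0 j0 hx hi0 hj0)
    (by rw [H.cover.lines_eq h hx hi0 hj0 supported_skew]; omega)
  -- The cell (i, j) has sums m and -m, and the cell (i0, j0) has both sums 0. Both edges are
  -- symmetric, yet `squares` separates them.
  have h7 := isColor_squares (e := e) h isColor_skew skew_swap _ _ _ _ (h5.trans h6.symm)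
  rw [H.cover.squares_eq h H.card hx hi hj isColor_skew supported_skew skew_swap,
    H.cover.squares_eq h H.card hx hi0 hj0 isColor_skew supported_skew skew_swap, hR, hC0, hR0] at h7
  have he : (0 : ℤ) < e := by omega
  have : 0 < (e : ℤ) ^ 2 * (m ^ 2 + colSum Γ.skew π x j ^ 2) := by positivity
  simp at h7
  rcases h7 with h7 | h7
  · omega
  · nlinarith [sq_nonneg (colSum Γ.skew π x j)]

end Mixed

end BoundedSums

end Digraph

namespace Digraph

variable {V α : Type*} [DecidableEq α] [Fintype α] {Γ : Digraph V} {e : ℕ} {π : Finset α → V}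

namespace BoundedSums

/-! ### The values m and m - 1 when m is less than e -/

section Balanced

variable {m : ℤ} [Fintype V] (H : BoundedSums Γ e π m) (hme : m < e)
include H hme

theorem not_mixed_sign {s : ℤ} (hs : s = 1 ∨ s = -1) {x : Finset α} (hx : x.card = e) {i i' : α}
    (hi : i ∈ x) (hi' : i' ∈ x) (hR : s * rowSum Γ.skew π x i = m) :
    s * rowSum Γ.skew π x i' ≠ -m := by
  intro hR'
  rcases hs with rfl | rfl
  · exact H.not_mixed hme hx hi hi' (by omega) (by omega)
  · exact H.not_mixed hme hx hi' hi (by omega) (by omega)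

theorem two_mul_eq_of_row {s : ℤ} (hs : s = 1 ∨ s = -1) {x : Finset α} (hx : x.card = e)
    {i : α} (hi : i ∈ x) (hR : s * rowSum Γ.skew π x i = m) : 2 * m = e + 1 := by
  refine H.two_mul_eq hs hme (w := x.erase i) (by rw [card_erase_add_one hi, hx])
    (notMem_erase i x) ?_
  rwa [lineSum, insert_erase hi]

/-- The clique of row i has only the values m and -m. Points of value m give the column sum -m. At
the m points of value -m the deficits are at least 1, since a column sum m would bring a row sum -m
at the same vertex; they add up to m, so each is 1. -/
theorem col_values {s : ℤ} (hs : s = 1 ∨ s = -1) {x : Finset α} (hx : x.card = e)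
    {i j : α} (hi : i ∈ x) (hj : j ∉ x) (hR : s * rowSum Γ.skew π x i = m) :
    s * colSum Γ.skew π x j = -m ∨ s * colSum Γ.skew π x j = m - 1 := by
  have hm := H.pos
  set w := x.erase i with hw'
  have hw : w.card + 1 = e := by rw [hw', card_erase_add_one hi, hx]
  have hiw : i ∉ w := by simp [hw']
  have hxw : insert i w = x := insert_erase hi
  have hL := (H.lineData hw).sign hs
  have hfi : s * lineSum Γ π w i = m := by rwa [lineSum, hxw]
  have hjw : j ∉ w := fun h0 => hj (erase_subset _ _ h0)
  have hij : i ≠ j := by rintro rfl; exact hj hi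
  have h2 := H.two_mul_eq hs hme hw hiw hfi
  have h3 := (H.card_max_sign hs hw hiw hfi).2
  have hg : ∀ k ∉ w, i ≠ k → s * crossSum Γ π w i k ≤ m - 1 := by
    intro k hk hik
    have h4 := (H.cross_bound hs hw hiw hk hik).2
    have hkx : k ∉ x := by
      rw [← hxw, mem_insert]; rintro (h0 | h0); exacts [hik h0.symm, hk h0]
    have h5 : s * crossSum Γ π w i k ≠ m := by
      intro h6
      rw [crossSum, hxw] at h6
      obtain ⟨l, hl, hRl⟩ := H.exists_row hs hme hx hkx h6
      exact H.not_mixed_sign hme hs hx hi hl hR hRl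
    omega
  have hcr : s * colSum Γ.skew π x j = s * crossSum Γ π w i j := by rw [crossSum, hxw]
  rw [hcr]
  rcases H.line_max hs hme hw hiw hjw hfi with h5 | h5
  · left
    rw [hL.cross_of_add_ne (mem_compl.2 hiw) (mem_compl.2 hjw) hij (by omega), h5]
  · right
    have h6 := hL.sum_deficit (mem_compl.2 hiw) hm.ne' hfi
    have h7 : ∑ k ∈ wᶜ with s * lineSum Γ π w k = -m, (1 : ℤ) =
        ∑ k ∈ wᶜ with s * lineSum Γ π w k = -m, (m - s * crossSum Γ π w i k) := by
      rw [h6, sum_const, nsmul_one]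
      omega
    rw [sum_eq_sum_iff_of_le] at h7
    · have := h7 j (by simp [hjw, h5])
      omega
    · intro k hk
      rw [mem_filter, mem_compl] at hk
      have := hg k hk.1 (by rintro rfl; omega)
      omega

theorem row_values {s : ℤ} (hs : s = 1 ∨ s = -1) {x : Finset α} (hx : x.card = e)
    {i i' : α} (hi : i ∈ x) (hi' : i' ∈ x) (hR : s * rowSum Γ.skew π x i = m) :
    s * rowSum Γ.skew π x i' = m ∨ s * rowSum Γ.skew π x i' = -(m - 1) := by
  obtain ⟨j, hj, hC⟩ := H.exists_col hs hme hx hi hR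
  have := H.dual.col_values hme (sign_neg hs) (x := xᶜ) (by rw [card_compl, hx, H.card]; omega)
    (mem_compl.2 hj) (j := i') (by simpa using hi') (by rw [rowSum_dual _ hj]; linarith)
  rw [colSum_dual _ hi'] at this
  rcases this with h | h
  · left; linarith
  · right; linarith

/-- A vertex with a row or column sum of maximal absolute value has row sums `m` of some sign. -/
theorem exists_sign_of_col {s : ℤ} (hs : s = 1 ∨ s = -1) {x : Finset α} (hx : x.card = e)
    {j : α} (hj : j ∉ x) (hC : s * colSum Γ.skew π x j = m) :
    ∃ i ∈ x, -s * rowSum Γ.skew π x i = m := by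
  obtain ⟨i, hi, hR⟩ := H.exists_row hs hme hx hj hC
  exact ⟨i, hi, by linarith⟩

section Line

variable {s : ℤ} (hs : s = 1 ∨ s = -1) {w : Finset α} (hw : w.card + 1 = e) {i : α} (hi : i ∉ w)
  {r : α} (hr : r ∈ insert i w) (hR : s * rowSum Γ.skew π (insert i w) r = m)
  (hfi : s * lineSum Γ π w i = -(m - 1))
include hs hw hi hr hR hfi

/-- If the value of j is not m - 1, the column sum at i towards j is its negative. `col_values` then
leaves m or -(m - 1), and the value m would confine the clique to m and -m. -/
theorem second_values (hm2 : 2 ≤ m) {j : α} (hj : j ∉ w) :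
    s * lineSum Γ π w j = m - 1 ∨ s * lineSum Γ π w j = -(m - 1) := by
  have hx : (insert i w).card = e := by rw [card_insert_of_notMem hi, hw]
  by_cases hij : i = j
  · exact Or.inr (hij ▸ hfi)
  by_contra! hne
  have hL := (H.lineData hw).sign hs
  have h1 := hL.cross_of_add_ne (mem_compl.2 hi) (mem_compl.2 hj) hij (by omega)
  have hjx : j ∉ insert i w := by simp [hj, Ne.symm hij]
  have h2 := H.col_values hme hs hx hr hjx hR
  rw [← crossSum] at h2
  have h3 : s * lineSum Γ π w j = m := by omega
  have h4 := H.line_max hs hme hw hj hi h3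
  omega

omit hfi in
theorem second_cross {j : α} (hj : j ∉ w) (hij : i ≠ j) :
    s * crossSum Γ π w i j = -m ∨ s * crossSum Γ π w i j = m - 1 :=
  H.col_values hme hs (by rw [card_insert_of_notMem hi, hw]) hr (by simp [hj, hij.symm]) hR

theorem second_card (hm2 : 2 ≤ m) :
    (((wᶜ).filter fun k => s * lineSum Γ π w k = m - 1).card : ℤ) = m ∧
      (((wᶜ).filter fun k => s * lineSum Γ π w k = -(m - 1)).card : ℤ) = m := by
  have hx : (insert i w).card = e := by rw [card_insert_of_notMem hi, hw]
  have h2 := H.two_mul_eq_of_row hme hs hx hr hR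
  have hL := (H.lineData hw).sign hs
  have h1 := hL.card_eq_card_neg (v := m - 1) (by omega)
  have h3 := card_filter_add_card_filter_not (s := wᶜ) (fun k => s * lineSum Γ π w k = m - 1)
  have h4 : (wᶜ).filter (fun k => ¬ s * lineSum Γ π w k = m - 1) =
      (wᶜ).filter fun k => s * lineSum Γ π w k = -(m - 1) :=
    filter_congr fun k hk => by
      have := H.second_values hme hs hw hi hr hR hfi hm2 (mem_compl.1 hk)
      omega
  rw [h4, H.card_compl_line hw] at h3
  omega

theorem second_sum : ∑ u ∈ wᶜ with s * lineSum Γ π w u = m - 1,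
    (m - 1 + s * crossSum Γ π w i u) = m - 1 := by
  by_cases hm1 : m = 1
  · have hx : (insert i w).card = e := by rw [card_insert_of_notMem hi, hw]
    have h2 := H.two_mul_eq_of_row hme hs hx hr hR
    have := H.two_le
    omega
  exact ((H.lineData hw).sign hs).sum_excess (mem_compl.2 hi) (by omega) hfi

/-- The m terms of `second_sum` are -1 or 2(m - 1), and their total is m - 1. Exactly one of them is
2(m - 1): it belongs to the mate of i, at which F vanishes. -/
theorem exists_second_mate : ∃ u ∉ w, s * lineSum Γ π w u = m - 1 ∧
    s * crossSum Γ π w i u = m - 1 := by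
  have hx : (insert i w).card = e := by rw [card_insert_of_notMem hi, hw]
  have h2 := H.two_mul_eq_of_row hme hs hx hr hR
  have := H.two_le
  have hm2 : 2 ≤ m := by omega
  by_contra! hne
  have h1 := H.second_sum hme hs hw hi hr hR hfi
  rw [sum_congr rfl (g := fun _ => (-1 : ℤ)), sum_const, nsmul_eq_mul,
    (H.second_card hme hs hw hi hr hR hfi hm2).1] at h1
  · omega
  · intro u hu
    rw [mem_filter, mem_compl] at hu
    have h4 := hne u hu.1 hu.2
    have h5 := H.second_cross hme hs hw hi hr hR hu.1 (by rintro rfl; omega)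
    omega

theorem exists_second_far : ∃ u ∉ w, s * lineSum Γ π w u = m - 1 ∧
    s * crossSum Γ π w i u = -m := by
  have hx : (insert i w).card = e := by rw [card_insert_of_notMem hi, hw]
  have h2 := H.two_mul_eq_of_row hme hs hx hr hR
  have := H.two_le
  have hm2 : 2 ≤ m := by omega
  by_contra! hne
  have h1 := H.second_sum hme hs hw hi hr hR hfi
  rw [sum_congr rfl (g := fun _ => (2 * (m - 1) : ℤ)), sum_const, nsmul_eq_mul,
    (H.second_card hme hs hw hi hr hR hfi hm2).1] at h1
  · nlinarith
  · intro u hu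
    rw [mem_filter, mem_compl] at hu
    have h4 := hne u hu.1 hu.2
    have h5 := H.second_cross hme hs hw hi hr hR hu.1 (by rintro rfl; omega)
    omega

/-- All points with the negative value on the line are of the same kind as `i`. -/
theorem second_same {v : α} (hv : v ∉ w) (hfv : s * lineSum Γ π w v = -(m - 1)) :
    ∃ r ∈ insert v w, s * rowSum Γ.skew π (insert v w) r = m := by
  have hx : (insert i w).card = e := by rw [card_insert_of_notMem hi, hw]
  have hxv : (insert v w).card = e := by rw [card_insert_of_notMem hv, hw]
  have h2 := H.two_mul_eq_of_row hme hs hx hr hR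
  have := H.two_le
  have hm2 : 2 ≤ m := by omega
  have hneg : ∀ r ∈ insert v w, -s * rowSum Γ.skew π (insert v w) r ≠ m := by
    intro r' hr' h0
    have h1 := H.row_values hme (sign_neg hs) hxv hr' (mem_insert_self v w) h0
    rw [← lineSum] at h1
    rw [neg_mul] at h1
    omega
  by_contra! hne
  -- If v has no extreme row sum, it has no extreme column sum either.
  have hcol : ∀ l ∉ insert v w, s * colSum Γ.skew π (insert v w) l ≠ m ∧
      s * colSum Γ.skew π (insert v w) l ≠ -m := by
    intro l hl
    constructor
    · intro h0
      obtain ⟨r', hr', h1⟩ := H.exists_sign_of_col hme hs hxv hl h0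
      exact hneg r' hr' h1
    · intro h0
      obtain ⟨r', hr', h1⟩ := H.exists_sign_of_col hme (sign_neg hs) hxv hl (by linarith)
      rw [neg_neg] at h1
      exact hne r' hr' h1
  have hiv : i ≠ v := by rintro rfl; exact hne r hr hR
  -- The column sum at u towards i is extreme, so the one towards v is m or -(m - 1), up to s. Read
  -- at v it must be m - 1, an excess of 2(m - 1). This exceeds the total m - 1, although no excess
  -- at v is negative.
  obtain ⟨u, hu, hfu, hgu⟩ := H.exists_second_far hme hs hw hi hr hR hfi
  have hiu : i ≠ u := by rintro rfl; omega
  have hvu : v ≠ u := by rintro rfl; omega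
  have hL := (H.lineData hw).sign hs
  have hgui := hL.cross_swap (mem_compl.2 hi) (mem_compl.2 hu) hiu (by omega)
  have hxu : (insert u w).card = e := by rw [card_insert_of_notMem hu, hw]
  obtain ⟨r', hr', h3⟩ := H.exists_sign_of_col hme hs hxu (j := i) (by simp [hi, hiu])
    (by rw [← crossSum]; omega)
  have h4 := H.col_values hme (sign_neg hs) hxu (j := v) hr' (by simp [hv, hvu]) h3
  rw [← crossSum, neg_mul] at h4
  have hguv := hL.cross_swap (mem_compl.2 hv) (mem_compl.2 hu) hvu (by omega)
  have hgv : s * crossSum Γ π w v u = m - 1 := by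
    have := (hcol u (by simp [hu, hvu.symm])).2
    rw [← crossSum] at this
    omega
  have h6 := hL.sum_excess (mem_compl.2 hv) (v := m - 1) (by omega) hfv
  have h7 := single_le_sum (s := (wᶜ).filter fun u => s * lineSum Γ π w u = m - 1)
    (f := fun u => m - 1 + s * crossSum Γ π w v u) (fun l hl => ?_)
    (mem_filter.2 ⟨mem_compl.2 hu, hfu⟩)
  · simp only [h6, hgv] at h7
    omega
  · rw [mem_filter, mem_compl] at hl
    have hvl : v ≠ l := by rintro rfl; omega
    have h8 := H.cross_bound hs hw hv hl.1 hvl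
    have h9 := (hcol l (by simp [hl.1, hvl.symm])).2
    rw [← crossSum] at h9
    omega

/-- A point `u` of the line with `lines` value zero and opposite line sum has no common zero
neighbour with `i` on the line. -/
theorem second_mate_lines {u t : α} (hu : u ∉ w) (ht : t ∉ w) (hti : t ≠ i) (htu : t ≠ u)
    (hfu : s * lineSum Γ π w u = m - 1) (hgu : s * crossSum Γ π w i u = m - 1) :
    Γ.lines Γ.skew (π (insert i w)) (π (insert t w)) ≠ 0 ∨
      Γ.lines Γ.skew (π (insert u w)) (π (insert t w)) ≠ 0 := by
  have hx : (insert i w).card = e := by rw [card_insert_of_notMem hi, hw]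
  have h2 := H.two_mul_eq_of_row hme hs hx hr hR
  have := H.two_le
  have hm2 : 2 ≤ m := by omega
  have hiu : i ≠ u := by rintro rfl; omega
  have hL := (H.lineData hw).sign hs
  rw [H.lines_eq hw hi ht hti.symm, H.lines_eq hw hu ht htu.symm]
  by_contra! hz
  have hz1 : s * lineSum Γ π w i + s * crossSum Γ π w i t = 0 := by rw [← mul_add, hz.1, mul_zero]
  have hz2 : s * lineSum Γ π w u + s * crossSum Γ π w u t = 0 := by rw [← mul_add, hz.2, mul_zero]
  have hcr := fun k => H.second_cross (j := k) hme hs hw hi hr hR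
  -- If t has value m - 1, then i has two mates, u and t. If t has value -(m - 1), then i and t
  -- share the mate u. Either way two terms 2(m - 1) overshoot the total m - 1.
  rcases H.second_values hme hs hw hi hr hR hfi hm2 ht with h3 | h3
  · have h4 := H.second_sum hme hs hw hi hr hR hfi
    have hsub : ({u, t} : Finset α) ⊆ (wᶜ).filter fun u => s * lineSum Γ π w u = m - 1 := by
      intro k hk
      rw [mem_insert, mem_singleton] at hk
      rw [mem_filter, mem_compl]
      rcases hk with rfl | rfl
      · exact ⟨hu, hfu⟩
      · exact ⟨ht, h3⟩
    have h5 := card_sdiff_add_card_eq_card hsub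
    rw [card_pair htu.symm] at h5
    have h6 := (H.second_card hme hs hw hi hr hR hfi hm2).1
    rw [← sum_sdiff hsub, sum_pair htu.symm] at h4
    have h7 : ∑ k ∈ ((wᶜ).filter fun u => s * lineSum Γ π w u = m - 1) \ {u, t}, (-1 : ℤ) ≤
        ∑ k ∈ ((wᶜ).filter fun u => s * lineSum Γ π w u = m - 1) \ {u, t},
          (m - 1 + s * crossSum Γ π w i k) := by
      refine sum_le_sum fun k hk => ?_
      rw [mem_sdiff, mem_filter, mem_compl] at hk
      have := hcr k hk.1.1 (by rintro rfl; omega)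
      omega
    rw [sum_const, nsmul_eq_mul] at h7
    omega
  · obtain ⟨r', hr', hR'⟩ := H.second_same hme hs hw hi hr hR hfi ht h3
    have hgtu := hL.cross_swap (mem_compl.2 ht) (mem_compl.2 hu) htu (by omega)
    have hcol : ∀ v ∈ (wᶜ).filter (fun v => s * lineSum Γ π w v = -(m - 1)),
        s * crossSum Γ π w u v = m ∨ s * crossSum Γ π w u v = -(m - 1) := by
      intro v hv
      rw [mem_filter, mem_compl] at hv
      have hvu : v ≠ u := by rintro rfl; have := hv.2; omega
      obtain ⟨r1, hr1, hR1⟩ := H.second_same hme hs hw hi hr hR hfi hv.1 hv.2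
      have h5 := H.second_cross hme hs hw hv.1 hr1 hR1 hu hvu
      have h6 := hL.cross_swap (mem_compl.2 hv.1) (mem_compl.2 hu) hvu (by have := hv.2; omega)
      omega
    have h5 := hL.sum_deficit (mem_compl.2 hu) (v := m - 1) (by omega) hfu
    have hsub : ({i, t} : Finset α) ⊆ (wᶜ).filter fun v => s * lineSum Γ π w v = -(m - 1) := by
      intro k hk
      rw [mem_insert, mem_singleton] at hk
      rw [mem_filter, mem_compl]
      rcases hk with rfl | rfl
      · exact ⟨hi, hfi⟩
      · exact ⟨ht, h3⟩
    have h6 := card_sdiff_add_card_eq_card hsub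
    rw [card_pair hti.symm] at h6
    have h7 := (H.second_card hme hs hw hi hr hR hfi hm2).2
    rw [← sum_sdiff hsub, sum_pair hti.symm] at h5
    have h8 : ∑ k ∈ ((wᶜ).filter fun v => s * lineSum Γ π w v = -(m - 1)) \ {i, t}, (-1 : ℤ) ≤
        ∑ k ∈ ((wᶜ).filter fun v => s * lineSum Γ π w v = -(m - 1)) \ {i, t},
          (m - 1 - s * crossSum Γ π w u k) := by
      refine sum_le_sum fun k hk => ?_
      have := hcol k (sdiff_subset hk)
      omega
    rw [sum_const, nsmul_eq_mul] at h8
    have h9 := hL.cross_swap (mem_compl.2 hi) (mem_compl.2 hu) hiu (by omega)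
    omega

end Line

end Balanced

end BoundedSums

end Digraph

/-! ### The maximal line sum is not less than e -/

namespace Digraph

variable {V α : Type*} [DecidableEq α] [Fintype α] {Γ : Digraph V} {e : ℕ} {π : Finset α → V}

omit [Fintype α] in
/-- The common neighbours of two adjacent vertices lie in the two cliques containing both. -/
theorem LocalCover.common_neighbor_cell (hπ : LocalCover Γ e π) (h : Γ.IsCWDR)
    {x : Finset α} (hx : x.card = e) {i j : α} (hi : i ∈ x) (hj : j ∉ x) {t : V}
    (hit : Γ.adjm (π x) t = 1) (hjt : Γ.adjm (π (exchange x i j)) t = 1) :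
    (∃ b ∉ x, b ≠ j ∧ π (exchange x i b) = t) ∨ ∃ a ∈ x, a ≠ i ∧ π (exchange x a j) = t := by
  obtain ⟨a, ha, b, hb, rfl⟩ := hπ.lift _ t hx hit
  have hab := hπ.nonadj _ _ _ _ _ hx hi hj ha hb hjt
  have hne : ¬ (i = a ∧ j = b) := by
    rintro ⟨rfl, rfl⟩
    rw [adjm_self h] at hjt
    omega
  by_cases hia : i = a
  · subst hia
    exact Or.inl ⟨b, hb, fun h0 => hne ⟨rfl, h0.symm⟩, rfl⟩
  · obtain rfl : j = b := by tauto
    exact Or.inr ⟨a, ha, Ne.symm hia, rfl⟩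

/-- Points of the other clique are written as complements, so that it becomes a clique with core
`(insert i (insert j w))ᶜ` of the dual cover. -/
theorem LocalCover.common_neighbor (hπ : LocalCover Γ e π) (h : Γ.IsCWDR)
    {w : Finset α} (hw : w.card + 1 = e) {i j : α} (hi : i ∉ w) (hj : j ∉ w) (hij : i ≠ j) {t : V}
    (hit : Γ.adjm (π (insert i w)) t = 1) (hjt : Γ.adjm (π (insert j w)) t = 1) :
    (∃ k ∉ w, k ≠ i ∧ k ≠ j ∧ π (insert k w) = t) ∨
      ∃ k ∉ (insert i (insert j w))ᶜ, k ≠ i ∧ k ≠ j ∧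
        π (insert k (insert i (insert j w))ᶜ)ᶜ = t := by
  have hx : (insert i w).card = e := by rw [card_insert_of_notMem hi, hw]
  have hjx : j ∉ insert i w := by simp [hj, hij.symm]
  rw [← exchange_insert (j := j) hi] at hjt
  rcases hπ.common_neighbor_cell h hx (mem_insert_self i w) hjx hit hjt with
    ⟨b, hb, hbj, rfl⟩ | ⟨a, ha, hai, rfl⟩
  · rw [mem_insert, not_or] at hb
    exact Or.inl ⟨b, hb.2, hb.1, hbj, by rw [exchange_insert hi]⟩
  · have haw : a ∈ w := mem_of_mem_insert_of_ne ha hai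
    refine Or.inr ⟨a, by simp [haw], hai, fun h0 => hj (h0 ▸ haw), ?_⟩
    congr 1
    ext b
    simp only [mem_compl, mem_insert, mem_exchange]
    grind

namespace BoundedSums

variable {m : ℤ} [Fintype V] (H : BoundedSums Γ e π m) (hme : m < e)
include H hme

/-- Being mates is self-dual: in the dual cover i and u change roles and s becomes -s. So
`second_mate_lines` covers both cliques through the edge. -/
theorem mate_common {s : ℤ} (hs : s = 1 ∨ s = -1) {w : Finset α} (hw : w.card + 1 = e) {i : α}
    (hi : i ∉ w) {r : α} (hr : r ∈ insert i w) (hR : s * rowSum Γ.skew π (insert i w) r = m)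
    (hfi : s * lineSum Γ π w i = -(m - 1)) {u : α} (hu : u ∉ w) (hiu : i ≠ u)
    (hfu : s * lineSum Γ π w u = m - 1) (hgu : s * crossSum Γ π w i u = m - 1) {t : V}
    (hit : Γ.adjm (π (insert i w)) t = 1) (hut : Γ.adjm (π (insert u w)) t = 1) :
    Γ.lines Γ.skew (π (insert i w)) t ≠ 0 ∨ Γ.lines Γ.skew (π (insert u w)) t ≠ 0 := by
  have hx : (insert i w).card = e := by rw [card_insert_of_notMem hi, hw]
  rcases H.cover.common_neighbor H.cwdr hw hi hu hiu hit hut with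
    ⟨k, hk, hki, hku, rfl⟩ | ⟨k, hk, hki, hku, rfl⟩
  · exact H.second_mate_lines hme hs hw hi hr hR hfi hu hk hki hku hfu hgu
  · set y := (insert i (insert u w))ᶜ with hy
    have hgi := ((H.lineData hw).sign hs).cross_swap (mem_compl.2 hi) (mem_compl.2 hu) hiu
      (by rw [hfi, hfu]; ring)
    have e1 : insert u y = (insert i w)ᶜ := by
      ext a; simp only [hy, mem_insert, mem_compl]; grind
    have e2 : insert i y = (insert u w)ᶜ := by
      ext a; simp only [hy, mem_insert, mem_compl]; grind
    obtain ⟨r', hr', hC⟩ := H.exists_col hs hme hx hr hR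
    have hux : u ∉ insert i w := by simp [hu, hiu.symm]
    have hiu' : i ∉ insert u w := by simp [hi, hiu]
    have hyc : y.card + 1 = e := by
      rw [hy, card_compl, card_insert_of_notMem hiu', card_insert_of_notMem hu, H.card]; omega
    have h1 : lineSum Γ (fun x => π xᶜ) y u = crossSum Γ π w i u := by
      rw [lineSum, e1, rowSum_dual _ hux]; rfl
    have h2 : lineSum Γ (fun x => π xᶜ) y i = crossSum Γ π w u i := by
      rw [lineSum, e2, rowSum_dual _ hiu']; rfl
    have h3 : crossSum Γ (fun x => π xᶜ) y u i = lineSum Γ π w i := by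
      rw [crossSum, e1, colSum_dual _ (mem_insert_self i w)]; rfl
    have h4 := H.dual.second_mate_lines hme (sign_neg hs) hyc (i := u) (r := r') (u := i) (t := k)
      (by simp [hy]) (by rw [e1, mem_compl]; exact hr')
      (by rw [e1, rowSum_dual _ hr']; linarith) (by rw [h1]; linarith) (by simp [hy]) hk hku hki
      (by rw [h2]; linarith) (by rw [h3]; linarith)
    simpa only [e1, e2, compl_compl] using h4

set_option maxHeartbeats 1000000 in
/-- The maximal line sum is at least `e`. -/
theorem false_of_max_lt {x : Finset α} (hx : x.card = e) {r : α} (hr : r ∈ x)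
    (hR : rowSum Γ.skew π x r = m) : False := by
  have h := H.cwdr
  have hs : (1 : ℤ) = 1 ∨ (1 : ℤ) = -1 := Or.inl rfl
  have hR1 : 1 * rowSum Γ.skew π x r = m := by rw [one_mul, hR]
  have h2m := H.two_mul_eq_of_row hme hs hx hr hR1
  have hm2 : 2 ≤ m := by have := H.two_le; omega
  have hF := isColor_lines h (isColor_skew (Γ := Γ))
  have hsq := isColor_squares (e := e) h (isColor_skew (Γ := Γ)) skew_swap
  have hsqs := squares_swap (e := e) h (isColor_skew (Γ := Γ)) skew_swap
  have he2 : (0 : ℤ) < (e : ℤ) ^ 2 := by have := H.two_le; positivity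
  obtain ⟨j, hj, hC⟩ := H.exists_col hs hme hx hr hR1
  rw [one_mul] at hC
  have hrows := H.card_row (s := -1) (Or.inr rfl) hx hj (by omega)
  -- Only e - m rows have sum m, and m is positive, so `row_values` gives a row with the other
  -- value.
  obtain ⟨i, hi, hRi⟩ : ∃ i ∈ x, rowSum Γ.skew π x i = -(m - 1) := by
    by_contra! hne
    rw [filter_true_of_mem, hx] at hrows
    · omega
    · intro i hi
      have := H.row_values hme hs hx hr hi hR1
      have := hne i hi
      omega
  set w := x.erase i with hw'
  have hw : w.card + 1 = e := by rw [hw', card_erase_add_one hi, hx]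
  have hiw : i ∉ w := by simp [hw']
  have hxw : insert i w = x := insert_erase hi
  have hr' : r ∈ insert i w := by rwa [hxw]
  have hR' : 1 * rowSum Γ.skew π (insert i w) r = m := by rwa [hxw]
  have hfi : 1 * lineSum Γ π w i = -(m - 1) := by rw [one_mul, lineSum, hxw, hRi]
  have hL := H.lineData hw
  obtain ⟨u, hu, hfu, hgu⟩ := H.exists_second_mate hme hs hw hiw hr' hR' hfi
  have hiu : i ≠ u := by rintro rfl; omega
  have hXadj := H.cover.adj x r j hx hr hj
  have hX0 : Γ.lines Γ.skew (π x) (π (exchange x r j)) = 0 := by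
    rw [H.cover.lines_eq h hx hr hj supported_skew]; omega
  have hXsq : Γ.squares e Γ.skew (π x) (π (exchange x r j)) = (e : ℤ) ^ 2 * (m ^ 2 + m ^ 2) := by
    rw [H.cover.squares_eq h H.card hx hr hj isColor_skew supported_skew skew_swap, hR, hC]; ring
  have hneg : ∀ a b, a ∉ w → b ∉ w → a ≠ b → lineSum Γ π w a = -(m - 1) →
      crossSum Γ π w a b = m - 1 → Γ.lines Γ.skew (π (insert a w)) (π (insert b w)) = 0 ∧
        Γ.squares e Γ.skew (π (insert a w)) (π (insert b w)) =
          (e : ℤ) ^ 2 * ((m - 1) ^ 2 + (m - 1) ^ 2) := by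
    intro a b ha hb hab hfa hgb
    rw [H.lines_eq hw ha hb hab, H.cover.squares_insert h H.card hw ha hb hab isColor_skew
      supported_skew skew_swap, ← lineSum, ← crossSum, hfa, hgb]
    constructor <;> ring
  -- The edge to the cell (r, j) and the edge to the mate u both have F = 0, but different values of
  -- `squares`. They cannot both be symmetric, nor both be (1,2) pairs.
  have hne : (e : ℤ) ^ 2 * (m ^ 2 + m ^ 2) ≠ (e : ℤ) ^ 2 * ((m - 1) ^ 2 + (m - 1) ^ 2) := by
    intro h0
    have := mul_left_cancel₀ he2.ne' h0
    nlinarith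
  have hneg' : ∀ a b, a ∉ w → b ∉ w → a ≠ b → lineSum Γ π w a = -(m - 1) →
      lineSum Γ π w b = -(m - 1) → crossSum Γ π w a b = m - 1 := by
    intro a b ha hb hab hfa hfb
    rw [hL.cross_of_add_ne (mem_compl.2 ha) (mem_compl.2 hb) hab (by omega), hfb, neg_neg]
  have hY := hneg i u hiw hu hiu (by omega) (by omega)
  have hYadj := H.cover.adjm_insert hw hiw hu hiu
  rw [hxw] at hY hYadj
  have hzero : ∀ a b, Γ.adjm a b = 1 → Γ.lines Γ.skew a b = 0 →
      Γ.twoWayDistance a b = (1, 1) ∨ Γ.twoWayDistance a b = (1, 2) ∨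
        Γ.twoWayDistance b a = (1, 2) := by
    intro a b hab h0
    rcases (adjm_eq_one h).1 hab with h1 | h1
    · rcases arc_cases h h1 with h2 | h2 | h2
      · exact Or.inl h2
      · exact Or.inr (Or.inl h2)
      · have := H.cover.two_le_lines_of_far h H.card h2; omega
    · rcases arc_cases h h1 with h2 | h2 | h2
      · left; rw [twoWayDistance_swap b a, h2]; rfl
      · exact Or.inr (Or.inr h2)
      · have := H.cover.two_le_lines_of_far h H.card h2
        have := lines_skew_swap h a b
        omega
  have hcol3 : ∀ a b c d, Γ.twoWayDistance a b = (1, 2) →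
      (Γ.twoWayDistance c d = (1, 2) ∨ Γ.twoWayDistance d c = (1, 2)) →
      Γ.squares e Γ.skew a b = Γ.squares e Γ.skew c d := by
    intro a b c d hab hcd
    rcases hcd with hcd | hcd
    · exact hsq _ _ _ _ (hab.trans hcd.symm)
    · exact (hsq _ _ _ _ (hab.trans hcd.symm)).trans (hsqs c d)
  have hcol3' : ∀ a b c d, (Γ.twoWayDistance a b = (1, 2) ∨ Γ.twoWayDistance b a = (1, 2)) →
      (Γ.twoWayDistance c d = (1, 2) ∨ Γ.twoWayDistance d c = (1, 2)) →
      Γ.squares e Γ.skew a b = Γ.squares e Γ.skew c d := by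
    intro a b c d hab hcd
    rcases hab with hab | hab
    · exact hcol3 a b c d hab hcd
    · exact (hsqs b a).trans (hcol3 b a c d hab hcd)
  have hXt := hzero _ _ hXadj hX0
  have hYt := hzero _ _ hYadj hY.1
  -- One of the two edges is a (1,2) pair in some direction, so F vanishes on all (1,2) arcs. Arcs
  -- with nonzero F are then far.
  have h3lines : ∀ a b, Γ.twoWayDistance a b = (1, 2) → Γ.lines Γ.skew a b = 0 := by
    have key : ∀ c d, Γ.lines Γ.skew c d = 0 →
        (Γ.twoWayDistance c d = (1, 2) ∨ Γ.twoWayDistance d c = (1, 2)) →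
        ∀ a b, Γ.twoWayDistance a b = (1, 2) → Γ.lines Γ.skew a b = 0 := by
      intro c d h0 hcd a b hab
      rcases hcd with hcd | hcd
      · rw [hF _ _ _ _ (hab.trans hcd.symm), h0]
      · rw [hF _ _ _ _ (hab.trans hcd.symm), lines_skew_swap h c d, h0, neg_zero]
    rcases hXt with h0 | h0
    · rcases hYt with h1 | h1
      · exact absurd (hsq _ _ _ _ (h0.trans h1.symm)) (by rw [hXsq, hY.2]; exact hne)
      · exact key _ _ hY.1 h1
    · exact key _ _ hX0 h0
  have hfar : ∀ a b, Γ.Adj a b → Γ.lines Γ.skew a b ≠ 0 → Γ.Far a b := by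
    intro a b hab h0
    rcases arc_cases h hab with h1 | h1 | h1
    · exact absurd (lines_skew_eq_zero h h1) h0
    · exact absurd (h3lines _ _ h1) h0
    · exact h1
  have hmate : ∀ t, Γ.adjm (π x) t = 1 → Γ.adjm (π (insert u w)) t = 1 →
      Γ.lines Γ.skew (π x) t ≠ 0 ∨ Γ.lines Γ.skew (π (insert u w)) t ≠ 0 := by
    intro t ht1 ht2
    have := H.mate_common hme hs hw hiw hr' hR' hfi hu hiu hfu hgu (t := t) (by rwa [hxw]) ht2
    rwa [hxw] at this
  -- Any third vertex of a directed triangle on the mate edge sends or receives an arc with nonzero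
  -- F; that arc is far and lies in no triangle.
  have hcycle : ∀ t, Γ.Adj t (π x) → Γ.Adj (π x) (π (insert u w)) →
      ¬ Γ.Adj (π (insert u w)) t := by
    intro t h1 h2 h3
    rcases hmate t ((adjm_eq_one h).2 (Or.inr h1)) ((adjm_eq_one h).2 (Or.inl h3)) with h4 | h4
    · exact (hfar _ _ h1 (by rw [lines_skew_swap h (π x)]; omega)).2.2 _ h2 h3
    · exact (hfar _ _ h3 h4).2.2 _ h1 h2
  have hcycle' : ∀ t, Γ.Adj t (π (insert u w)) → Γ.Adj (π (insert u w)) (π x) →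
      ¬ Γ.Adj (π x) t := by
    intro t h1 h2 h3
    rcases hmate t ((adjm_eq_one h).2 (Or.inl h3)) ((adjm_eq_one h).2 (Or.inr h1)) with h4 | h4
    · exact (hfar _ _ h3 h4).2.2 _ h1 h2
    · exact (hfar _ _ h1 (by rw [lines_skew_swap h (π (insert u w))]; omega)).2.2 _ h2 h3
  rcases hYt with hYt | hYt | hYt
  -- If the mate edge is symmetric, the edge to (r, j) is a (1,2) pair in some direction.
  · have hXt : Γ.twoWayDistance (π x) (π (exchange x r j)) = (1, 2) ∨
        Γ.twoWayDistance (π (exchange x r j)) (π x) = (1, 2) := by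
      rcases hXt with h0 | h0
      · exact absurd (hsq _ _ _ _ (h0.trans hYt.symm)) (by rw [hXsq, hY.2]; exact hne)
      · exact h0
    have hS : ∀ a b, a ∉ w → b ∉ w → a ≠ b → lineSum Γ π w a = -(m - 1) →
        lineSum Γ π w b = -(m - 1) →
        Γ.twoWayDistance (π (insert a w)) (π (insert b w)) = (1, 1) := by
      intro a b ha hb hab hfa hfb
      have h0 := hneg a b ha hb hab hfa (hneg' a b ha hb hab hfa hfb)
      rcases hzero _ _ (H.cover.adjm_insert hw ha hb hab) h0.1 with h1 | h1
      · exact h1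
      · have := hcol3' _ _ _ _ h1 hXt
        rw [hXsq, h0.2] at this
        exact absurd this.symm hne
    have hcard := (H.second_card hme hs hw hiw hr' hR' hfi hm2).2
    simp only [one_mul] at hcard hfi hfu hgu
    have hsym1 : ∀ a b, Γ.twoWayDistance a b = (1, 1) → Γ.sym a b = 1 := by
      intro a b hab
      rw [sym_eq_one h, ← h.wdr.distance_eq_one, ← h.wdr.distance_eq_one]
      exact Prod.ext_iff.1 hab
    have hconv : conv Γ.sym Γ.sym (π x) (π (insert u w)) = 0 := by
      rw [conv]
      refine sum_eq_zero fun t _ => ?_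
      rcases Γ.sym_eq_or (π x) t with h1 | h1
      · rw [h1, zero_mul]
      rcases Γ.sym_eq_or t (π (insert u w)) with h2 | h2
      · rw [h2, mul_zero]
      rw [sym_eq_one h] at h1 h2
      have hz : ∀ a b, Γ.Adj a b → Γ.Adj b a → Γ.lines Γ.skew a b = 0 := fun a b hab hba =>
        lines_skew_eq_zero h (twoWayDistance_of_adj h hab hba)
      rcases hmate t ((adjm_eq_one h).2 (Or.inl h1.1)) ((adjm_eq_one h).2 (Or.inr h2.1)) with h4 | h4
      · exact absurd (hz _ _ h1.1 h1.2) h4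
      · exact absurd (hz _ _ h2.2 h2.1) h4
    -- The mate edge is symmetric and has no common neighbour along symmetric arcs, so no symmetric
    -- edge has one. The m points of value -(m - 1) are mutually joined by symmetric arcs, so there
    -- are at most two of them.
    have hm : m = 2 := by
      by_contra hm3
      obtain ⟨a, ha, b, hb, c, hc, hab, hac, hbc⟩ := two_lt_card.1
        (show 2 < ((wᶜ).filter fun k => lineSum Γ π w k = -(m - 1)).card by omega)
      have hex : ∃ v v', v ∉ w ∧ v' ∉ w ∧ i ≠ v ∧ i ≠ v' ∧ v ≠ v' ∧
          lineSum Γ π w v = -(m - 1) ∧ lineSum Γ π w v' = -(m - 1) := by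
        simp only [mem_filter, mem_compl] at ha hb hc
        by_cases hia : i = a
        · exact ⟨b, c, hb.1, hc.1, hia ▸ hab, hia ▸ hac, hbc, hb.2, hc.2⟩
        by_cases hib : i = b
        · exact ⟨a, c, ha.1, hc.1, hia, hib ▸ hbc, hac, ha.2, hc.2⟩
        · exact ⟨a, b, ha.1, hb.1, hia, hib, hab, ha.2, hb.2⟩
      obtain ⟨v, v', hv, hv', hiv, hiv', hvv', hfv, hfv'⟩ := hex
      have h1 := hS i v hiw hv hiv hfi hfv
      have h2 := h.isColor_conv isColor_sym isColor_sym _ _ _ _ (hYt.trans (hxw ▸ h1).symm)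
      rw [hconv, conv] at h2
      have h3 := single_le_sum (s := univ)
        (f := fun t => Γ.sym (π x) t * Γ.sym t (π (insert v w))) (fun t _ => by
          rcases Γ.sym_eq_or (π x) t with h1 | h1 <;>
          rcases Γ.sym_eq_or t (π (insert v w)) with h2 | h2 <;> simp [h1, h2])
        (mem_univ (π (insert v' w)))
      rw [← h2] at h3
      have h4 := hsym1 _ _ (hS i v' hiw hv' hiv' hfi hfv')
      have h5 := hsym1 _ _ (hS v' v hv' hv hvv'.symm hfv' hfv)
      rw [hxw] at h4
      simp [h4, h5] at h3
    have hcols := H.card_col hs hx hr hR1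
    -- Since m = 2 gives e = 3, only one row has sum m and only one column has sum -m. The value of
    -- `squares` confines all (1,2) pairs at x to that single cell.
    have huniq : ∀ y, (Γ.twoWayDistance (π x) y = (1, 2) ∨ Γ.twoWayDistance y (π x) = (1, 2)) →
        y = π (exchange x r j) := by
      intro y hy
      have hadj : Γ.adjm (π x) y = 1 := by
        rw [adjm_eq_one h, ← h.wdr.distance_eq_one, ← h.wdr.distance_eq_one]
        rcases hy with hy | hy
        · exact Or.inl (Prod.ext_iff.1 hy).1
        · exact Or.inr (Prod.ext_iff.1 hy).1
      have hl : Γ.lines Γ.skew (π x) y = 0 := by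
        rcases hy with hy | hy
        · exact h3lines _ _ hy
        · rw [lines_skew_swap h y, h3lines _ _ hy, neg_zero]
      have hq := hcol3' _ _ _ _ hy hXt
      obtain ⟨a, ha, b, hb, rfl⟩ := H.cover.lift x y hx hadj
      rw [H.cover.lines_eq h hx ha hb supported_skew] at hl
      rw [hXsq, H.cover.squares_eq h H.card hx ha hb isColor_skew supported_skew skew_swap] at hq
      have hra := H.row_values hme hs hx hr ha hR1
      have hcb : colSum Γ.skew π x b = -rowSum Γ.skew π x a := by omega
      have hRa : rowSum Γ.skew π x a = m := by
        rcases hra with h0 | h0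
        · omega
        · rw [one_mul] at h0
          rw [hcb, h0] at hq
          exact absurd hq.symm (by convert hne using 2; ring)
      have ha1 : #(x.filter fun i => -1 * rowSum Γ.skew π x i = -m) = 1 := by omega
      have hb1 : #((xᶜ).filter fun j => 1 * colSum Γ.skew π x j = -m) = 1 := by omega
      rw [card_eq_one] at ha1 hb1
      obtain ⟨a0, ha1⟩ := ha1
      obtain ⟨b0, hb1⟩ := hb1
      have h1 : a ∈ ({a0} : Finset α) := by rw [← ha1, mem_filter]; exact ⟨ha, by omega⟩
      have h2 : r ∈ ({a0} : Finset α) := by rw [← ha1, mem_filter]; exact ⟨hr, by omega⟩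
      have h3 : b ∈ ({b0} : Finset α) := by
        rw [← hb1, mem_filter, mem_compl]; exact ⟨hb, by omega⟩
      have h4 : j ∈ ({b0} : Finset α) := by
        rw [← hb1, mem_filter, mem_compl]; exact ⟨hj, by omega⟩
      rw [mem_singleton] at h1 h2 h3 h4
      rw [h1, h2, h3, h4]
    -- Thus x is incident with a single (1,2) arc, but the numbers of incoming and outgoing ones
    -- must agree.
    have hsum := h.sum_row (isColor_ind (Γ := Γ) (1, 2)) (π x) (π x)
    have hind : ∀ a b, 0 ≤ Γ.ind (1, 2) a b := fun a b => by rw [ind]; split_ifs <;> simp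
    have hboth : ∀ a b, Γ.twoWayDistance a b = (1, 2) → Γ.twoWayDistance b a ≠ (1, 2) := by
      intro a b h1 h2
      rw [twoWayDistance_swap a b, h1] at h2
      simp at h2
    rcases hXt with hXt | hXt
    · have h1 : ∑ v, Γ.ind (1, 2) v (π x) = 0 := by
        refine sum_eq_zero fun v _ => ?_
        rw [ind, if_neg]
        intro h0
        obtain rfl := huniq v (Or.inr h0)
        exact hboth _ _ hXt h0
      have h2 := single_le_sum (s := univ) (f := fun v => Γ.ind (1, 2) (π x) v)
        (fun v _ => hind _ v) (mem_univ (π (exchange x r j)))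
      rw [hsum, h1, ind, if_pos hXt] at h2
      omega
    · have h1 : ∑ v, Γ.ind (1, 2) (π x) v = 0 := by
        refine sum_eq_zero fun v _ => ?_
        rw [ind, if_neg]
        intro h0
        obtain rfl := huniq v (Or.inl h0)
        exact hboth _ _ h0 hXt
      have h2 := single_le_sum (s := univ) (f := fun v => Γ.ind (1, 2) v (π x))
        (fun v _ => hind v _) (mem_univ (π (exchange x r j)))
      rw [← hsum, h1, ind, if_pos hXt] at h2
      omega
  -- A (1,2) arc between mates would lie in a directed triangle.
  · rw [twoWayDistance, Prod.mk.injEq, h.wdr.distance_eq_one] at hYt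
    obtain ⟨t, h1, h2⟩ := h.wdr.stronglyConnected.exists_of_distance hYt.2
    exact hcycle t h2 hYt.1 h1
  · rw [twoWayDistance, Prod.mk.injEq, h.wdr.distance_eq_one] at hYt
    obtain ⟨t, h1, h2⟩ := h.wdr.stronglyConnected.exists_of_distance hYt.2
    exact hcycle' t h2 hYt.1 h1

end BoundedSums

end Digraph

/-! ### The extremal case m = e -/

namespace Digraph

variable {V α : Type*} [DecidableEq α] [Fintype α] {Γ : Digraph V} {e : ℕ} {π : Finset α → V}

theorem sign_skew_le {s : ℤ} (hs : s = 1 ∨ s = -1) (x y : V) : s * Γ.skew x y ≤ 1 := by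
  rcases Γ.skew_eq_or x y with h | h | h <;> rcases hs with rfl | rfl <;> omega

omit [Fintype α] in
/-- A sum over a whole line attains the length of the line only if all terms are extreme. -/
theorem sign_skew_eq_of_colSum {s : ℤ} (hs : s = 1 ∨ s = -1) {x : Finset α} (hx : x.card = e) {j : α}
    (hC : s * colSum Γ.skew π x j = e) {i : α} (hi : i ∈ x) :
    s * Γ.skew (π x) (π (exchange x i j)) = 1 := by
  rw [colSum, mul_sum] at hC
  have h1 : ∑ i ∈ x, s * Γ.skew (π x) (π (exchange x i j)) = ∑ i ∈ x, 1 := by simp [hC, hx]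
  rw [sum_eq_sum_iff_of_le fun i _ => sign_skew_le hs _ _] at h1
  exact h1 i hi

theorem sign_skew_eq_of_rowSum {s : ℤ} (hs : s = 1 ∨ s = -1) {x : Finset α} {i : α}
    (hR : s * rowSum Γ.skew π x i = (xᶜ).card) {j : α} (hj : j ∉ x) :
    s * Γ.skew (π x) (π (exchange x i j)) = 1 := by
  rw [rowSum, mul_sum] at hR
  have h1 : ∑ j ∈ xᶜ, s * Γ.skew (π x) (π (exchange x i j)) = ∑ j ∈ xᶜ, 1 := by simp [hR]
  rw [sum_eq_sum_iff_of_le fun i _ => sign_skew_le hs _ _] at h1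
  exact h1 j (mem_compl.2 hj)

namespace BoundedSums

variable {m : ℤ} [Fintype V] (H : BoundedSums Γ e π m)
include H

/-- The clique has at least one maximal point, so `card_max` gives m ≤ e, and `false_of_max_lt`
excludes strict inequality. -/
theorem max_eq {x : Finset α} (hx : x.card = e) {i : α} (hi : i ∈ x)
    (hR : rowSum Γ.skew π x i = m) : m = e := by
  have h1 := H.card_max (w := x.erase i) (by rw [card_erase_add_one hi, hx]) (i := i) (by simp)
    (by rwa [lineSum, insert_erase hi])
  have h2 : 0 < ((x.erase i)ᶜ.filter fun k => lineSum Γ π (x.erase i) k = m).card :=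
    card_pos.2 ⟨i, by simp [lineSum, insert_erase hi, hR]⟩
  rcases lt_or_ge m e with h3 | h3
  · exact (H.false_of_max_lt h3 hx hi hR).elim
  · omega

/-- The structure of a clique whose line sums attain the maximum. -/
theorem source_line (hme : m = e) {w : Finset α} (hw : w.card + 1 = e) {i : α} (hi : i ∉ w)
    (hfi : lineSum Γ π w i = m) : ∃ z ∉ w, z ≠ i ∧ crossSum Γ π w i z = 0 ∧
      Γ.twoWayDistance (π (insert i w)) (π (insert z w)) = (1, 2) ∧
      ∀ v ∉ w, v ≠ i → v ≠ z → crossSum Γ π w i v = 0 ∧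
        Γ.twoWayDistance (π (insert i w)) (π (insert v w)) = (1, 3) ∧
        Γ.twoWayDistance (π (insert v w)) (π (insert z w)) = (1, 3) := by
  have h := H.cwdr
  have hm := H.pos
  have hsc := h.wdr.stronglyConnected
  have hL := H.lineData hw
  have hcard := H.card_max_sign (s := 1) (Or.inl rfl) hw hi (by omega)
  simp only [one_mul] at hcard
  -- With m = e the count e + 1 - m leaves one point of value m, the source i, and one of value -m,
  -- the sink z. The single deficit at z is m, so the cross sum there is 0.
  obtain ⟨i0, hi0⟩ := card_eq_one.1
    (show #((wᶜ).filter fun k => lineSum Γ π w k = m) = 1 by omega)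
  obtain ⟨z, hz⟩ := card_eq_one.1
    (show #((wᶜ).filter fun k => lineSum Γ π w k = -m) = 1 by omega)
  have hmax : ∀ k ∉ w, lineSum Γ π w k = m → k = i := by
    have key : ∀ k ∉ w, lineSum Γ π w k = m → k = i0 := fun k hk hfk => by
      rw [← mem_singleton, ← hi0, mem_filter, mem_compl]; exact ⟨hk, hfk⟩
    intro k hk hfk
    rw [key k hk hfk, key i hi hfi]
  have hmin : ∀ k ∉ w, lineSum Γ π w k = -m → k = z := fun k hk hfk => by
    rw [← mem_singleton, ← hz, mem_filter, mem_compl]; exact ⟨hk, hfk⟩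
  have hzm : z ∈ (wᶜ).filter fun k => lineSum Γ π w k = -m := by rw [hz, mem_singleton]
  have hzm' := hzm
  rw [mem_filter, mem_compl] at hzm'
  obtain ⟨hzw, hfz⟩ := hzm'
  have hzi : z ≠ i := by rintro rfl; omega
  have hdef := hL.sum_deficit (mem_compl.2 hi) hm.ne' hfi
  rw [hz, sum_singleton] at hdef
  have hgz : crossSum Γ π w i z = 0 := by omega
  have hgz' : crossSum Γ π w z i = 0 := by
    rw [hL.cross_swap (mem_compl.2 hi) (mem_compl.2 hzw) hzi.symm (by omega), hgz, neg_zero]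
  have hsrc : ∀ k ∉ w, k ≠ i → Γ.Adj (π (insert i w)) (π (insert k w)) ∧
      ¬ Γ.Adj (π (insert k w)) (π (insert i w)) := fun k hk hki =>
    (Digraph.skew_eq_one h).1 (H.skew_eq_one hw hi hk hfi fun h0 => hki (hmax k hk h0))
  have hsnk : ∀ k ∉ w, k ≠ z → Γ.Adj (π (insert k w)) (π (insert z w)) ∧
      ¬ Γ.Adj (π (insert z w)) (π (insert k w)) := by
    intro k hk hkz
    have hzc : (insert z w).card = e := by rw [card_insert_of_notMem hzw, hw]
    have h1 := sign_skew_eq_of_rowSum (Γ := Γ) (π := π) (s := -1) (Or.inr rfl) (x := insert z w)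
      (i := z) (by rw [card_compl, hzc, H.card, ← lineSum, hfz]; omega) (j := k) (by simp [hk, hkz])
    rw [exchange_insert hzw] at h1
    exact (skew_eq_neg_one h).1 (by omega)
  -- The arc is not symmetric, since F = m, and not far, since the cross sums vanish at both ends.
  have htd : Γ.twoWayDistance (π (insert i w)) (π (insert z w)) = (1, 2) := by
    rcases arc_cases h (hsrc z hzw hzi).1 with h9 | h9 | h9
    · have := lines_skew_eq_zero h h9
      rw [H.lines_eq hw hi hzw hzi.symm] at this
      omega
    · exact h9
    · have := Far.colSum_lt H.cover h H.card hw hi hzw hzi.symm h9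
      rw [crossSum] at hgz hgz'
      omega
  refine ⟨z, hzw, hzi, hgz, htd, fun v hv hvi hvz => ?_⟩
  have hvm : lineSum Γ π w v ≠ m := fun h0 => hvi (hmax v hv h0)
  have hvm' : lineSum Γ π w v ≠ -m := fun h0 => hvz (hmin v hv h0)
  have hgvi := hL.cross_of_add_ne (mem_compl.2 hv) (mem_compl.2 hi) hvi (by omega)
  have hgvz := hL.cross_of_add_ne (mem_compl.2 hv) (mem_compl.2 hzw) hvz (by omega)
  have hgiv := hL.cross_of_add_ne (mem_compl.2 hi) (mem_compl.2 hv) hvi.symm (by omega)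
  have hvc : (insert v w).card = e := by rw [card_insert_of_notMem hv, hw]
  have hiv' : i ∉ insert v w := by simp [hi, hvi.symm]
  have hzv' : z ∉ insert v w := by simp [hzw, hvz.symm]
  have hcn : ∀ k ∉ w, k ∉ insert v w → ∀ t, Γ.adjm (π (insert v w)) t = 1 →
      Γ.adjm (π (insert k w)) t = 1 → (∃ l ∉ w, l ≠ k ∧ π (insert l w) = t) ∨
        ∃ a ∈ insert v w, π (exchange (insert v w) a k) = t := by
    intro k hk hkv t h1 h2
    rcases H.cover.common_neighbor_cell h hvc (mem_insert_self v w) hkv h1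
      (by rwa [exchange_insert hv]) with ⟨b, hb, hbk, rfl⟩ | ⟨a, ha, -, rfl⟩
    · rw [mem_insert, not_or] at hb
      exact Or.inl ⟨b, hb.2, hbk, by rw [exchange_insert hv]⟩
    · exact Or.inr ⟨a, ha, rfl⟩
  -- Seen from v, the other clique through i has sum -e, so all its arcs at v enter v; in the clique
  -- of w the point i is a source. Hence no directed triangle contains the arc.
  have hfar1 : Γ.Far (π (insert i w)) (π (insert v w)) := by
    refine ⟨(hsrc v hv hvi).1, (hsrc v hv hvi).2, fun t h1 h2 => ?_⟩
    rcases hcn i hi hiv' t ((adjm_eq_one h).2 (Or.inl h1)) ((adjm_eq_one h).2 (Or.inr h2)) with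
      ⟨l, hl, hli, rfl⟩ | ⟨a, ha, rfl⟩
    · exact (hsrc l hl hli).2 h2
    · have h3 := sign_skew_eq_of_colSum (Γ := Γ) (π := π) (s := -1) (Or.inr rfl) hvc (j := i)
        (by rw [← crossSum]; omega) ha
      exact ((skew_eq_neg_one h).1 (by omega)).2 h1
  have hfar2 : Γ.Far (π (insert v w)) (π (insert z w)) := by
    refine ⟨(hsnk v hv hvz).1, (hsnk v hv hvz).2, fun t h1 h2 => ?_⟩
    rcases hcn z hzw hzv' t ((adjm_eq_one h).2 (Or.inr h2)) ((adjm_eq_one h).2 (Or.inl h1)) with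
      ⟨l, hl, hlz, rfl⟩ | ⟨a, ha, rfl⟩
    · exact (hsnk l hl hlz).2 h1
    · have h3 := sign_skew_eq_of_colSum (Γ := Γ) (π := π) (s := 1) (Or.inl rfl) hvc (j := z)
        (by rw [← crossSum]; omega) ha
      exact ((Digraph.skew_eq_one h).1 (by omega)).2 h2
  have h1 := (far_iff h).1 hfar1
  have h2 := (far_iff h).1 hfar2
  have d1 := h.wdr.distance_eq_one.2 h1.1
  have d2 := h.wdr.distance_eq_one.2 h2.1
  have d3 : Γ.distance (π (insert z w)) (π (insert i w)) = 2 := (Prod.ext_iff.1 htd).2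
  have d4 := hsc.distance_triangle (π (insert v w)) (π (insert z w)) (π (insert i w))
  have d5 := hsc.distance_triangle (π (insert z w)) (π (insert i w)) (π (insert v w))
  have t1 : Γ.twoWayDistance (π (insert i w)) (π (insert v w)) = (1, 3) := by
    rw [twoWayDistance, Prod.mk.injEq]; omega
  have t2 : Γ.twoWayDistance (π (insert v w)) (π (insert z w)) = (1, 3) := by
    rw [twoWayDistance, Prod.mk.injEq]; omega
  refine ⟨?_, t1, t2⟩
  -- Equal values of F on the two (1,3) arcs read m - f v = f v + m, where f is the line sum. So f v
  -- = 0, and the cross sum -f v vanishes.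
  have h3 := isColor_lines h isColor_skew _ _ _ _ (t1.trans t2.symm)
  rw [H.lines_eq hw hi hv hvi.symm, H.lines_eq hw hv hzw hvz] at h3
  omega

/-- By `source_line` all column sums at x vanish, so F is constant along each row. A far arc makes
the constant of its row positive; as F is nonnegative on every arc, the whole row leaves x. The row
sum is then m, and `source_line` gives the types. -/
theorem distance_le_three_of_row (hme : m = e)
    (h3 : ∀ a b, Γ.twoWayDistance a b = (1, 2) → 0 < Γ.lines Γ.skew a b)
    {x : Finset α} (hx : x.card = e) {i : α} (hi : i ∈ x) (hR : rowSum Γ.skew π x i = m) {y : V}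
    (hfar : Γ.Far (π x) y) : Γ.distance y (π x) ≤ 3 := by
  have h := H.cwdr
  have hline : ∀ i ∈ x, rowSum Γ.skew π x i = m → ∃ z ∉ x, colSum Γ.skew π x z = 0 ∧
      Γ.twoWayDistance (π x) (π (exchange x i z)) = (1, 2) ∧ ∀ v ∉ x, v ≠ z →
        colSum Γ.skew π x v = 0 ∧ Γ.twoWayDistance (π x) (π (exchange x i v)) = (1, 3) := by
    intro i hi hR
    obtain ⟨z, hz, hzi, h1, h2, h3⟩ := H.source_line hme (w := x.erase i)
      (by rw [card_erase_add_one hi, hx]) (i := i) (by simp) (by rwa [lineSum, insert_erase hi])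
    have hex : ∀ v, insert v (x.erase i) = exchange x i v := fun v => rfl
    simp only [crossSum, insert_erase hi, hex] at h1 h2 h3
    have hmem : ∀ v, v ≠ i → (v ∉ x.erase i ↔ v ∉ x) := by intro v hv; simp [hv]
    refine ⟨z, (hmem z hzi).1 hz, h1, h2, fun v hv hvz => ?_⟩
    have hvi : v ≠ i := by rintro rfl; exact hv hi
    have := h3 v ((hmem v hvi).2 hv) hvi hvz
    exact ⟨this.1, this.2.1⟩
  have hC : ∀ v ∉ x, colSum Γ.skew π x v = 0 := by
    obtain ⟨z, hz, h1, -, h3⟩ := hline i hi hR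
    intro v hv
    by_cases hvz : v = z
    · rw [hvz, h1]
    · exact (h3 v hv hvz).1
  obtain ⟨a, ha, b, hb, rfl⟩ := H.cover.lift x y hx ((adjm_eq_one h).2 (Or.inl hfar.1))
  have h4 := H.cover.two_le_lines_of_far h H.card hfar
  have hl : ∀ v ∉ x, Γ.lines Γ.skew (π x) (π (exchange x a v)) = rowSum Γ.skew π x a := by
    intro v hv
    rw [H.cover.lines_eq h hx ha hv supported_skew, hC v hv, add_zero]
  rw [hl b hb] at h4
  have hout : ∀ v ∈ xᶜ, Γ.skew (π x) (π (exchange x a v)) = 1 := by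
    intro v hv
    rw [mem_compl] at hv
    rcases skew_of_lines_ne_zero h (H.cover.adj x a v hx ha hv) (by rw [hl v hv]; omega) with h5 | h5
    · exact h5
    · have h6 := ((skew_eq_neg_one h).1 h5).1
      have h7 := lines_skew_swap h (π x) (π (exchange x a v))
      rw [hl v hv] at h7
      rcases arc_cases h h6 with h8 | h8 | h8
      · have := lines_skew_eq_zero h h8; omega
      · have := h3 _ _ h8; omega
      · have := H.cover.two_le_lines_of_far h H.card h8; omega
  have hRa : rowSum Γ.skew π x a = m := by
    rw [rowSum, sum_congr rfl hout, sum_const, nsmul_one, card_compl, hx, H.card]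
    omega
  obtain ⟨z, hz, h5, h6, h7⟩ := hline a ha hRa
  by_cases hbz : b = z
  · have := (Prod.ext_iff.1 h6).2
    rw [hbz]
    simp only [twoWayDistance] at this
    omega
  · have := (Prod.ext_iff.1 (h7 b hb hbz).2).2
    simp only [twoWayDistance] at this
    omega

/-- The digraphs with a nonzero line sum. -/
theorem structure_of_row {x : Finset α} (hx : x.card = e) {i : α} (hi : i ∈ x)
    (hR : rowSum Γ.skew π x i = m) : (∀ a b, Γ.Adj a b → Γ.distance b a ≤ 3) ∧
      ∃ a b c, Γ.twoWayDistance a b = (1, 2) ∧ Γ.twoWayDistance a c = (1, 3) ∧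
        Γ.twoWayDistance c b = (1, 3) := by
  have h := H.cwdr
  have hm := H.pos
  have hme := H.max_eq hx hi hR
  set w := x.erase i with hw'
  have hw : w.card + 1 = e := by rw [hw', card_erase_add_one hi, hx]
  have hiw : i ∉ w := by simp [hw']
  have hfi : lineSum Γ π w i = m := by rwa [lineSum, insert_erase hi]
  obtain ⟨z, hz, hzi, h1, h2, h3⟩ := H.source_line hme hw hiw hfi
  have hl3 : ∀ a b, Γ.twoWayDistance a b = (1, 2) → Γ.lines Γ.skew a b = m := by
    intro a b hab
    rw [isColor_lines h isColor_skew _ _ _ _ (hab.trans h2.symm), H.lines_eq hw hiw hz hzi.symm]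
    omega
  have hs3 : ∀ a b, Γ.twoWayDistance a b = (1, 2) →
      Γ.squares e Γ.skew a b = (e : ℤ) ^ 2 * (m ^ 2 + 0 ^ 2) := by
    intro a b hab
    rw [isColor_squares h isColor_skew skew_swap _ _ _ _ (hab.trans h2.symm),
      H.cover.squares_insert h H.card hw hiw hz hzi.symm isColor_skew supported_skew skew_swap,
      ← lineSum, ← crossSum, h1, hfi]
  constructor
  · intro a b hab
    rcases arc_cases h hab with h4 | h4 | h4
    · have := (Prod.ext_iff.1 h4).2
      simp only [twoWayDistance] at this
      omega
    · have := (Prod.ext_iff.1 h4).2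
      simp only [twoWayDistance] at this
      omega
    -- The (1,2) indicator has equal row and column sums, so every vertex has an outgoing (1,2) arc.
    · have hout : ∃ c, Γ.twoWayDistance a c = (1, 2) := by
        by_contra! hne
        have h5 : ∑ v, Γ.ind (1, 2) a v = 0 := sum_eq_zero fun v _ => by rw [ind, if_neg (hne v)]
        rw [h.sum_row (isColor_ind _) a (π (insert z w))] at h5
        have h6 := single_le_sum (s := univ) (f := fun v => Γ.ind (1, 2) v (π (insert z w)))
          (fun v _ => by simp only [ind]; split_ifs <;> simp) (mem_univ (π (insert i w)))
        rw [h5, ind, if_pos h2] at h6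
        omega
      obtain ⟨c, hc⟩ := hout
      obtain ⟨y, hy, rfl⟩ := H.cover.surj a
      obtain ⟨p, hp, q, hq, rfl⟩ := H.cover.lift y c hy ((adjm_eq_one h).2
        (Or.inl (h.wdr.distance_eq_one.1 (Prod.ext_iff.1 hc).1)))
      have h5 := hl3 _ _ hc
      have h6 := hs3 _ _ hc
      rw [H.cover.lines_eq h hy hp hq supported_skew] at h5
      rw [H.cover.squares_eq h H.card hy hp hq isColor_skew supported_skew skew_swap] at h6
      have h7 := mul_left_cancel₀ (by have := H.two_le; positivity) h6
      -- From R + C = m and R² + C² = m² follows R C = 0, so every vertex has a row or a column of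
      -- sum m.
      have h8 : rowSum Γ.skew π y p * colSum Γ.skew π y q = 0 := by
        have : m = rowSum Γ.skew π y p + colSum Γ.skew π y q := h5.symm
        rw [this] at h7
        nlinarith
      have hpos : ∀ a b, Γ.twoWayDistance a b = (1, 2) → 0 < Γ.lines Γ.skew a b :=
        fun a b hab => by rw [hl3 a b hab]; exact hm
      rcases mul_eq_zero.1 h8 with h9 | h9
      · have := H.dual.distance_le_three_of_row hme hpos (x := yᶜ)
          (by rw [card_compl, hy, H.card]; omega) (mem_compl.2 hq)
          (by rw [rowSum_dual _ hq]; omega) (y := b) (by simpa using h4)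
        simpa using this
      · exact H.distance_le_three_of_row hme hpos hy hp (by omega) h4
  · have hcard := H.card_compl_line hw
    have h2le := H.two_le
    obtain ⟨v, hv⟩ : ((wᶜ.erase i).erase z).Nonempty := by
      rw [← card_pos, card_erase_of_mem (by simp [hz, hzi]), card_erase_of_mem (by simp [hiw])]
      omega
    simp only [mem_erase, mem_compl] at hv
    have := h3 v hv.2.2 hv.2.1 hv.1
    exact ⟨_, _, _, h2, this.2.1, this.2.2⟩

end BoundedSums

/-- If some line sum is nonzero, all arcs have type at most four, and a `(1, 2)` arc is the
composition of two `(1, 3)` arcs. -/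
theorem LocalCover.structure_of_ne_zero [Fintype V] (hπ : LocalCover Γ e π) (h : Γ.IsCWDR)
    (hα : Fintype.card α = 2 * e) (he : 2 ≤ e)
    (hne : ¬ ∀ x : Finset α, x.card = e →
      (∀ i ∈ x, rowSum Γ.skew π x i = 0) ∧ ∀ j ∉ x, colSum Γ.skew π x j = 0) :
    (∀ a b, Γ.Adj a b → Γ.distance b a ≤ 3) ∧
      ∃ a b c, Γ.twoWayDistance a b = (1, 2) ∧ Γ.twoWayDistance a c = (1, 3) ∧
        Γ.twoWayDistance c b = (1, 3) := by
  -- Row sums and column sums at a set are combined into one function of all points, whose maximum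
  -- is the bound m.
  set E : Finset α × α → ℤ := fun p =>
    if p.2 ∈ p.1 then |rowSum Γ.skew π p.1 p.2| else |colSum Γ.skew π p.1 p.2| with hE
  have hEr : ∀ x i, i ∈ x → E (x, i) = |rowSum Γ.skew π x i| := fun x i hi => by
    simp only [hE, if_pos hi]
  have hEc : ∀ x i, i ∉ x → E (x, i) = |colSum Γ.skew π x i| := fun x i hi => by
    simp only [hE, if_neg hi]
  have hex : ∃ x : Finset α, x.card = e ∧ ∃ i, E (x, i) ≠ 0 := by
    by_contra! h0
    refine hne fun x hx => ⟨fun i hi => ?_, fun j hj => ?_⟩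
    · have := h0 x hx i
      rwa [hEr x i hi, abs_eq_zero] at this
    · have := h0 x hx j
      rwa [hEc x j hj, abs_eq_zero] at this
  obtain ⟨x0, hx0, i0, hi0⟩ := hex
  obtain ⟨⟨x, i⟩, hmem, hmax⟩ := exists_max_image
    ((univ : Finset (Finset α × α)).filter fun p => p.1.card = e) E ⟨(x0, i0), by simp [hx0]⟩
  simp only [mem_filter, mem_univ, true_and, Prod.forall] at hmem hmax
  have hnn : ∀ p, 0 ≤ E p := fun p => by
    simp only [hE]; split_ifs <;> exact abs_nonneg _
  have H : BoundedSums Γ e π (E (x, i)) := {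
    cwdr := h
    cover := hπ
    card := hα
    two_le := he
    pos := lt_of_lt_of_le (lt_of_le_of_ne (hnn _) hi0.symm) (hmax _ _ hx0)
    row := fun y hy k hk => by rw [← hEr y k hk]; exact hmax _ _ hy
    col := fun y hy k hk => by rw [← hEc y k hk]; exact hmax _ _ hy }
  have key : ∀ {π : Finset α → V} {m : ℤ}, BoundedSums Γ e π m → ∀ x : Finset α, x.card = e →
      ∀ i ∈ x, |rowSum Γ.skew π x i| = m → (∀ a b, Γ.Adj a b → Γ.distance b a ≤ 3) ∧
      ∃ a b c, Γ.twoWayDistance a b = (1, 2) ∧ Γ.twoWayDistance a c = (1, 3) ∧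
        Γ.twoWayDistance c b = (1, 3) := by
    intro π m H x hx i hi hm
    have hw : (x.erase i).card + 1 = e := by rw [card_erase_add_one hi, hx]
    rcases abs_choice (rowSum Γ.skew π x i) with h1 | h1
    · exact H.structure_of_row hx hi (h1 ▸ hm)
    -- If the extreme sum is -m, another point of the same clique has sum m.
    · have h4 := (H.lineData hw).card_eq_card_neg H.pos.ne'
      have h5 : 0 < #((x.erase i)ᶜ.filter fun k => lineSum Γ π (x.erase i) k = m) := by
        rw [h4]
        refine card_pos.2 ⟨i, ?_⟩
        rw [mem_filter, mem_compl, lineSum, insert_erase hi]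
        exact ⟨notMem_erase _ _, by omega⟩
      obtain ⟨k, hk⟩ := card_pos.1 h5
      rw [mem_filter, mem_compl] at hk
      exact H.structure_of_row (x := insert k (x.erase i)) (by rw [card_insert_of_notMem hk.1, hw])
        (mem_insert_self _ _) hk.2
  by_cases hi : i ∈ x
  · exact key H x hmem i hi (hEr x i hi).symm
  · exact key H.dual xᶜ (by rw [card_compl, hmem, hα]; omega) i (mem_compl.2 hi)
      (by rw [rowSum_dual _ hi, hEc x i hi])

end Digraph

/-! ### Matrices of symmetric arcs and the block law -/

/-- The indicator of zero. -/
def zeroInd (t : ℤ) : ℤ := if t = 0 then 1 else 0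

theorem zeroInd_spec {t : ℤ} (h : t = 0 ∨ t = 1 ∨ t = -1) :
    (t = 0 ∧ zeroInd t = 1) ∨ (t = 1 ∧ zeroInd t = 0) ∨ (t = -1 ∧ zeroInd t = 0) := by
  rcases h with rfl | rfl | rfl <;> simp [zeroInd]

/-- A restriction on the number `s` of zeros and the sum `d` of a two by two block. -/
def BlockLaw (s₀ s₁ d₁ s d : ℤ) : Prop :=
  s = 0 ∨ (d = 0 ∧ s = s₀) ∨ (s = s₁ ∧ (d = d₁ ∨ d = -d₁) ∧ s₁ ≤ d₁)

/-- Matrices with entries `0, 1, -1` and vanishing row and column sums whose two by two blocks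
satisfy the block law. -/
structure ZeroGrid {α : Type*} (A B : Finset α) (D : α → α → ℤ) (s₀ s₁ d₁ : ℤ) : Prop where
  val : ∀ a ∈ A, ∀ b ∈ B, D a b = 0 ∨ D a b = 1 ∨ D a b = -1
  row : ∀ a ∈ A, ∑ b ∈ B, D a b = 0
  col : ∀ b ∈ B, ∑ a ∈ A, D a b = 0
  block : ∀ a ∈ A, ∀ a' ∈ A, ∀ b ∈ B, ∀ b' ∈ B, a ≠ a' → b ≠ b' → BlockLaw s₀ s₁ d₁
    (zeroInd (D a b) + zeroInd (D a b') + zeroInd (D a' b) + zeroInd (D a' b'))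
    (D a b + D a b' + D a' b + D a' b')

theorem Finset.eq_zero_of_sum_eq_zero_of_sign {β : Type*} {s : Finset β} {f : β → ℤ} {v : ℤ}
    (hv : v = 1 ∨ v = -1) (hf : ∀ b ∈ s, f b = 0 ∨ f b = v) (hs : ∑ b ∈ s, f b = 0) :
    ∀ b ∈ s, f b = 0 := by
  intro b hb
  have h1 : ∑ b ∈ s, v * f b = 0 := by rw [← mul_sum, hs, mul_zero]
  rw [sum_eq_zero_iff_of_nonneg] at h1
  · have := h1 b hb
    rcases hv with rfl | rfl <;> omega
  · intro b hb
    rcases hv with rfl | rfl <;> rcases hf b hb with h | h <;> omega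

/-- The parity of the number of nonzero terms of a vanishing sum. -/
theorem Finset.even_card_of_sum_eq_zero {β : Type*} {s : Finset β} {f : β → ℤ}
    (hf : ∀ b ∈ s, f b = 1 ∨ f b = -1) (hs : ∑ b ∈ s, f b = 0) : Even s.card := by
  have h1 : ∑ b ∈ s, (f b + 1) = s.card := by rw [sum_add_distrib, hs]; simp
  have h2 : (2 : ℤ) ∣ ∑ b ∈ s, (f b + 1) := by
    refine dvd_sum fun b hb => ?_
    rcases hf b hb with h | h <;> rw [h] <;> decide
  rw [h1] at h2
  rw [even_iff_two_dvd]
  exact_mod_cast h2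

theorem Finset.even_card_zeros_add_card {β : Type*} {s : Finset β} {f : β → ℤ}
    (hf : ∀ b ∈ s, f b = 0 ∨ f b = 1 ∨ f b = -1) (hs : ∑ b ∈ s, f b = 0) :
    Even ((s.filter fun b => f b = 0).card + s.card) := by
  have h1 : Even (s.filter fun b => f b ≠ 0).card := by
    refine even_card_of_sum_eq_zero (f := f) (fun b hb => ?_) ?_
    · rw [mem_filter] at hb
      have := hf b hb.1
      omega
    · rw [sum_filter_ne_zero, hs]
  have h2 := card_filter_add_card_filter_not (s := s) (fun b => f b = 0)
  rw [← h2, ← add_assoc, ← two_mul]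
  exact (even_two_mul _).add h1

namespace ZeroGrid

variable {α : Type*} [DecidableEq α] {A B : Finset α} {D : α → α → ℤ} {s₀ s₁ d₁ : ℤ}

omit [DecidableEq α] in
theorem transpose (G : ZeroGrid A B D s₀ s₁ d₁) :
    ZeroGrid B A (fun b a => D a b) s₀ s₁ d₁ where
  val b hb a ha := G.val a ha b hb
  row := G.col
  col := G.row
  block b hb b' hb' a ha a' ha' hbb haa := by
    have := G.block a ha a' ha' b hb b' hb' haa hbb
    convert this using 1 <;> ring

variable (G : ZeroGrid A B D s₀ s₁ d₁)
include G

omit [DecidableEq α] in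
-- A single nonzero entry would give s = 3 and d = 1 or -1, whereas the law asks for d = 0 or |d| ≥
-- s.
theorem eq_zero_of_three {a a' b b' : α} (ha : a ∈ A) (ha' : a' ∈ A) (hb : b ∈ B) (hb' : b' ∈ B)
    (haa : a ≠ a') (hbb : b ≠ b') (h1 : D a b = 0) (h2 : D a b' = 0) (h3 : D a' b = 0) :
    D a' b' = 0 := by
  have h4 := zeroInd_spec (G.val a' ha' b' hb')
  have h5 := G.block a ha a' ha' b hb b' hb' haa hbb
  rw [h1, h2, h3, BlockLaw, show zeroInd 0 = 1 from rfl] at h5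
  omega

omit [DecidableEq α] in
-- If D p c = 0, blocks on row p and columns q, c have s strictly between 0 and 4, so s = s₁ = 2 and
-- the two nonzero entries agree. Column q then has entries 0 and D p q only and cannot cancel.
theorem row_nonzero_of_four (hs0 : s₀ = 4) (hs1 : s₁ ≠ 1) {p q : α} (hp : p ∈ A) (hq : q ∈ B)
    (hpq : D p q ≠ 0) {c : α} (hc : c ∈ B) : D p c ≠ 0 := by
  intro hpc
  have hcq : q ≠ c := by rintro rfl; exact hpq hpc
  have hv := G.val p hp q hq
  refine hpq (eq_zero_of_sum_eq_zero_of_sign (v := D p q) (by omega) (fun a ha => ?_)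
    (G.col q hq) p hp)
  by_cases hap : p = a
  · subst hap; exact Or.inr rfl
  have h1 := zeroInd_spec hv
  have h2 := zeroInd_spec (G.val a ha q hq)
  have h3 := zeroInd_spec (G.val a ha c hc)
  have h4 := G.block p hp a ha q hq c hc hap hcq
  rw [hpc, BlockLaw, show zeroInd 0 = 1 from rfl] at h4
  omega

/-- The fourth entry is zero too, so s₀ = 4. If s₁ = 1, every block with two zeros is all zero, and
zeros spread over the whole matrix. If s₁ ≠ 1, the row and column of a nonzero entry avoid zero and
meet those of D a b in a block with exactly one zero, which the law forbids. -/
theorem not_four (hnz : ∃ p ∈ A, ∃ q ∈ B, D p q ≠ 0) {a a' b b' : α} (ha : a ∈ A) (ha' : a' ∈ A)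
    (hb : b ∈ B) (hb' : b' ∈ B) (haa : a ≠ a') (hbb : b ≠ b') (h1 : D a b = 0) (h2 : D a b' = 0)
    (h3 : D a' b = 0) : False := by
  have h4 := G.eq_zero_of_three ha ha' hb hb' haa hbb h1 h2 h3
  have hs0 : s₀ = 4 := by
    have h5 := G.block a ha a' ha' b hb b' hb' haa hbb
    rw [h1, h2, h3, h4, BlockLaw, show zeroInd 0 = 1 from rfl] at h5
    omega
  obtain ⟨p, hp, q, hq, hpq⟩ := hnz
  by_cases hs1 : s₁ = 1
  · have key : ∀ a ∈ A, ∀ a' ∈ A, ∀ b ∈ B, ∀ b' ∈ B, a ≠ a' → b ≠ b' → D a b = 0 →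
        (D a' b = 0 ∨ D a b' = 0) → D a' b' = 0 := by
      intro a ha a' ha' b hb b' hb' haa hbb h1 h2
      have h4 := zeroInd_spec (G.val a' ha' b' hb')
      have h5 := zeroInd_spec (G.val a' ha' b hb)
      have h6 := zeroInd_spec (G.val a ha b' hb')
      have h7 := G.block a ha a' ha' b hb b' hb' haa hbb
      rw [h1, BlockLaw, show zeroInd 0 = 1 from rfl] at h7
      omega
    have hrow : ∀ c ∈ B, D a c = 0 := by
      intro c hc
      by_cases hcb : c = b
      · rw [hcb, h1]
      · exact key a' ha' a ha b hb c hc haa.symm (Ne.symm hcb) h3 (Or.inl h1)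
    by_cases hpa : p = a
    · exact hpq (hpa ▸ hrow q hq)
    by_cases hqb : q = b
    · exact hpq (key a ha p hp b' hb' q hq (Ne.symm hpa) (hqb ▸ hbb.symm) h2
        (Or.inr (hrow q hq)))
    · exact hpq (key a ha p hp b hb q hq (Ne.symm hpa) (Ne.symm hqb) h1 (Or.inr (hrow q hq)))
  · have hrow := G.row_nonzero_of_four hs0 hs1 hp hq hpq (c := b) hb
    have hcol := G.transpose.row_nonzero_of_four hs0 hs1 hq hp hpq (c := a) ha
    have hpa : a ≠ p := by rintro rfl; exact hrow h1
    have hqb : b ≠ q := by rintro rfl; exact hcol h1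
    have h5 := zeroInd_spec (G.val p hp b hb)
    have h6 := zeroInd_spec (G.val a ha q hq)
    have h7 := zeroInd_spec (G.val p hp q hq)
    have h8 := G.block a ha p hp b hb q hq hpa hqb
    rw [h1, BlockLaw, show zeroInd 0 = 1 from rfl] at h8
    omega

/-- A block with one zero is impossible: its sum is odd, which excludes d = 0, and s₁ ≠ 1. So an
entry D p b ≠ 0 would be the only nonzero entry of column b. -/
theorem row_eq_zero_of_two (hnz : ∃ p ∈ A, ∃ q ∈ B, D p q ≠ 0) (hs1 : s₁ ≠ 1) {p q c : α}
    (hp : p ∈ A) (hq : q ∈ B) (hc : c ∈ B) (hqc : q ≠ c) (h1 : D p q = 0) (h2 : D p c = 0) {b : α}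
    (hb : b ∈ B) : D p b = 0 := by
  by_contra h3
  have hqb : q ≠ b := by rintro rfl; exact h3 h1
  have h4 : ∀ i ∈ A, i ≠ p → D i b = 0 := by
    intro i hi hip
    have h5 : D i q ≠ 0 := fun h0 =>
      G.not_four hnz hp hi hq hc hip.symm hqc h1 h2 h0
    have h6 := zeroInd_spec (G.val i hi q hq)
    have h7 := zeroInd_spec (G.val i hi b hb)
    have h8 := zeroInd_spec (G.val p hp b hb)
    have h9 := G.block p hp i hi q hq b hb hip.symm hqb
    rw [h1, BlockLaw, show zeroInd 0 = 1 from rfl] at h9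
    omega
  have h5 := G.col b hb
  rw [sum_eq_single_of_mem p hp h4] at h5
  exact h3 h5

/-- If no block has exactly one zero, the zeros form a row or a column. -/
theorem full_line (hnz : ∃ p ∈ A, ∃ q ∈ B, D p q ≠ 0) (hz : ∃ p ∈ A, ∃ q ∈ B, D p q = 0)
    (hs1 : s₁ ≠ 1) (hA : 2 ≤ A.card) (hB : 2 ≤ B.card) :
    (∃ p ∈ A, ∀ a ∈ A, ∀ b ∈ B, D a b = 0 ↔ a = p) ∨
      ∃ q ∈ B, ∀ a ∈ A, ∀ b ∈ B, D a b = 0 ↔ b = q := by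
  have hnzT : ∃ p ∈ B, ∃ q ∈ A, D q p ≠ 0 := by
    obtain ⟨p, hp, q, hq, h⟩ := hnz; exact ⟨q, hq, p, hp, h⟩
  obtain ⟨p, hp, q, hq, hpq⟩ := hz
  obtain ⟨i, hi, hip⟩ := exists_mem_ne hA p
  obtain ⟨j, hj, hjq⟩ := exists_mem_ne hB q
  by_cases h1 : ∃ c ∈ B, q ≠ c ∧ D p c = 0
  · obtain ⟨c, hc, hqc, hpc⟩ := h1
    left
    refine ⟨p, hp, fun a ha b hb => ⟨fun h2 => ?_, fun h2 => ?_⟩⟩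
    · by_contra hap
      obtain ⟨b', hb', hbb⟩ := exists_mem_ne hB b
      have h3 := G.row_eq_zero_of_two hnz hs1 hp hq hc hqc hpq hpc hb
      have h4 := G.row_eq_zero_of_two hnz hs1 hp hq hc hqc hpq hpc hb'
      exact G.not_four hnz hp ha hb hb' (Ne.symm hap) hbb.symm h3 h4 h2
    · rw [h2]
      exact G.row_eq_zero_of_two hnz hs1 hp hq hc hqc hpq hpc hb
  by_cases h2 : ∃ c ∈ A, p ≠ c ∧ D c q = 0
  · obtain ⟨c, hc, hpc, hcq⟩ := h2
    right
    refine ⟨q, hq, fun a ha b hb => ⟨fun h2 => ?_, fun h2 => ?_⟩⟩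
    · by_contra hbq
      obtain ⟨a', ha', haa⟩ := exists_mem_ne hA a
      have h3 := G.transpose.row_eq_zero_of_two hnzT hs1 hq hp hc hpc hpq hcq ha
      have h4 := G.transpose.row_eq_zero_of_two hnzT hs1 hq hp hc hpc hpq hcq ha'
      exact G.transpose.not_four hnzT hq hb ha ha' (Ne.symm hbq) haa.symm h3 h4 h2
    · rw [h2]
      exact G.transpose.row_eq_zero_of_two hnzT hs1 hq hp hc hpc hpq hcq ha
  -- The zero at (p, q) is alone in its row and column. Since no block has exactly one zero, row i
  -- is zero outside column q and cannot cancel.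
  exfalso
  push Not at h1 h2
  have h3 : ∀ b ∈ B, b ≠ q → D i b = 0 := by
    intro b hb hbq
    have h4 := zeroInd_spec (G.val i hi q hq)
    have h5 := zeroInd_spec (G.val i hi b hb)
    have h6 := zeroInd_spec (G.val p hp b hb)
    have h7 := G.block p hp i hi q hq b hb hip.symm hbq.symm
    have h8 := h1 b hb hbq.symm
    have h9 := h2 i hi hip.symm
    rw [hpq, BlockLaw, show zeroInd 0 = 1 from rfl] at h7
    omega
  have h4 := G.row i hi
  rw [sum_eq_single_of_mem q hq h3] at h4
  exact h2 i hi hip.symm h4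

omit [DecidableEq α] in
theorem parity {a : α} (ha : a ∈ A) : Even ((B.filter fun b => D a b = 0).card + B.card) :=
  even_card_zeros_add_card (G.val a ha) (G.row a ha)

section One

variable (hnz : ∃ p ∈ A, ∃ q ∈ B, D p q ≠ 0) (hs1 : s₁ = 1)
include hnz hs1

/-- With s₁ = 1 a block with two zeros can only obey the second alternative of the law, so its sum
vanishes. -/
theorem sum_zero_of_row {p i b c : α} (hp : p ∈ A) (hi : i ∈ A) (hb : b ∈ B) (hc : c ∈ B)
    (hip : p ≠ i) (hbc : b ≠ c) (h1 : D p b = 0) (h2 : D p c = 0) :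
    D i b ≠ 0 ∧ D i c ≠ 0 ∧ D i b + D i c = 0 := by
  have h3 : D i b ≠ 0 := fun h0 => G.not_four hnz hp hi hb hc hip hbc h1 h2 h0
  have h4 : D i c ≠ 0 := fun h0 => G.not_four hnz hp hi hc hb hip hbc.symm h2 h1 h0
  have h5 := zeroInd_spec (G.val i hi b hb)
  have h6 := zeroInd_spec (G.val i hi c hc)
  have h7 := G.block p hp i hi b hb c hc hip hbc
  rw [h1, h2, BlockLaw, show zeroInd 0 = 1 from rfl] at h7
  omega

theorem sum_zero_of_diag {p i b c : α} (hp : p ∈ A) (hi : i ∈ A) (hb : b ∈ B) (hc : c ∈ B)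
    (hip : p ≠ i) (hbc : b ≠ c) (h1 : D p b = 0) (h2 : D i c = 0) :
    D p c ≠ 0 ∧ D i b ≠ 0 ∧ D p c + D i b = 0 := by
  have h3 : D p c ≠ 0 := fun h0 => G.not_four hnz hp hi hc hb hip hbc.symm h0 h1 h2
  have h4 : D i b ≠ 0 := fun h0 => G.not_four hnz hi hp hb hc hip.symm hbc h0 h2 h1
  have h5 := zeroInd_spec (G.val i hi b hb)
  have h6 := zeroInd_spec (G.val p hp c hc)
  have h7 := G.block p hp i hi b hb c hc hip hbc
  rw [h1, h2, BlockLaw, show zeroInd 0 = 1 from rfl] at h7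
  omega

omit hs1 in
theorem card_col_of_row {p b c : α} (hp : p ∈ A) (hb : b ∈ B) (hc : c ∈ B) (hbc : b ≠ c)
    (h1 : D p b = 0) (h2 : D p c = 0) : (A.filter fun a => D a b = 0) = {p} := by
  ext a
  rw [mem_filter, mem_singleton]
  constructor
  · rintro ⟨ha, h3⟩
    by_contra hap
    exact G.not_four hnz hp ha hb hc (Ne.symm hap) hbc h1 h2 h3
  · rintro rfl
    exact ⟨hp, h1⟩

omit hs1 in
/-- A block with a single zero together with another zero in its row produces two zeros in
different rows and columns. -/
theorem exists_diag_of_row {p b c : α} (hp : p ∈ A) (hb : b ∈ B) (hc : c ∈ B) (h1 : D p b = 0) (h2 : D p c ≠ 0)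
    {c' : α} (hc' : c' ∈ B) (hbc' : b ≠ c') (h3 : D p c' = 0) :
    ∃ i' ∈ A, i' ≠ p ∧ ∃ b' ∈ B, b' ≠ b ∧ D i' b' = 0 := by
  -- Column b contains exactly one zero, and all columns have the same parity of zeros, so column c
  -- contains a zero as well.
  have h4 := G.transpose.parity hb
  simp only [G.card_col_of_row hnz hp hb hc' hbc' h1 h3, card_singleton] at h4
  have h5 := G.transpose.parity hc
  have h6 : 0 < (A.filter fun a => D a c = 0).card := by
    rcases Nat.eq_zero_or_pos (A.filter fun a => D a c = 0).card with h0 | h0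
    · rw [h0, zero_add] at h5
      rw [add_comm, Nat.even_add_one] at h4
      exact absurd h5 h4
    · exact h0
  obtain ⟨i', hi'⟩ := card_pos.1 h6
  rw [mem_filter] at hi'
  exact ⟨i', hi'.1, by rintro rfl; exact h2 hi'.2, c, hc, by rintro rfl; exact h2 h1, hi'.2⟩

omit hs1 in
/-- A block with a single zero forces two zeros in different rows and columns. -/
theorem exists_diag {p i b c : α} (hp : p ∈ A) (hi : i ∈ A) (hb : b ∈ B) (hc : c ∈ B)
    (hip : p ≠ i) (h1 : D p b = 0) (h2 : D p c ≠ 0) (h3 : D i b ≠ 0) :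
    ∃ i' ∈ A, i' ≠ p ∧ ∃ b' ∈ B, b' ≠ b ∧ D i' b' = 0 := by
  have hnzT : ∃ p ∈ B, ∃ q ∈ A, D q p ≠ 0 := by
    obtain ⟨p, hp, q, hq, h⟩ := hnz; exact ⟨q, hq, p, hp, h⟩
  have hbc : b ≠ c := by rintro rfl; exact h2 h1
  by_cases h4 : ∃ c' ∈ B, b ≠ c' ∧ D p c' = 0
  · obtain ⟨c', hc', hbc', h5⟩ := h4
    exact G.exists_diag_of_row hnz hp hb hc h1 h2 hc' hbc' h5
  by_cases h5 : ∃ a' ∈ A, p ≠ a' ∧ D a' b = 0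
  · obtain ⟨a', ha', hpa', h6⟩ := h5
    obtain ⟨b', hb', hbb', i', hi', hip', h7⟩ :=
      G.transpose.exists_diag_of_row hnzT hb hp hi h1 h3 ha' hpa' h6
    exact ⟨i', hi', hip', b', hb', hbb', h7⟩
  push Not at h4 h5
  have h6 : (B.filter fun b => D p b = 0) = {b} := by
    ext a
    rw [mem_filter, mem_singleton]
    constructor
    · rintro ⟨ha, h7⟩
      by_contra hab
      exact h4 a ha (Ne.symm hab) h7
    · rintro rfl
      exact ⟨hb, h1⟩
  have h7 := G.parity hp
  rw [h6, card_singleton, add_comm, Nat.even_add_one] at h7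
  have h8 := G.parity hi
  have h9 : 0 < (B.filter fun b => D i b = 0).card := by
    rcases Nat.eq_zero_or_pos (B.filter fun b => D i b = 0).card with h0 | h0
    · rw [h0, zero_add] at h8
      exact absurd h8 h7
    · exact h0
  obtain ⟨b', hb'⟩ := card_pos.1 h9
  rw [mem_filter] at hb'
  exact ⟨i, hi, hip.symm, b', hb'.1, by rintro rfl; exact h3 hb'.2, hb'.2⟩

end One

/-- A grid with exactly two zeros in each row and column of length at least three is impossible. -/
theorem false_of_two_zeros (hA : 3 ≤ A.card) (hB : 3 ≤ B.card)
    (hrow : ∀ a ∈ A, (B.filter fun b => D a b = 0).card = 2)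
    (hcol : ∀ b ∈ B, (A.filter fun a => D a b = 0).card = 2) : False := by
  obtain ⟨a, ha⟩ := card_pos.1 (show 0 < A.card by omega)
  obtain ⟨b, c, hbc, hbc'⟩ := card_eq_two.1 (hrow a ha)
  have hb : b ∈ B.filter fun b => D a b = 0 := by rw [hbc']; simp
  have hc : c ∈ B.filter fun b => D a b = 0 := by rw [hbc']; simp
  rw [mem_filter] at hb hc
  have hnz : ∃ p ∈ A, ∃ q ∈ B, D p q ≠ 0 := by
    refine ⟨a, ha, ?_⟩
    by_contra! h0
    have := hrow a ha
    rw [filter_true_of_mem h0] at this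
    omega
  have h1 := G.card_col_of_row hnz ha hb.1 hc.1 hbc hb.2 hc.2
  have h2 := hcol b hb.1
  rw [h1, card_singleton] at h2
  omega

end ZeroGrid

/-! ### Vertices at distance two in the underlying graph -/

namespace Digraph

variable {V α : Type*} [DecidableEq α] [Fintype α] {Γ : Digraph V} {e : ℕ} {π : Finset α → V}

/-- The indicator function of the arcs that are not symmetric. -/
noncomputable def strict (Γ : Digraph V) (x y : V) : ℤ := Γ.arc x y - Γ.sym x y

theorem isColor_strict : Γ.IsColor Γ.strict := isColor_arc.sub isColor_sym

theorem strict_eq_or (x y : V) : Γ.strict x y = 0 ∨ Γ.strict x y = 1 := by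
  rw [strict, sym]
  rcases Γ.arc_eq_or x y with h | h <;> rcases Γ.arc_eq_or y x with h' | h' <;> simp [h, h']

theorem strict_eq_one (h : Γ.IsCWDR) {x y : V} : Γ.strict x y = 1 ↔ Γ.Adj x y ∧ ¬ Γ.Adj y x := by
  rw [← arc_eq_one h, ← arc_eq_zero h, strict, sym]
  rcases Γ.arc_eq_or x y with h | h <;> rcases Γ.arc_eq_or y x with h' | h' <;> simp [h, h']

theorem skew_eq_strict_sub (x y : V) : Γ.skew x y = Γ.strict x y - Γ.strict y x := by
  rw [skew, strict, strict, sym_swap x y]; ring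

theorem adjm_eq_sym_add (x y : V) : Γ.adjm x y = Γ.sym x y + Γ.strict x y + Γ.strict y x := by
  rw [adjm, strict, strict, sym_swap x y]; ring

section Schemes

variable [Fintype V]

omit [Fintype V] in
theorem two_le_distance (h : Γ.IsCWDR) {u v : V} (huv : u ≠ v) (hn : Γ.adjm u v = 0) :
    2 ≤ Γ.distance u v ∧ 2 ≤ Γ.distance v u := by
  have h0 : ¬ (Γ.Adj u v ∨ Γ.Adj v u) := by rw [← adjm_eq_one h]; omega
  have h1 := h.wdr.distance_eq_one (x := u) (y := v)
  have h2 := h.wdr.distance_eq_one (x := v) (y := u)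
  have h3 := h.wdr.stronglyConnected.distance_eq_zero (x := u) (y := v)
  have h4 := h.wdr.stronglyConnected.distance_eq_zero (x := v) (y := u)
  have h5 : Γ.distance u v ≠ 0 := fun h6 => huv (h3.1 h6)
  have h6 : Γ.distance v u ≠ 0 := fun h6 => huv (h4.1 h6).symm
  have h7 : Γ.distance u v ≠ 1 := fun h6 => h0 (Or.inl (h1.1 h6))
  have h8 : Γ.distance v u ≠ 1 := fun h6 => h0 (Or.inr (h2.1 h6))
  omega

theorem conv_sym_adjm_swap (h : Γ.IsCWDR) (u v : V) :
    conv Γ.sym Γ.adjm v u = conv Γ.sym Γ.adjm u v := by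
  rw [h.conv_comm isColor_sym isColor_adjm u v, conv, conv]
  exact sum_congr rfl fun w _ => by rw [sym_swap v w, adjm_swap w u, mul_comm]

theorem conv_skew_adjm_swap (h : Γ.IsCWDR) (u v : V) :
    conv Γ.skew Γ.adjm v u = -conv Γ.skew Γ.adjm u v := by
  rw [h.conv_comm isColor_skew isColor_adjm u v, conv, conv, ← sum_neg_distrib]
  exact sum_congr rfl fun w _ => by rw [skew_swap v w, adjm_swap w u]; ring

/-- If there is no path of length two from `v` to `u`, most arcs between `u` and the common
neighbours lead away from `u`. -/
theorem conv_sym_le_conv_skew (h : Γ.IsCWDR) {u v : V} (hd : 2 < Γ.distance v u) :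
    conv Γ.sym Γ.adjm u v = conv Γ.strict Γ.sym u v ∧
      conv Γ.sym Γ.adjm u v ≤ conv Γ.skew Γ.adjm u v := by
  have hno : ∀ w, Γ.Adj v w → ¬ Γ.Adj w u := fun w h1 h2 => by
    have := distance_le ((hasPath_one h1).trans (hasPath_one h2)); omega
  -- An arc from v to a symmetric neighbour w of u would give a path of length two from v to u. Only
  -- one-way arcs from w to v remain.
  have h1 : conv Γ.sym Γ.adjm u v = conv Γ.sym Γ.strict u v := by
    refine sum_congr rfl fun w _ => ?_
    rcases Γ.sym_eq_or u w with h2 | h2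
    · simp [h2]
    have h3 := (sym_eq_one h).1 h2
    have h4 : Γ.sym w v = 0 := by
      rcases Γ.sym_eq_or w v with h5 | h5
      · exact h5
      · exact absurd h3.2 (hno w ((sym_eq_one h).1 h5).2)
    have h5 : Γ.strict v w = 0 := by
      rcases Γ.strict_eq_or v w with h5 | h5
      · exact h5
      · exact absurd h3.2 (hno w ((strict_eq_one h).1 h5).1)
    rw [adjm_eq_sym_add, h4, h5]
    ring
  have h2 : conv (fun a b => Γ.strict b a) Γ.adjm u v =
      conv (fun a b => Γ.strict b a) Γ.strict u v := by
    refine sum_congr rfl fun w _ => ?_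
    rcases Γ.strict_eq_or w u with h2 | h2
    · simp [h2]
    have h3 := (strict_eq_one h).1 h2
    have h4 : Γ.sym w v = 0 := by
      rcases Γ.sym_eq_or w v with h5 | h5
      · exact h5
      · exact absurd h3.1 (hno w ((sym_eq_one h).1 h5).2)
    have h5 : Γ.strict v w = 0 := by
      rcases Γ.strict_eq_or v w with h5 | h5
      · exact h5
      · exact absurd h3.1 (hno w ((strict_eq_one h).1 h5).1)
    simp only
    rw [adjm_eq_sym_add, h4, h5]
    ring
  -- Commutativity equates the paths u ← w → v with the paths u → w ← v. They are absorbed when the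
  -- strict arcs into u are subtracted from those out of u, which leaves at least the strict arcs
  -- followed by symmetric ones.
  rw [h.conv_comm isColor_strict.swap isColor_strict] at h2
  rw [h.conv_comm isColor_sym isColor_strict] at h1
  refine ⟨h1, ?_⟩
  have h3 : conv Γ.skew Γ.adjm u v =
      conv Γ.strict Γ.adjm u v - conv (fun a b => Γ.strict b a) Γ.adjm u v := by
    rw [conv, conv, conv, ← sum_sub_distrib]
    exact sum_congr rfl fun w _ => by rw [skew_eq_strict_sub]; ring
  have h4 : conv Γ.strict Γ.sym u v + conv Γ.strict (fun a b => Γ.strict b a) u v ≤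
      conv Γ.strict Γ.adjm u v := by
    rw [conv, conv, conv, ← sum_add_distrib]
    refine sum_le_sum fun w _ => ?_
    rw [adjm_eq_sym_add]
    rcases Γ.strict_eq_or u w with h5 | h5 <;> rcases Γ.strict_eq_or w v with h6 | h6 <;>
      rw [h5, h6] <;> linarith
  linarith

/-- A (2,2) pair has the type of its reverse, so symmetric arcs are followed equally often by strict
arcs of either direction. -/
theorem conv_sym_sym (h : Γ.IsCWDR) {u v : V} (hd : Γ.twoWayDistance u v = (2, 2)) :
    conv Γ.sym Γ.adjm u v = conv Γ.sym Γ.sym u v + 2 * conv Γ.sym Γ.strict u v := by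
  have h1 : conv Γ.sym Γ.adjm u v = conv Γ.sym Γ.sym u v + conv Γ.sym Γ.strict u v +
      conv Γ.sym (fun a b => Γ.strict b a) u v := by
    rw [conv, conv, conv, conv, ← sum_add_distrib, ← sum_add_distrib]
    exact sum_congr rfl fun w _ => by rw [adjm_eq_sym_add]; ring
  have h2 : conv Γ.sym (fun a b => Γ.strict b a) u v = conv Γ.strict Γ.sym v u :=
    sum_congr rfl fun w _ => by rw [sym_swap w u, mul_comm]
  have h3 := h.isColor_conv isColor_strict isColor_sym v u u v (by
    rw [twoWayDistance_swap u v, hd]; rfl)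
  rw [h1, h2, h3, h.conv_comm isColor_strict isColor_sym]
  ring

theorem conv_sym_strict_nonneg (u v : V) : 0 ≤ conv Γ.sym Γ.strict u v :=
  sum_nonneg fun w _ => by
    rcases Γ.sym_eq_or u w with h1 | h1 <;> rcases Γ.strict_eq_or w v with h2 | h2 <;>
      simp [h1, h2]

theorem conv_sym_sym_pos {u v w : V} (h1 : Γ.sym u w = 1) (h2 : Γ.sym w v = 1) :
    0 < conv Γ.sym Γ.sym u v := by
  have h3 := single_le_sum (s := univ) (f := fun w => Γ.sym u w * Γ.sym w v) (fun w _ => by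
    rcases Γ.sym_eq_or u w with h1 | h1 <;> rcases Γ.sym_eq_or w v with h2 | h2 <;> simp [h1, h2])
    (mem_univ w)
  rw [conv]
  simp only [h1, h2] at h3
  omega

omit [Fintype V] in
theorem twoWayDistance_of_sym_sym (h : Γ.IsCWDR) {u v w : V} (huv : u ≠ v) (hn : Γ.adjm u v = 0)
    (h1 : Γ.sym u w = 1) (h2 : Γ.sym w v = 1) : Γ.twoWayDistance u v = (2, 2) := by
  have h3 := (sym_eq_one h).1 h1
  have h4 := (sym_eq_one h).1 h2
  have h5 := two_le_distance h huv hn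
  have h6 := distance_le ((hasPath_one h3.1).trans (hasPath_one h4.1))
  have h7 := distance_le ((hasPath_one h4.2).trans (hasPath_one h3.2))
  rw [twoWayDistance, Prod.mk.injEq]
  omega

theorem conv_skew_eq_zero (h : Γ.IsCWDR) {u v : V} (hd : Γ.twoWayDistance u v = (2, 2)) :
    conv Γ.skew Γ.adjm u v = 0 := by
  have h1 := h.isColor_conv isColor_skew isColor_adjm v u u v (by
    rw [twoWayDistance_swap u v, hd]; rfl)
  have h2 := conv_skew_adjm_swap h u v
  omega

/-- A common neighbour along a symmetric arc gives a path of length two in at least one direction.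
If there is none from v to u, some w has a strict arc from u and a symmetric arc to v; going from v
to w and returning to u takes at most three steps. -/
theorem twoWayDistance_cases (h : Γ.IsCWDR) (hΓ : ∀ a b, Γ.Adj a b → Γ.distance b a ≤ 2) {u v : V}
    (huv : u ≠ v) (hn : Γ.adjm u v = 0) (hs : 0 < conv Γ.sym Γ.adjm u v) :
    Γ.twoWayDistance u v = (2, 2) ∨
      (Γ.twoWayDistance u v = (2, 3) ∧ conv Γ.sym Γ.adjm u v ≤ conv Γ.skew Γ.adjm u v) ∨
      (Γ.twoWayDistance v u = (2, 3) ∧ conv Γ.sym Γ.adjm u v ≤ -conv Γ.skew Γ.adjm u v) := by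
  have hsc := h.wdr.stronglyConnected
  have key : ∀ u v, 0 < conv Γ.sym Γ.adjm u v → 2 < Γ.distance v u → Γ.distance v u ≤ 3 := by
    intro u v hs hd
    have h1 := (conv_sym_le_conv_skew h hd).1
    rw [h1] at hs
    obtain ⟨w, -, hw⟩ := exists_ne_zero_of_sum_ne_zero hs.ne'
    have h2 : Γ.strict u w = 1 := by
      rcases Γ.strict_eq_or u w with h0 | h0
      · rw [h0, zero_mul] at hw; exact absurd rfl hw
      · exact h0
    have h3 : Γ.sym w v = 1 := by
      rcases Γ.sym_eq_or w v with h0 | h0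
      · rw [h0, mul_zero] at hw; exact absurd rfl hw
      · exact h0
    have h4 := hΓ _ _ ((strict_eq_one h).1 h2).1
    have h5 := h.wdr.distance_eq_one.2 ((sym_eq_one h).1 h3).2
    have h6 := hsc.distance_triangle v w u
    omega
  obtain ⟨w, -, hw⟩ := exists_ne_zero_of_sum_ne_zero hs.ne'
  have h2 : Γ.sym u w = 1 := by
    rcases Γ.sym_eq_or u w with h0 | h0
    · rw [h0, zero_mul] at hw; exact absurd rfl hw
    · exact h0
  have h3 : Γ.adjm w v = 1 := by
    rcases Γ.adjm_eq_or w v with h0 | h0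
    · rw [h0, mul_zero] at hw; exact absurd rfl hw
    · exact h0
  have h4 := two_le_distance h huv hn
  have h5 := (sym_eq_one h).1 h2
  have h6 : Γ.distance u v = 2 ∨ Γ.distance v u = 2 := by
    rcases (adjm_eq_one h).1 h3 with h7 | h7
    · have := distance_le ((hasPath_one h5.1).trans (hasPath_one h7)); omega
    · have := distance_le ((hasPath_one h7).trans (hasPath_one h5.2)); omega
  simp only [twoWayDistance, Prod.mk.injEq]
  by_cases h7 : 2 < Γ.distance v u
  · have h8 := key u v hs h7
    have h9 := (conv_sym_le_conv_skew h h7).2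
    right; left
    exact ⟨by omega, h9⟩
  by_cases h8 : 2 < Γ.distance u v
  · have h9 := key v u (by rwa [conv_sym_adjm_swap h u v]) h8
    have h10 := (conv_sym_le_conv_skew h h8).2
    rw [conv_sym_adjm_swap h u v, conv_skew_adjm_swap h u v] at h10
    right; right
    exact ⟨by omega, h10⟩
  · left; omega

/-- The common neighbours of two vertices at distance two follow the block law. -/
theorem exists_blockLaw (h : Γ.IsCWDR) (hΓ : ∀ a b, Γ.Adj a b → Γ.distance b a ≤ 2) :
    ∃ s₀ s₁ d₁, ∀ u v, u ≠ v → Γ.adjm u v = 0 →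
      BlockLaw s₀ s₁ d₁ (conv Γ.sym Γ.adjm u v) (conv Γ.skew Γ.adjm u v) := by
  have hcs := h.isColor_conv (isColor_sym (Γ := Γ)) isColor_adjm
  have hcd := h.isColor_conv (isColor_skew (Γ := Γ)) isColor_adjm
  -- The constants are the counts at the types (2,2) and (2,3), and type (3,2) only changes the sign
  -- of d. A type that does not occur gets the unused value 0.
  have h0 : ∃ s₀, ∀ u v, Γ.twoWayDistance u v = (2, 2) → conv Γ.sym Γ.adjm u v = s₀ := by
    by_cases hex : ∃ a b, Γ.twoWayDistance a b = (2, 2)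
    · obtain ⟨a, b, hab⟩ := hex
      exact ⟨_, fun u v huv => hcs _ _ _ _ (huv.trans hab.symm)⟩
    · push Not at hex
      exact ⟨0, fun u v huv => absurd huv (hex u v)⟩
  have h1 : ∃ s₁ d₁, ∀ u v, Γ.twoWayDistance u v = (2, 3) →
      conv Γ.sym Γ.adjm u v = s₁ ∧ conv Γ.skew Γ.adjm u v = d₁ := by
    by_cases hex : ∃ a b, Γ.twoWayDistance a b = (2, 3)
    · obtain ⟨a, b, hab⟩ := hex
      exact ⟨_, _, fun u v huv => ⟨hcs _ _ _ _ (huv.trans hab.symm),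
        hcd _ _ _ _ (huv.trans hab.symm)⟩⟩
    · push Not at hex
      exact ⟨0, 0, fun u v huv => absurd huv (hex u v)⟩
  obtain ⟨s₀, h0⟩ := h0
  obtain ⟨s₁, d₁, h1⟩ := h1
  refine ⟨s₀, s₁, d₁, fun u v huv hn => ?_⟩
  have hnn : 0 ≤ conv Γ.sym Γ.adjm u v := sum_nonneg fun w _ => by
    rcases Γ.sym_eq_or u w with h1 | h1 <;> rcases Γ.adjm_eq_or w v with h2 | h2 <;> simp [h1, h2]
  rcases hnn.eq_or_lt with h2 | h2
  · exact Or.inl h2.symm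
  right
  rcases twoWayDistance_cases h hΓ huv hn h2 with h3 | ⟨h3, h4⟩ | ⟨h3, h4⟩
  · exact Or.inl ⟨conv_skew_eq_zero h h3, h0 u v h3⟩
  · have h5 := h1 u v h3
    exact Or.inr ⟨h5.1, Or.inl h5.2, by omega⟩
  · have h5 := h1 v u h3
    rw [conv_sym_adjm_swap h u v, conv_skew_adjm_swap h u v] at h5
    exact Or.inr ⟨h5.1, Or.inr (by omega), by omega⟩

theorem exists_sym (h : Γ.IsCWDR) {a b : V} (hab : Γ.sym a b = 1) (u : V) :
    ∃ v, Γ.sym u v = 1 := by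
  by_contra! hne
  have h1 : ∑ v, Γ.sym u v = 0 := sum_eq_zero fun v _ => by
    have := Γ.sym_eq_or u v; have := hne v; omega
  rw [h.sum_row isColor_sym u b] at h1
  have h2 := single_le_sum (s := univ) (f := fun v => Γ.sym v b)
    (fun v _ => by rcases Γ.sym_eq_or v b with h | h <;> simp [h]) (mem_univ a)
  simp only [hab, h1] at h2
  omega

theorem exists_strict (h : Γ.IsCWDR) {a b : V} (hab : Γ.strict a b = 1) (u : V) :
    ∃ v, Γ.strict u v = 1 := by
  by_contra! hne
  have h1 : ∑ v, Γ.strict u v = 0 := sum_eq_zero fun v _ => by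
    have := Γ.strict_eq_or u v; have := hne v; omega
  rw [h.sum_row isColor_strict u b] at h1
  have h2 := single_le_sum (s := univ) (f := fun v => Γ.strict v b)
    (fun v _ => by rcases Γ.strict_eq_or v b with h | h <;> simp [h]) (mem_univ a)
  simp only [hab, h1] at h2
  omega

/-- Not all arcs are symmetric. -/
theorem exists_strict_arc (h : Γ.IsCWDR) : ∃ a b, Γ.strict a b = 1 := by
  by_contra! hne
  have hsym : ∀ a b, Γ.Adj a b → Γ.Adj b a := by
    intro a b hab
    by_contra hba
    exact hne a b ((strict_eq_one h).2 ⟨hab, hba⟩)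
  have hpath : ∀ r x y, Γ.HasPath r x y → Γ.HasPath r y x := by
    rintro r x y ⟨w, h0, h1, h2⟩
    refine ⟨fun t => w (r - t), by simpa using h1, by simpa using h0, fun t ht => ?_⟩
    have := hsym _ _ (h2 (r - (t + 1)) (by omega))
    rwa [show r - (t + 1) + 1 = r - t by omega] at this
  have hdist : ∀ x y, Γ.distance x y = Γ.distance y x := by
    intro x y
    rw [distance, distance]
    congr 1
    ext r
    exact ⟨hpath r x y, hpath r y x⟩
  obtain ⟨i, hi⟩ := h.wdr.nonSymmetric
  apply hi
  ext ⟨x, y⟩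
  change Γ.twoWayDistance y x = i ↔ Γ.twoWayDistance x y = i
  rw [twoWayDistance, twoWayDistance, hdist x y]

end Schemes

end Digraph

/-! ### Double exchanges -/

section Opposite

set_option linter.unusedSectionVars false

variable {α : Type*} [DecidableEq α]

/-- Replace the elements `i, i'` of `x` by `j, j'`. -/
def opposite (x : Finset α) (i i' j j' : α) : Finset α := exchange (exchange x i j) i' j'

theorem mem_opposite {x : Finset α} {i i' j j' a : α} :
    a ∈ opposite x i i' j j' ↔ a = j' ∨ a ≠ i' ∧ (a = j ∨ a ≠ i ∧ a ∈ x) := by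
  rw [opposite, mem_exchange, mem_exchange]

variable {x : Finset α} {i i' j j' : α} (hi : i ∈ x) (hi' : i' ∈ x) (hii : i ≠ i') (hj : j ∉ x)
  (hj' : j' ∉ x) (hjj : j ≠ j')
include hi hi' hii hj hj' hjj

theorem opposite_swap : opposite x i' i j' j = opposite x i i' j j' := by
  ext a
  simp only [mem_opposite]
  grind

theorem opposite_swap_left : opposite x i' i j j' = opposite x i i' j j' := by
  ext a
  simp only [mem_opposite]
  grind

theorem opposite_swap_right : opposite x i i' j' j = opposite x i i' j j' := by
  ext a
  simp only [mem_opposite]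
  grind

theorem opposite_opposite : opposite (opposite x i i' j j') j j' i i' = x := by
  ext a
  simp only [mem_opposite]
  grind

theorem exchange_opposite : exchange (opposite x i i' j j') j i = exchange x i' j' := by
  ext a
  simp only [mem_opposite, mem_exchange]
  grind

theorem card_opposite : (opposite x i i' j j').card = x.card := by
  rw [opposite, card_exchange, card_exchange hi hj]
  · rw [mem_exchange]; exact Or.inr ⟨hii.symm, hi'⟩
  · rw [mem_exchange, not_or, not_and]; exact ⟨hjj.symm, fun _ => hj'⟩

end Opposite

namespace Digraph

variable {V α : Type*} [DecidableEq α] [Fintype α] {Γ : Digraph V} {e : ℕ} {π : Finset α → V}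

section Cells

variable (hπ : LocalCover Γ e π) {x : Finset α} (hx : x.card = e) {i i' j j' : α} (hi : i ∈ x)
  (hi' : i' ∈ x) (hii : i ≠ i') (hj : j ∉ x) (hj' : j' ∉ x) (hjj : j ≠ j')
include hπ hx hi hi' hii hj hj' hjj

omit [Fintype α] in
-- Seen from `exchange x i j`, the two vertices are the cells (j, i) and (i', j'), which differ in
-- both coordinates.
theorem LocalCover.opposite_ne :
    π x ≠ π (opposite x i i' j j') ∧ Γ.adjm (π x) (π (opposite x i i' j j')) = 0 := by
  have hc : (exchange x i j).card = e := by rw [card_exchange hi hj, hx]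
  have h1 : j ∈ exchange x i j := by simp [mem_exchange]
  have h2 : i ∉ exchange x i j := by
    rw [mem_exchange]; rintro (rfl | h); exacts [hj hi, h.1 rfl]
  have h3 : i' ∈ exchange x i j := by rw [mem_exchange]; exact Or.inr ⟨hii.symm, hi'⟩
  have h4 : j' ∉ exchange x i j := by
    rw [mem_exchange, not_or, not_and]; exact ⟨hjj.symm, fun _ => hj'⟩
  have h5 := hπ.inj (exchange x i j) j i i' j' hc h1 h2 h3 h4
  have h6 := hπ.nonadj (exchange x i j) j i i' j' hc h1 h2 h3 h4
  rw [exchange_back hi hj] at h5 h6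
  have h7 : j ≠ i' := fun h0 => hj (h0 ▸ hi')
  have h8 : i ≠ j' := fun h0 => hj' (h0 ▸ hi)
  refine ⟨fun h0 => h7 (h5 h0).1, ?_⟩
  rcases Γ.adjm_eq_or (π x) (π (opposite x i i' j j')) with h0 | h0
  · exact h0
  · rcases h6 h0 with h9 | h9
    · exact absurd h9 h7
    · exact absurd h9 h8

omit [Fintype α] in
theorem LocalCover.adjm_cell : Γ.adjm (π (exchange x i j)) (π (opposite x i i' j j')) = 1 :=
  hπ.adj _ _ _ (by rw [card_exchange hi hj, hx]) (by rw [mem_exchange]; exact Or.inr ⟨hii.symm, hi'⟩)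
    (by rw [mem_exchange, not_or, not_and]; exact ⟨hjj.symm, fun _ => hj'⟩)

end Cells

/-- The skew adjacency function from `x` to its neighbours. -/
noncomputable def grid (Γ : Digraph V) (π : Finset α → V) (x : Finset α) (a b : α) : ℤ :=
  Γ.skew (π x) (π (exchange x a b))

theorem sym_eq_zeroInd {u v : V} (huv : Γ.adjm u v = 1) : Γ.sym u v = zeroInd (Γ.skew u v) := by
  rw [adjm, sym] at huv
  rw [sym, skew, zeroInd]
  rcases Γ.arc_eq_or u v with h | h <;> rcases Γ.arc_eq_or v u with h' | h' <;> simp_all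

omit [Fintype α] in
theorem LocalCover.sym_cell (hπ : LocalCover Γ e π) {x : Finset α} (hx : x.card = e) {a b : α}
    (ha : a ∈ x) (hb : b ∉ x) :
    Γ.sym (π x) (π (exchange x a b)) = zeroInd (grid Γ π x a b) :=
  sym_eq_zeroInd (hπ.adj x a b hx ha hb)

omit [Fintype α] in
theorem LocalCover.grid_eq_zero (hπ : LocalCover Γ e π) {x : Finset α} (hx : x.card = e) {a b : α}
    (ha : a ∈ x) (hb : b ∉ x) :
    grid Γ π x a b = 0 ↔ Γ.sym (π x) (π (exchange x a b)) = 1 := by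
  rw [hπ.sym_cell hx ha hb]
  have := zeroInd_spec (Γ.skew_eq_or (π x) (π (exchange x a b)))
  rw [← grid] at this
  omega

theorem supported_adjm : Γ.Supported Γ.adjm := fun x y => by
  rcases Γ.adjm_eq_or x y with h | h <;> simp [h]

/-! ### Vanishing line sums with four common neighbours -/

/-- Covers with vanishing line sums for which two vertices at distance two in the underlying graph
have only four common neighbours. -/
structure BalancedCover (Γ : Digraph V) (e : ℕ) (π : Finset α → V) : Prop where
  cwdr : Γ.IsCWDR
  cover : LocalCover Γ e π
  two_le : 2 ≤ e
  two_le' : e + 2 ≤ Fintype.card α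
  row : ∀ x : Finset α, x.card = e → ∀ i ∈ x, rowSum Γ.skew π x i = 0
  col : ∀ x : Finset α, x.card = e → ∀ j ∉ x, colSum Γ.skew π x j = 0
  quad : ∀ x i i' j j', x.card = e → i ∈ x → i' ∈ x → i ≠ i' → j ∉ x → j' ∉ x → j ≠ j' →
    ∀ a ∈ x, ∀ b ∉ x, Γ.adjm (π (exchange x a b)) (π (opposite x i i' j j')) = 1 →
      (a = i ∨ a = i') ∧ (b = j ∨ b = j')

theorem LocalCover.exists_grid_ne_zero [Fintype V] (hπ : LocalCover Γ e π) (h : Γ.IsCWDR) {x : Finset α} (hx : x.card = e) :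
    ∃ p ∈ x, ∃ q ∈ xᶜ, grid Γ π x p q ≠ 0 := by
  obtain ⟨a, b, hab⟩ := exists_strict_arc h
  obtain ⟨v, hv⟩ := exists_strict h hab (π x)
  have h1 := (strict_eq_one h).1 hv
  obtain ⟨i, hi, j, hj, rfl⟩ := hπ.lift x v hx ((adjm_eq_one h).2 (Or.inl h1.1))
  exact ⟨i, hi, j, mem_compl.2 hj, by rw [grid, (skew_eq_one h).2 h1]; decide⟩

theorem LocalCover.exists_grid_eq_zero [Fintype V] (hπ : LocalCover Γ e π) (h : Γ.IsCWDR) {a b : V} (hab : Γ.sym a b = 1) {x : Finset α} (hx : x.card = e) :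
    ∃ p ∈ x, ∃ q ∈ xᶜ, grid Γ π x p q = 0 := by
  obtain ⟨v, hv⟩ := exists_sym h hab (π x)
  have h1 := (sym_eq_one h).1 hv
  obtain ⟨i, hi, j, hj, rfl⟩ := hπ.lift x v hx ((adjm_eq_one h).2 (Or.inl h1.1))
  exact ⟨i, hi, j, mem_compl.2 hj, (hπ.grid_eq_zero hx hi hj).2 hv⟩

/-- Arcs lie in directed triangles when all row sums vanish. -/
theorem LocalCover.distance_le_two (hπ : LocalCover Γ e π) (h : Γ.IsCWDR)
    (hrow : ∀ x : Finset α, x.card = e → ∀ i ∈ x, rowSum Γ.skew π x i = 0) {a b : V}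
    (hab : Γ.Adj a b) : Γ.distance b a ≤ 2 := by
  rcases arc_cases h hab with h1 | h1 | h1
  · have := (Prod.ext_iff.1 h1).2; simp only [twoWayDistance] at this; omega
  · have := (Prod.ext_iff.1 h1).2; simp only [twoWayDistance] at this; omega
  · obtain ⟨w, i, j, hw, hi, hj, hij, rfl, rfl⟩ :=
      hπ.exists_insert_of_adjm ((adjm_eq_one h).2 (Or.inl hab))
    have h2 := Far.rowSum_lt hπ h hw hi hj hij h1
    rw [hrow _ (by rw [card_insert_of_notMem hi, hw]) i (by simp),
      hrow _ (by rw [card_insert_of_notMem hj, hw]) j (by simp)] at h2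
    omega

namespace BalancedCover

variable (H : BalancedCover Γ e π)
include H

theorem dual {d : ℕ} (hα : Fintype.card α = e + d) : BalancedCover Γ d fun x => π xᶜ where
  cwdr := H.cwdr
  cover := H.cover.dual_of_card hα
  two_le := by have := H.two_le'; omega
  two_le' := by have := H.two_le; omega
  row x hx i hi := by
    have := H.col xᶜ (by rw [card_compl]; omega) i (by simpa using hi)
    rwa [← rowSum_dual _ (by simpa using hi), compl_compl] at this
  col x hx i hi := by
    have := H.row xᶜ (by rw [card_compl]; omega) i (by simpa using hi)
    rwa [← colSum_dual _ (by simpa using hi), compl_compl] at this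
  quad x i i' j j' hx hi hi' hii hj hj' hjj a ha b hb hab := by
    have h1 : (exchange x a b)ᶜ = exchange xᶜ b a := by
      rw [← compl_exchange (x := xᶜ) (by simpa using hb) (by simpa using ha), compl_compl]
    have h2 : (opposite x i i' j j')ᶜ = opposite xᶜ j j' i i' := by
      ext c
      simp only [mem_compl, mem_opposite]
      grind
    rw [h1, h2] at hab
    exact (H.quad xᶜ j j' i i' (by rw [card_compl]; omega) (by simpa using hj) (by simpa using hj')
      hjj (by simpa using hi) (by simpa using hi') hii b (by simpa using hb) a (by simpa using ha)
      hab).symm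

section Block

variable [Fintype V] {x : Finset α} (hx : x.card = e) {i i' j j' : α} (hi : i ∈ x)
  (hi' : i' ∈ x) (hii : i ≠ i') (hj : j ∉ x) (hj' : j' ∉ x) (hjj : j ≠ j')
include hx hi hi' hii hj hj' hjj

theorem conv_block {φ ψ : V → V → ℤ} (hφ : Γ.Supported φ) (hψ : Γ.Supported ψ) :
    conv φ ψ (π x) (π (opposite x i i' j j')) =
      φ (π x) (π (exchange x i j)) * ψ (π (exchange x i j)) (π (opposite x i i' j j')) +
      φ (π x) (π (exchange x i j')) * ψ (π (exchange x i j')) (π (opposite x i i' j j')) +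
      φ (π x) (π (exchange x i' j)) * ψ (π (exchange x i' j)) (π (opposite x i i' j j')) +
      φ (π x) (π (exchange x i' j')) * ψ (π (exchange x i' j')) (π (opposite x i i' j j')) := by
  have h0 : ∀ a ∈ x, ∀ b ∈ xᶜ, ¬ ((a = i ∨ a = i') ∧ (b = j ∨ b = j')) →
      φ (π x) (π (exchange x a b)) * ψ (π (exchange x a b)) (π (opposite x i i' j j')) = 0 := by
    intro a ha b hb hab
    rcases Γ.adjm_eq_or (π (exchange x a b)) (π (opposite x i i' j j')) with h1 | h1
    · rw [hψ, h1, zero_mul, mul_zero]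
    · exact absurd (H.quad x i i' j j' hx hi hi' hii hj hj' hjj a ha b (by simpa using hb) h1) hab
  rw [conv, H.cover.sum_cell x hx hφ fun v => ψ v (π (opposite x i i' j j'))]
  rw [← sum_subset (s₁ := {i, i'}) (s₂ := x) (by
    intro a ha; rw [mem_insert, mem_singleton] at ha; rcases ha with rfl | rfl <;> assumption)
    (fun a ha hna => sum_eq_zero fun b hb => h0 a ha b hb fun h1 => hna (by simpa using h1.1)),
    sum_pair hii]
  have key : ∀ a ∈ x, ∑ b ∈ xᶜ,
      φ (π x) (π (exchange x a b)) * ψ (π (exchange x a b)) (π (opposite x i i' j j')) =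
      φ (π x) (π (exchange x a j)) * ψ (π (exchange x a j)) (π (opposite x i i' j j')) +
      φ (π x) (π (exchange x a j')) * ψ (π (exchange x a j')) (π (opposite x i i' j j')) := by
    intro a ha
    rw [← sum_subset (s₁ := {j, j'}) (s₂ := xᶜ) (by
      intro b hb; rw [mem_insert, mem_singleton] at hb
      rcases hb with rfl | rfl <;> simpa)
      (fun b hb hnb => h0 a ha b hb fun h1 => hnb (by simpa using h1.2)), sum_pair hjj]
  rw [key i hi, key i' hi']
  ring

theorem conv_adjm_block {φ : V → V → ℤ} (hφ : Γ.Supported φ) :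
    conv φ Γ.adjm (π x) (π (opposite x i i' j j')) =
      φ (π x) (π (exchange x i j)) + φ (π x) (π (exchange x i j')) +
      φ (π x) (π (exchange x i' j)) + φ (π x) (π (exchange x i' j')) := by
  rw [H.conv_block hx hi hi' hii hj hj' hjj hφ supported_adjm]
  have h1 := H.cover.adjm_cell hx hi hi' hii hj hj' hjj
  have h2 := H.cover.adjm_cell hx hi hi' hii hj' hj hjj.symm
  have h3 := H.cover.adjm_cell hx hi' hi hii.symm hj hj' hjj
  have h4 := H.cover.adjm_cell hx hi' hi hii.symm hj' hj hjj.symm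
  rw [opposite_swap_right hi hi' hii hj hj' hjj] at h2
  rw [opposite_swap_left hi hi' hii hj hj' hjj] at h3
  rw [opposite_swap hi hi' hii hj hj' hjj] at h4
  rw [h1, h2, h3, h4]
  ring

theorem conv_sym_block : conv Γ.sym Γ.adjm (π x) (π (opposite x i i' j j')) =
    zeroInd (grid Γ π x i j) + zeroInd (grid Γ π x i j') + zeroInd (grid Γ π x i' j) +
      zeroInd (grid Γ π x i' j') := by
  rw [H.conv_adjm_block hx hi hi' hii hj hj' hjj supported_sym, H.cover.sym_cell hx hi hj,
    H.cover.sym_cell hx hi hj', H.cover.sym_cell hx hi' hj, H.cover.sym_cell hx hi' hj']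

theorem conv_skew_block : conv Γ.skew Γ.adjm (π x) (π (opposite x i i' j j')) =
    grid Γ π x i j + grid Γ π x i j' + grid Γ π x i' j + grid Γ π x i' j' :=
  H.conv_adjm_block hx hi hi' hii hj hj' hjj supported_skew

end Block

theorem card_compl_ge {x : Finset α} (hx : x.card = e) : 2 ≤ (xᶜ).card := by
  have := H.two_le'
  rw [card_compl]
  omega

variable [Fintype V]

theorem exists_zeroGrid : ∃ s₀ s₁ d₁, ∀ x : Finset α, x.card = e →
    ZeroGrid x xᶜ (grid Γ π x) s₀ s₁ d₁ := by
  obtain ⟨s₀, s₁, d₁, hlaw⟩ := exists_blockLaw H.cwdr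
    fun a b => H.cover.distance_le_two H.cwdr H.row (a := a) (b := b)
  refine ⟨s₀, s₁, d₁, fun x hx => ⟨fun a _ b _ => Γ.skew_eq_or _ _, H.row x hx, fun b hb =>
    H.col x hx b (mem_compl.1 hb), fun i hi i' hi' j hj j' hj' hii hjj => ?_⟩⟩
  rw [mem_compl] at hj hj'
  have h1 := H.cover.opposite_ne hx hi hi' hii hj hj' hjj
  have h2 := hlaw _ _ h1.1 h1.2
  rwa [H.conv_sym_block hx hi hi' hii hj hj' hjj, H.conv_skew_block hx hi hi' hii hj hj' hjj] at h2

theorem exists_grid_ne_zero {x : Finset α} (hx : x.card = e) :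
    ∃ p ∈ x, ∃ q ∈ xᶜ, grid Γ π x p q ≠ 0 :=
  H.cover.exists_grid_ne_zero H.cwdr hx

theorem exists_grid_eq_zero {a b : V} (hab : Γ.sym a b = 1) {x : Finset α} (hx : x.card = e) :
    ∃ p ∈ x, ∃ q ∈ xᶜ, grid Γ π x p q = 0 :=
  H.cover.exists_grid_eq_zero H.cwdr hab hx

/-- The symmetric arcs do not form rows at all vertices. -/
theorem not_all_rows (hrow : ∀ x : Finset α, x.card = e →
    ∃ p ∈ x, ∀ a ∈ x, ∀ b ∈ xᶜ, grid Γ π x a b = 0 ↔ a = p) : False := by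
  obtain ⟨v⟩ := H.cwdr.wdr.nonempty
  obtain ⟨x, hx, -⟩ := H.cover.surj v
  obtain ⟨p, hp, hpx⟩ := hrow x hx
  obtain ⟨i, hi, hip⟩ := exists_mem_ne (show 1 < x.card by have := H.two_le; omega) p
  obtain ⟨j, hj, j', hj', hjj⟩ := one_lt_card.1 (show 1 < (xᶜ).card from H.card_compl_ge hx)
  have key : ∀ j ∉ x, ∀ j' ∉ x, j ≠ j' → ∀ r, (∀ a ∈ opposite x p i j j',
      ∀ b ∈ (opposite x p i j j')ᶜ, grid Γ π (opposite x p i j j') a b = 0 ↔ a = r) → j ≠ r := by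
    intro j hj j' hj' hjj r hr hjr
    have hz : (opposite x p i j j').card = e := by
      rw [card_opposite hp hi hip.symm hj hj' hjj, hx]
    have hip' : i ≠ p := hip
    have hiz : i ∉ opposite x p i j j' := by
      rw [mem_opposite]; grind
    have hjz : j ∈ opposite x p i j j' := by
      rw [mem_opposite]; grind
    have h1 := (hr j hjz i (mem_compl.2 hiz)).2 hjr
    rw [H.cover.grid_eq_zero hz hjz hiz] at h1
    have e1 : exchange (opposite x p i j j') j i = exchange x p j' := by
      rw [← opposite_swap_left hp hi hip.symm hj hj' hjj,
        exchange_opposite hi hp hip hj hj' hjj]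
    rw [e1] at h1
    have h2 := (hpx p hp j' (mem_compl.2 hj')).2 rfl
    rw [H.cover.grid_eq_zero hx hp hj'] at h2
    -- At the common neighbour `exchange x p j'` the zero row would contain the cell (j', p) leading
    -- back to x and the cell (i, j) leading to the opposite vertex, which lie in different rows.
    have hw : (exchange x p j').card = e := by rw [card_exchange hp hj', hx]
    obtain ⟨t, ht, htw⟩ := hrow _ hw
    have m1 : j' ∈ exchange x p j' := by rw [mem_exchange]; exact Or.inl rfl
    have m2 : p ∉ exchange x p j' := by rw [mem_exchange]; grind
    have m3 : i ∈ exchange x p j' := by rw [mem_exchange]; exact Or.inr ⟨hip, hi⟩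
    have m4 : j ∉ exchange x p j' := by rw [mem_exchange]; grind
    have h3 := (htw j' m1 p (mem_compl.2 m2)).1 (by
      rw [H.cover.grid_eq_zero hw m1 m2, exchange_back hp hj', sym_swap]; exact h2)
    have h4 := (htw i m3 j (mem_compl.2 m4)).1 (by
      rw [H.cover.grid_eq_zero hw m3 m4, sym_swap, ← opposite,
        opposite_swap_right hp hi hip.symm hj hj' hjj]; exact h1)
    exact hj' (h3.trans h4.symm ▸ hi)
  rw [mem_compl] at hj hj'
  have hz : (opposite x p i j j').card = e := by
    rw [card_opposite hp hi hip.symm hj hj' hjj, hx]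
  obtain ⟨r, hr, hrz⟩ := hrow _ hz
  have hjr := key j hj j' hj' hjj r hrz
  have hjr' := key j' hj' j hj hjj.symm r (by
    rw [opposite_swap_right hp hi hip.symm hj hj' hjj]; exact hrz)
  -- The block has at least two zeros seen from x and none seen from the opposite vertex, but the
  -- count is symmetric.
  have h1 := conv_sym_adjm_swap H.cwdr (π x) (π (opposite x p i j j'))
  rw [H.conv_sym_block hx hp hi hip.symm hj hj' hjj] at h1
  have mj : j ∈ opposite x p i j j' := by rw [mem_opposite]; grind
  have mj' : j' ∈ opposite x p i j j' := by rw [mem_opposite]; grind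
  have mp : p ∉ opposite x p i j j' := by rw [mem_opposite]; grind
  have mi : i ∉ opposite x p i j j' := by rw [mem_opposite]; grind
  have h2 := H.conv_sym_block hz mj mj' hjj mp mi hip.symm
  rw [opposite_opposite hp hi hip.symm hj hj' hjj, h1] at h2
  have z1 := (hpx p hp j (mem_compl.2 hj)).2 rfl
  have z2 := (hpx p hp j' (mem_compl.2 hj')).2 rfl
  have z3 := mt (hrz j mj p (mem_compl.2 mp)).1 hjr
  have z4 := mt (hrz j mj i (mem_compl.2 mi)).1 hjr
  have z5 := mt (hrz j' mj' p (mem_compl.2 mp)).1 hjr'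
  have z6 := mt (hrz j' mj' i (mem_compl.2 mi)).1 hjr'
  simp only [zeroInd, z1, z2, z3, z4, z5, z6, if_true, if_false] at h2
  split_ifs at h2 <;> omega

/-- Some block contains exactly one symmetric arc. -/
theorem exists_one {a b : V} (hab : Γ.sym a b = 1) : ∃ x : Finset α, x.card = e ∧
    ∃ p ∈ x, ∃ i ∈ x, ∃ j ∈ xᶜ, ∃ j' ∈ xᶜ, p ≠ i ∧ j ≠ j' ∧ grid Γ π x p j = 0 ∧
      grid Γ π x p j' ≠ 0 ∧ grid Γ π x i j ≠ 0 ∧ grid Γ π x i j' ≠ 0 := by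
  by_contra! hno
  obtain ⟨s₀, s₁, d₁, hG⟩ := H.exists_zeroGrid
  -- Without one-zero blocks the third alternative with s₁ = 1 never applies, so its constants may
  -- be replaced by 0.
  have hG' : ∀ x : Finset α, x.card = e → ZeroGrid x xᶜ (grid Γ π x) s₀ 0 0 ∨
      ZeroGrid x xᶜ (grid Γ π x) s₀ s₁ d₁ ∧ s₁ ≠ 1 := by
    intro x hx
    by_cases hs1 : s₁ = 1
    · left
      refine ⟨(hG x hx).val, (hG x hx).row, (hG x hx).col,
        fun a ha a' ha' b hb b' hb' haa hbb => ?_⟩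
      have h1 := (hG x hx).block a ha a' ha' b hb b' hb' haa hbb
      have n1 := hno x hx a ha a' ha' b hb b' hb' haa hbb
      have n2 := hno x hx a ha a' ha' b' hb' b hb haa hbb.symm
      have n3 := hno x hx a' ha' a ha b hb b' hb' haa.symm hbb
      have n4 := hno x hx a' ha' a ha b' hb' b hb haa.symm hbb.symm
      have hs : zeroInd (grid Γ π x a b) + zeroInd (grid Γ π x a b') +
          zeroInd (grid Γ π x a' b) + zeroInd (grid Γ π x a' b') ≠ 1 := by
        simp only [zeroInd]
        clear h1 hno hG
        split_ifs with z1 z2 z3 z4 z3 z4 z4 z2 z3 z4 z3 z4 z4 <;> first | decide | skip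
        all_goals first
          | exact absurd (n1 z1 ‹_› ‹_›) ‹_›
          | exact absurd (n2 z2 ‹_› ‹_›) ‹_›
          | exact absurd (n3 z3 ‹_› ‹_›) ‹_›
          | exact absurd (n4 z4 ‹_› ‹_›) ‹_›
          | (exfalso; simp_all)
      rcases h1 with h1 | h1 | h1
      · exact Or.inl h1
      · exact Or.inr (Or.inl h1)
      · exact absurd (h1.1.trans hs1) hs
    · exact Or.inr ⟨hG x hx, hs1⟩
  -- A zero row makes the number of columns even and e odd; a zero column does the opposite. So the
  -- parity of e decides the same case at all vertices.
  have hline : ∀ x : Finset α, x.card = e →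
      ((∃ p ∈ x, ∀ a ∈ x, ∀ b ∈ xᶜ, grid Γ π x a b = 0 ↔ a = p) ∧ Even (xᶜ).card ∧ ¬ Even e) ∨
      ((∃ q ∈ xᶜ, ∀ a ∈ x, ∀ b ∈ xᶜ, grid Γ π x a b = 0 ↔ b = q) ∧ ¬ Even (xᶜ).card ∧ Even e) := by
    have key : ∀ (x : Finset α) (s₁ d₁ : ℤ), x.card = e → s₁ ≠ 1 →
        ZeroGrid x xᶜ (grid Γ π x) s₀ s₁ d₁ → _ := fun x s₁ d₁ hx hs1 G =>
      G.full_line (H.exists_grid_ne_zero hx) (H.exists_grid_eq_zero hab hx) hs1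
        (by have := H.two_le; omega) (H.card_compl_ge hx)
    intro x hx
    have hl : (∃ p ∈ x, ∀ a ∈ x, ∀ b ∈ xᶜ, grid Γ π x a b = 0 ↔ a = p) ∨
        ∃ q ∈ xᶜ, ∀ a ∈ x, ∀ b ∈ xᶜ, grid Γ π x a b = 0 ↔ b = q := by
      rcases hG' x hx with G | ⟨G, hs1⟩
      · exact key x 0 0 hx (by decide) G
      · exact key x s₁ d₁ hx hs1 G
    rcases hl with ⟨p, hp, hpx⟩ | ⟨q, hq, hqx⟩
    · left
      refine ⟨⟨p, hp, hpx⟩, ?_⟩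
      obtain ⟨i, hi, hip⟩ := exists_mem_ne (show 1 < x.card by have := H.two_le; omega) p
      obtain ⟨j, hj⟩ := card_pos.1 (show 0 < (xᶜ).card by have := H.card_compl_ge hx; omega)
      have h1 := (hG x hx).parity hi
      rw [filter_false_of_mem fun b hb => mt (hpx i hi b hb).1 hip, card_empty, zero_add] at h1
      have h2 := (hG x hx).transpose.parity hj
      rw [filter_congr fun a ha => hpx a ha j hj, filter_eq', if_pos hp, card_singleton, hx,
        add_comm, Nat.even_add_one] at h2
      exact ⟨h1, h2⟩
    · right
      refine ⟨⟨q, hq, hqx⟩, ?_⟩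
      obtain ⟨j, hj, hjq⟩ := exists_mem_ne (show 1 < (xᶜ).card from H.card_compl_ge hx) q
      obtain ⟨i, hi⟩ := card_pos.1 (show 0 < x.card by have := H.two_le; omega)
      have h1 := (hG x hx).transpose.parity hj
      rw [filter_false_of_mem fun a ha => mt (hqx a ha j hj).1 hjq, card_empty, zero_add, hx] at h1
      have h2 := (hG x hx).parity hi
      rw [filter_congr fun b hb => hqx i hi b hb, filter_eq', if_pos hq, card_singleton,
        add_comm, Nat.even_add_one] at h2
      exact ⟨h2, h1⟩
  by_cases he : Even e
  · have hd : Fintype.card α = e + (Fintype.card α - e) := by have := H.two_le'; omega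
    refine (H.dual hd).not_all_rows fun x hx => ?_
    have hxc : (xᶜ).card = e := by rw [card_compl, hx]; omega
    rcases hline xᶜ hxc with h1 | ⟨⟨q, hq, hqx⟩, -⟩
    · exact absurd he h1.2.2
    · rw [compl_compl] at hq
      refine ⟨q, hq, fun a ha b hb => ?_⟩
      rw [← hqx b hb a (by simpa using ha), grid, grid, ← compl_exchange (x := xᶜ) hb (by simpa using ha),
        compl_compl]
  · refine H.not_all_rows fun x hx => ?_
    rcases hline x hx with h1 | h1
    · exact h1.1
    · exact absurd h1.2.2 he

end BalancedCover

end Digraph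

/-! ### Matchings on a six-set -/

/-- A matching between each 3-subset of a 6-set and its complement cannot be preserved by exchanges
along its edges. -/
theorem false_of_matching {α : Type*} [Fintype α] [DecidableEq α] (hα : Fintype.card α = 6)
    (Z : Finset α → α → α → Prop) (hZ : ∀ x i j, Z x i j → i ∈ x ∧ j ∉ x)
    (hex : ∀ x : Finset α, x.card = 3 → ∀ i ∈ x, ∃ j, Z x i j)
    (hr : ∀ x i j j', Z x i j → Z x i j' → j = j')
    (hc : ∀ x i i' j, Z x i j → Z x i' j → i = i')
    (hs : ∀ x i i' j j', Z x i j → Z x i' j' → i ≠ i' → Z (exchange x i j) i' j')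
    (hb : ∀ x i j, Z x i j → Z (exchange x i j) j i) : False := by
  obtain ⟨x, -, hx⟩ := exists_subset_card_eq (s := (univ : Finset α)) (n := 3)
    (by rw [card_univ, hα]; decide)
  obtain ⟨a, b, c, hab, hac, hbc, rfl⟩ := card_eq_three.1 hx
  obtain ⟨a', ha⟩ := hex _ hx a (by simp)
  obtain ⟨b', hb'⟩ := hex _ hx b (by simp)
  obtain ⟨c', hc'⟩ := hex _ hx c (by simp)
  have ma := (hZ _ _ _ ha).2
  have mb := (hZ _ _ _ hb').2
  have mc := (hZ _ _ _ hc').2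
  have nab : a' ≠ b' := by rintro rfl; exact hab (hc _ _ _ _ ha hb')
  have nac : a' ≠ c' := by rintro rfl; exact hac (hc _ _ _ _ ha hc')
  have nbc : b' ≠ c' := by rintro rfl; exact hbc (hc _ _ _ _ hb' hc')
  simp only [mem_insert, mem_singleton, not_or] at ma mb mc
  have huniv : ∀ u, u = a ∨ u = b ∨ u = c ∨ u = a' ∨ u = b' ∨ u = c' := by
    have h1 : ({a, b, c, a', b', c'} : Finset α) = univ := by
      rw [← card_eq_iff_eq_univ, hα]
      rw [card_insert_of_notMem, card_insert_of_notMem, card_insert_of_notMem,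
        card_insert_of_notMem, card_insert_of_notMem, card_singleton] <;>
      simp only [mem_insert, mem_singleton] <;> grind
    intro u
    have := mem_univ u
    rw [← h1] at this
    simpa using this
  -- In the set {a, b, a'} let u and u' be the partners of a and a' among c, b', c'. Exchanging
  -- along one of these edges leads, in each case, to a set also reached from {a, b, c} by its own
  -- edges, where a partner would not be unique.
  have hy : (exchange {a, b, c} c a').card = 3 := by
    rw [card_exchange (by simp) (by simp [ma]), hx]
  obtain ⟨u, hu⟩ := hex _ hy a (by simp [mem_exchange, hac])
  obtain ⟨u', hu'⟩ := hex _ hy a' (by simp [mem_exchange])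
  have nu := (hZ _ _ _ hu).2
  have nu' := (hZ _ _ _ hu').2
  have huu : u ≠ u' := by rintro rfl; exact ma.1 (hc _ _ _ _ hu hu').symm
  have h1 := hs _ _ _ _ _ hu hu' (Ne.symm ma.1)
  have h2 := hs _ _ _ _ _ hu' hu ma.1
  have h3 := hs _ _ _ _ _ hc' ha hac.symm
  simp only [mem_exchange, mem_insert, mem_singleton, not_or, not_and] at nu nu'
  have cu : u = c ∨ u = b' ∨ u = c' := by have := huniv u; grind
  have cu' : u' = c ∨ u' = b' ∨ u' = c' := by have := huniv u'; grind
  have hua : u' ≠ a := by rintro rfl; grind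
  rcases cu with rfl | rfl | rfl
  · rw [show exchange (exchange {a, b, u} u a') a u = exchange {a, b, u} a a' by
      ext z; simp only [mem_exchange, mem_insert, mem_singleton]; grind] at h1
    exact hua (hr _ _ _ _ h1 (hb _ _ _ ha))
  · rcases cu' with rfl | rfl | rfl
    · rw [show exchange (exchange {a, b, u'} u' a') a' u' = {a, b, u'} by
        ext z; simp only [mem_exchange, mem_insert, mem_singleton]; grind] at h2
      exact nab (hr _ _ _ _ ha h2)
    · exact huu rfl
    · rw [show exchange (exchange {a, b, c} c a') a' u' = exchange {a, b, c} c u' by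
        ext z; simp only [mem_exchange, mem_insert, mem_singleton]; grind] at h2
      exact nab (hr _ _ _ _ h3 h2)
  · rw [show exchange (exchange {a, b, c} c a') a u = exchange (exchange {a, b, c} c u) a a' by
      ext z; simp only [mem_exchange, mem_insert, mem_singleton]; grind] at h1
    exact hua (hr _ _ _ _ h1 (hb _ _ _ h3))

/-! ### Excluding symmetric arcs: one zero in each line -/

namespace ZeroGrid

variable {α : Type*} [DecidableEq α] {A B : Finset α} {D : α → α → ℤ} {s₀ s₁ d₁ : ℤ}

/-- A grid with exactly one zero in each row and column has few columns. -/
theorem card_le_three (G : ZeroGrid A B D s₀ s₁ d₁) (hs1 : s₁ = 1)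
    (hnz : ∃ p ∈ A, ∃ q ∈ B, D p q ≠ 0) (hA : 0 < A.card)
    (hrow : ∀ a ∈ A, ∃ b ∈ B, D a b = 0) (hcol : ∀ b ∈ B, ∃ a ∈ A, D a b = 0)
    (hone : ∀ a ∈ A, ∀ b ∈ B, ∀ b' ∈ B, D a b = 0 → D a b' = 0 → b = b') : B.card ≤ 3 := by
  have hodd : ∀ a ∈ A, ∀ b ∈ B, D a b % 2 = 0 → D a b = 0 := fun a ha b hb h => by
    have := G.val a ha b hb
    omega
  -- If D k c were 1, the block in columns b, c would have one zero and sum 3. With a the zero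
  -- column of row i, the block in columns a, c would have one zero and sum 1. Both sums cannot be
  -- d₁ up to sign.
  have hlaw : ∀ i ∈ A, ∀ k ∈ A, ∀ b ∈ B, ∀ c ∈ B, b ≠ c → D i b = 1 → D i c = 1 → D k b = 0 →
      D k c ≠ 1 := by
    intro i hi k hk b hb c hc hbc h1 h2 h3 h4
    have hik : i ≠ k := by rintro rfl; omega
    obtain ⟨a, ha, hia⟩ := hrow i hi
    have hab : a ≠ b := by rintro rfl; omega
    have hac : a ≠ c := by rintro rfl; omega
    have h5 := G.sum_zero_of_diag hnz hs1 hi hk ha hb hik hab hia h3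
    have h6 := G.block k hk i hi b hb c hc hik.symm hbc
    have h7 := G.block i hi k hk a ha c hc hik hac
    have h8 : D k a = -1 := by omega
    rw [h1, h2, h3, h4, BlockLaw] at h6
    rw [hia, h2, h4, h8, BlockLaw] at h7
    simp only [zeroInd] at h6 h7
    norm_num at h6 h7
    omega
  obtain ⟨i, hi⟩ := card_pos.1 hA
  have h1 : ∑ b ∈ B, (D i b + 1) = B.card := by rw [sum_add_distrib, G.row i hi]; simp
  have h2 : ∑ b ∈ B, (D i b + 1) = (B.filter fun b => D i b = 0).card +
      2 * (B.filter fun b => D i b = 1).card := by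
    rw [card_filter, card_filter]
    push_cast
    rw [mul_sum, ← sum_add_distrib]
    refine sum_congr rfl fun b hb => ?_
    rcases G.val i hi b hb with h | h | h <;> rw [h] <;> decide
  have h3 : (B.filter fun b => D i b = 0).card ≤ 1 := card_le_one.2 fun b hb c hc => by
    rw [mem_filter] at hb hc
    exact hone i hi b hb.1 c hc.1 hb.2 hc.2
  -- For two entries 1 in columns b and c, the rows k and k' with zeros there have D k c = D k' b =
  -- -1 by `hlaw`, although these entries must be opposite. A row thus has at most one zero and one
  -- entry 1, and the sum of D i b + 1 counts at most three columns.
  have h4 : (B.filter fun b => D i b = 1).card ≤ 1 := card_le_one.2 fun b hb c hc => by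
    rw [mem_filter] at hb hc
    by_contra hbc
    obtain ⟨k, hk, hkb⟩ := hcol b hb.1
    obtain ⟨k', hk', hkc⟩ := hcol c hc.1
    have hkk : k ≠ k' := by rintro rfl; exact hbc (hone k hk b hb.1 c hc.1 hkb hkc)
    have h5 := G.sum_zero_of_diag hnz hs1 hk hk' hb.1 hc.1 hkk hbc hkb hkc
    have h6 := hlaw i hi k hk b hb.1 c hc.1 hbc hb.2 hc.2 hkb
    have h7 := hlaw i hi k' hk' c hc.1 b hb.1 (Ne.symm hbc) hc.2 hb.2 hkc
    have h8 := G.val k hk c hc.1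
    have h9 := G.val k' hk' b hb.1
    omega
  omega

end ZeroGrid

namespace Digraph

variable {V α : Type*} [DecidableEq α] [Fintype α] [Fintype V] {Γ : Digraph V} {e : ℕ}
  {π : Finset α → V}

omit [Fintype α] [Fintype V] in
theorem grid_back {x : Finset α} {p j : α} (hp : p ∈ x) (hj : j ∉ x)
    (h1 : grid Γ π x p j = 0) : grid Γ π (exchange x p j) j p = 0 := by
  rw [grid, exchange_back hp hj, skew_swap, ← grid, h1, neg_zero]

omit [Fintype V] in
theorem grid_dual {x : Finset α} {i j : α} (hi : i ∈ x) (hj : j ∉ x) :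
    grid Γ (fun y => π yᶜ) xᶜ j i = grid Γ π x i j := by
  rw [grid, grid, compl_exchange hi hj, compl_compl]

namespace BalancedCover

variable (H : BalancedCover Γ e π)
include H

omit [Fintype V] in
theorem distance_le_two {a b : V} (hab : Γ.Adj a b) : Γ.distance b a ≤ 2 :=
  H.cover.distance_le_two H.cwdr H.row hab

/-- A block with an odd number of nonzero entries shows that `s₁ = 1`. -/
theorem exists_zeroGrid_one {u v : V} (huv : Γ.sym u v = 1) : ∃ s₀ d₁, ∀ x : Finset α, x.card = e →
    ZeroGrid x xᶜ (grid Γ π x) s₀ 1 d₁ := by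
  obtain ⟨s₀, s₁, d₁, hG⟩ := H.exists_zeroGrid
  obtain ⟨x, hx, p, hp, i, hi, j, hj, j', hj', hpi, hjj, h1, h2, h3, h4⟩ := H.exists_one huv
  have hs1 : s₁ = 1 := by
    have h5 := (hG x hx).block p hp i hi j hj j' hj' hpi hjj
    have v2 := (hG x hx).val p hp j' hj'
    have v3 := (hG x hx).val i hi j hj
    have v4 := (hG x hx).val i hi j' hj'
    simp only [BlockLaw, zeroInd, h1, h2, h3, h4, if_true, if_false] at h5
    omega
  exact ⟨s₀, d₁, hs1 ▸ hG⟩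

/-- Two vertices at two-way distance `(2, 2)` have two common neighbours along symmetric arcs. -/
theorem conv_sym_sym_eq_two {u v : V} (huv : Γ.sym u v = 1) {a b : V}
    (hab : Γ.twoWayDistance a b = (2, 2)) : conv Γ.sym Γ.sym a b = 2 := by
  obtain ⟨s₀, d₁, hG⟩ := H.exists_zeroGrid_one huv
  obtain ⟨x, hx, p, hp, i, hi, j, hj, j', hj', hpi, hjj, h1, h2, h3, h4⟩ := H.exists_one huv
  have hnz := H.exists_grid_ne_zero hx
  -- A block with two zeros on a diagonal has sum 0, so its far corner is at two-way distance (2,2),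
  -- and the count there is 2.
  obtain ⟨i', hi', hip, b', hb', hbj, hz⟩ := (hG x hx).exists_diag hnz hp hi hj hj' hpi h1 h2 h3
  have h5 := (hG x hx).sum_zero_of_diag hnz rfl hp hi' hj hb' hip.symm hbj.symm h1 hz
  rw [mem_compl] at hj hb'
  have h6 := H.conv_sym_block hx hp hi' hip.symm hj hb' hbj.symm
  have h7 := H.conv_skew_block hx hp hi' hip.symm hj hb' hbj.symm
  have h8 := H.cover.opposite_ne hx hp hi' hip.symm hj hb' hbj.symm
  simp only [zeroInd, h1, hz, h5.1, h5.2.1, if_true, if_false] at h6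
  have h9 : Γ.twoWayDistance (π x) (π (opposite x p i' j b')) = (2, 2) := by
    rcases twoWayDistance_cases H.cwdr (fun a b => H.distance_le_two) h8.1 h8.2 (by omega) with
      h | h | h
    · exact h
    · have := h.2; omega
    · have := h.2; omega
  have hcs := H.cwdr.isColor_conv (isColor_sym (Γ := Γ)) isColor_adjm
  have hss := H.cwdr.isColor_conv (isColor_sym (Γ := Γ)) isColor_sym
  have hw : (exchange x p j).card = e := by rw [card_exchange hp hj, hx]
  have m1 : j ∈ exchange x p j := by rw [mem_exchange]; exact Or.inl rfl
  have m2 : i' ∈ exchange x p j := by rw [mem_exchange]; exact Or.inr ⟨hip, hi'⟩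
  have m3 : p ∉ exchange x p j := by rw [mem_exchange]; grind
  have m4 : b' ∉ exchange x p j := by rw [mem_exchange]; grind
  have n1 : j ≠ i' := by rintro rfl; exact hj hi'
  have n2 : p ≠ b' := by rintro rfl; exact hb' hp
  have h10 := H.cover.opposite_ne hw m1 m2 n1 m3 m4 n2
  rw [opposite, exchange_back hp hj] at h10
  have h11 : Γ.sym (π (exchange x p j)) (π x) = 1 := by
    rw [sym_swap]; exact (H.cover.grid_eq_zero hx hp hj).1 h1
  have h12 := (H.cover.grid_eq_zero hx hi' hb').1 hz
  -- The two symmetric neighbours of x form another (2,2) pair with a symmetric path between them.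
  -- By `conv_sym_sym` their number of symmetric paths is even, and it lies between 1 and 2.
  have h13 := twoWayDistance_of_sym_sym H.cwdr h10.1 h10.2 h11 h12
  have h14 := conv_sym_sym_pos h11 h12
  have h15 := conv_sym_sym H.cwdr h13
  have h16 := conv_sym_strict_nonneg (Γ := Γ) (π (exchange x p j)) (π (exchange x i' b'))
  have h17 := hcs _ _ _ _ (h13.trans h9.symm)
  rw [hss _ _ _ _ (hab.trans h13.symm)]
  omega

/-- The symmetric arcs of a block with two symmetric arcs at `x` have symmetric opposite arcs. -/
theorem sym_opposite {u v : V} (huv : Γ.sym u v = 1) {x : Finset α} (hx : x.card = e)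
    {p i j k : α} (hp : p ∈ x) (hi : i ∈ x) (hpi : p ≠ i) (hj : j ∉ x) (hk : k ∉ x) (hjk : j ≠ k)
    (hz : grid Γ π x p j = 0)
    (hs : zeroInd (grid Γ π x p j) + zeroInd (grid Γ π x p k) + zeroInd (grid Γ π x i j) +
      zeroInd (grid Γ π x i k) = 2)
    (hd : grid Γ π x p j + grid Γ π x p k + grid Γ π x i j + grid Γ π x i k = 0) :
    Γ.sym (π (exchange x p j)) (π (opposite x p i j k)) = 1 := by
  have h6 := H.conv_sym_block hx hp hi hpi hj hk hjk
  have h7 := H.conv_skew_block hx hp hi hpi hj hk hjk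
  have h8 := H.cover.opposite_ne hx hp hi hpi hj hk hjk
  rw [hs] at h6
  rw [hd] at h7
  have h9 : Γ.twoWayDistance (π x) (π (opposite x p i j k)) = (2, 2) := by
    rcases twoWayDistance_cases H.cwdr (fun a b => H.distance_le_two) h8.1 h8.2 (by omega) with
      h | h | h
    · exact h
    · have := h.2; omega
    · have := h.2; omega
  have h10 := H.conv_sym_sym_eq_two huv h9
  rw [H.conv_block hx hp hi hpi hj hk hjk supported_sym supported_sym, H.cover.sym_cell hx hp hj,
    H.cover.sym_cell hx hp hk, H.cover.sym_cell hx hi hj, H.cover.sym_cell hx hi hk] at h10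
  have key : ∀ (a b : α) (w : V), zeroInd (grid Γ π x a b) * Γ.sym w (π (opposite x p i j k)) ≤
      zeroInd (grid Γ π x a b) := by
    intro a b w
    have := zeroInd_spec (Γ.skew_eq_or (π x) (π (exchange x a b)))
    rw [← grid] at this
    rcases Γ.sym_eq_or w (π (opposite x p i j k)) with h | h <;> rw [h] <;> omega
  have k1 := key p k (π (exchange x p k))
  have k2 := key i j (π (exchange x i j))
  have k3 := key i k (π (exchange x i k))
  have k4 : zeroInd (grid Γ π x p j) = 1 := by rw [hz]; rfl
  rw [k4, one_mul] at h10
  have := Γ.sym_eq_or (π (exchange x p j)) (π (opposite x p i j k))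
  omega

/-- Opposite symmetric arcs of a block persist. -/
theorem grid_exchange {u v : V} (huv : Γ.sym u v = 1) {x : Finset α} (hx : x.card = e)
    {p i j k : α} (hp : p ∈ x) (hi : i ∈ x) (hpi : p ≠ i) (hj : j ∉ x) (hk : k ∉ x) (hjk : j ≠ k)
    (h1 : grid Γ π x p j = 0) (h2 : grid Γ π x i k = 0) : grid Γ π (exchange x p j) i k = 0 := by
  obtain ⟨s₀, d₁, hG⟩ := H.exists_zeroGrid_one huv
  have h3 := (hG x hx).sum_zero_of_diag (H.exists_grid_ne_zero hx) rfl hp hi (mem_compl.2 hj)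
    (mem_compl.2 hk) hpi hjk h1 h2
  exact H.sym_opposite huv hx hp hi hpi hj hk hjk h1
    (by simp [zeroInd, h1, h2, h3.1, h3.2.1]) (by rw [h1, h2]; omega) |> fun h4 =>
      (H.cover.grid_eq_zero (by rw [card_exchange hp hj, hx])
        (by rw [mem_exchange]; exact Or.inr ⟨hpi.symm, hi⟩)
        (by rw [mem_exchange, not_or, not_and]; exact ⟨hjk.symm, fun _ => hk⟩)).2 h4

/-- The symmetric arcs at a vertex lie in different rows and columns. -/
theorem false_of_row {u v : V} (huv : Γ.sym u v = 1) {x : Finset α} (hx : x.card = e)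
    {p i j k : α} (hp : p ∈ x) (hi : i ∈ x) (hpi : p ≠ i) (hj : j ∉ x) (hk : k ∉ x) (hjk : j ≠ k)
    (hz : grid Γ π x p j = 0)
    (hs : zeroInd (grid Γ π x p j) + zeroInd (grid Γ π x p k) + zeroInd (grid Γ π x i j) +
      zeroInd (grid Γ π x i k) = 2)
    (hd : grid Γ π x p j + grid Γ π x p k + grid Γ π x i j + grid Γ π x i k = 0) :
    grid Γ π x i k = 0 := by
  have hw : (exchange x p j).card = e := by rw [card_exchange hp hj, hx]
  have m1 : j ∈ exchange x p j := by rw [mem_exchange]; exact Or.inl rfl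
  have m2 : i ∈ exchange x p j := by rw [mem_exchange]; exact Or.inr ⟨hpi.symm, hi⟩
  have m3 : p ∉ exchange x p j := by rw [mem_exchange]; grind
  have m4 : k ∉ exchange x p j := by rw [mem_exchange]; grind
  have n1 : j ≠ i := by rintro rfl; exact hj hi
  have n2 : p ≠ k := by rintro rfl; exact hk hp
  -- The opposite arc is a zero at (i, k) seen from `exchange x p j`; moving back along the
  -- symmetric edge carries it to x.
  have h1 := (H.cover.grid_eq_zero hw m2 m4).2 (H.sym_opposite huv hx hp hi hpi hj hk hjk hz hs hd)
  have h2 := H.grid_exchange huv hw m1 m2 n1 m3 m4 n2 (grid_back hp hj hz) h1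
  rwa [exchange_back hp hj] at h2

/-- Two zeros in one row would give a block with exactly two zeros and sum 0, for which
`false_of_row` produces a third. -/
theorem row_unique {u v : V} (huv : Γ.sym u v = 1) {x : Finset α} (hx : x.card = e)
    {p j k : α} (hp : p ∈ x) (hj : j ∉ x) (hk : k ∉ x)
    (h1 : grid Γ π x p j = 0) (h2 : grid Γ π x p k = 0) : j = k := by
  by_contra hjk
  obtain ⟨s₀, d₁, hG⟩ := H.exists_zeroGrid_one huv
  obtain ⟨i, hi, hip⟩ := exists_mem_ne (show 1 < x.card by have := H.two_le; omega) p
  have h3 := (hG x hx).sum_zero_of_row (H.exists_grid_ne_zero hx) rfl hp hi (mem_compl.2 hj)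
    (mem_compl.2 hk) hip.symm hjk h1 h2
  exact h3.2.1 (H.false_of_row huv hx hp hi hip.symm hj hk hjk h1
    (by simp [zeroInd, h1, h2, h3.1, h3.2.1]) (by rw [h1, h2]; omega))

theorem col_unique {u v : V} (huv : Γ.sym u v = 1) {x : Finset α} (hx : x.card = e)
    {p i j : α} (hp : p ∈ x) (hi : i ∈ x) (hj : j ∉ x)
    (h1 : grid Γ π x p j = 0) (h2 : grid Γ π x i j = 0) : p = i := by
  by_contra hpi
  obtain ⟨s₀, d₁, hG⟩ := H.exists_zeroGrid_one huv
  obtain ⟨k, hk, hkj⟩ := exists_mem_ne (show 1 < (xᶜ).card from H.card_compl_ge hx) j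
  have hnz : ∃ p ∈ xᶜ, ∃ q ∈ x, grid Γ π x q p ≠ 0 := by
    obtain ⟨p, hp, q, hq, h⟩ := H.exists_grid_ne_zero hx; exact ⟨q, hq, p, hp, h⟩
  have h3 := (hG x hx).transpose.sum_zero_of_row hnz rfl (mem_compl.2 hj) hk hp hi hkj.symm hpi h1 h2
  exact h3.2.1 (H.false_of_row huv hx hp hi hpi hj (mem_compl.1 hk) hkj.symm h1
    (by simp [zeroInd, h1, h2, h3.1, h3.2.1]) (by rw [h1, h2]; omega))

theorem odd_card {u v : V} (huv : Γ.sym u v = 1) : ¬ Even (Fintype.card α - e) := by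
  obtain ⟨s₀, d₁, hG⟩ := H.exists_zeroGrid_one huv
  obtain ⟨x, hx, -⟩ := H.cover.surj u
  obtain ⟨p, hp, q, hq, hpq⟩ := H.exists_grid_eq_zero huv hx
  have h1 : ((xᶜ).filter fun b => grid Γ π x p b = 0) = {q} := by
    ext b
    rw [mem_filter, mem_singleton]
    constructor
    · rintro ⟨hb, h2⟩
      rw [mem_compl] at hb hq
      exact H.row_unique huv hx hp hb hq h2 hpq
    · rintro rfl
      exact ⟨hq, hpq⟩
  have h2 := (hG x hx).parity hp
  rwa [h1, card_singleton, add_comm, Nat.even_add_one, card_compl, hx] at h2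

theorem row_exists {u v : V} (huv : Γ.sym u v = 1) {x : Finset α} (hx : x.card = e)
    {i : α} (hi : i ∈ x) : ∃ j ∈ xᶜ, grid Γ π x i j = 0 := by
  obtain ⟨s₀, d₁, hG⟩ := H.exists_zeroGrid_one huv
  have h2 := H.odd_card huv
  have h3 := (hG x hx).parity hi
  rw [card_compl, hx] at h3
  have h4 : 0 < ((xᶜ).filter fun b => grid Γ π x i b = 0).card := by
    rcases Nat.eq_zero_or_pos ((xᶜ).filter fun b => grid Γ π x i b = 0).card with h0 | h0
    · rw [h0, zero_add] at h3; exact absurd h3 h2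
    · exact h0
  obtain ⟨j, hj⟩ := card_pos.1 h4
  rw [mem_filter] at hj
  exact ⟨j, hj⟩

theorem col_exists {u v : V} (huv : Γ.sym u v = 1) {x : Finset α} (hx : x.card = e)
    {j : α} (hj : j ∈ xᶜ) : ∃ i ∈ x, grid Γ π x i j = 0 := by
  have hd : Fintype.card α = e + (Fintype.card α - e) := by have := H.two_le'; omega
  obtain ⟨i, hi, h1⟩ := (H.dual hd).row_exists huv (x := xᶜ) (by rw [card_compl, hx]) hj
  rw [compl_compl] at hi
  rw [mem_compl] at hj
  exact ⟨i, hi, by rwa [grid_dual hi hj] at h1⟩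

theorem card_le {u v : V} (huv : Γ.sym u v = 1) : Fintype.card α ≤ e + 3 := by
  obtain ⟨s₀, d₁, hG⟩ := H.exists_zeroGrid_one huv
  obtain ⟨x, hx, -⟩ := H.cover.surj u
  have h1 := (hG x hx).card_le_three rfl (H.exists_grid_ne_zero hx)
    (by have := H.two_le; omega) (fun a ha => H.row_exists huv hx ha)
    (fun b hb => H.col_exists huv hx hb) fun a ha b hb b' hb' h2 h3 =>
      H.row_unique huv hx ha (mem_compl.1 hb) (mem_compl.1 hb') h2 h3
  rw [card_compl] at h1
  omega

/-- There are no symmetric arcs. -/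
theorem sym_ne_one (u v : V) : Γ.sym u v ≠ 1 := by
  intro huv
  have hd : Fintype.card α = e + (Fintype.card α - e) := by have := H.two_le'; omega
  have h1 := H.card_le huv
  have h2 := (H.dual hd).card_le huv
  have h3 := H.odd_card huv
  have h4 := (H.dual hd).odd_card huv
  have h5 := H.two_le
  have h6 := H.two_le'
  rw [Nat.even_iff] at h3 h4
  -- The numbers of rows and columns are both odd, at least 2 and at most 3.
  have he : e = 3 := by omega
  subst he
  refine false_of_matching (α := α) (by omega)
    (fun x i j => x.card = 3 ∧ i ∈ x ∧ j ∉ x ∧ grid Γ π x i j = 0)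
    (fun x i j h => ⟨h.2.1, h.2.2.1⟩) (fun x hx i hi => ?_) (fun x i j j' h h' => ?_)
    (fun x i i' j h h' => ?_) (fun x i i' j j' h h' hii => ?_) fun x i j h => ?_
  · obtain ⟨j, hj, hij⟩ := H.row_exists huv hx hi
    exact ⟨j, hx, hi, mem_compl.1 hj, hij⟩
  · exact H.row_unique huv h.1 h.2.1 h.2.2.1 h'.2.2.1 h.2.2.2 h'.2.2.2
  · exact H.col_unique huv h.1 h.2.1 h'.2.1 h.2.2.1 h.2.2.2 h'.2.2.2
  · have hjj : j ≠ j' := by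
      rintro rfl
      exact hii (H.col_unique huv h.1 h.2.1 h'.2.1 h.2.2.1 h.2.2.2 h'.2.2.2)
    exact ⟨by rw [card_exchange h.2.1 h.2.2.1, h.1],
      by rw [mem_exchange]; exact Or.inr ⟨hii.symm, h'.2.1⟩,
      by rw [mem_exchange, not_or, not_and]; exact ⟨hjj.symm, fun _ => h'.2.2.1⟩,
      H.grid_exchange huv h.1 h.2.1 h'.2.1 hii h.2.2.1 h'.2.2.1 hjj h.2.2.2 h'.2.2.2⟩
  · exact ⟨by rw [card_exchange h.2.1 h.2.2.1, h.1], by rw [mem_exchange]; exact Or.inl rfl,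
      by have := h.2.1; have := h.2.2.1; rw [mem_exchange]; grind,
      grid_back h.2.1 h.2.2.1 h.2.2.2⟩

end BalancedCover

end Digraph

/-! ### Four-element sets split into pairs -/

section Quad

variable {α : Type*} [DecidableEq α]

/-- The set `x` consists of the four different elements `i, i', k, k'`. -/
structure IsQuad (x : Finset α) (i i' k k' : α) : Prop where
  eq : x = {i, i', k, k'}
  ne₁₂ : i ≠ i'
  ne₁₃ : i ≠ k
  ne₁₄ : i ≠ k'
  ne₂₃ : i' ≠ k
  ne₂₄ : i' ≠ k'
  ne₃₄ : k ≠ k'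

theorem exists_isQuad {x : Finset α} (hx : x.card = 4) {i i' : α} (hi : i ∈ x) (hi' : i' ∈ x)
    (hii : i ≠ i') : ∃ k k', IsQuad x i i' k k' := by
  have h1 : ((x.erase i).erase i').card = 2 := by
    rw [card_erase_of_mem (mem_erase.2 ⟨hii.symm, hi'⟩), card_erase_of_mem hi, hx]
  obtain ⟨k, k', hkk, h2⟩ := card_eq_two.1 h1
  have hk : k ∈ (x.erase i).erase i' := by rw [h2]; simp
  have hk' : k' ∈ (x.erase i).erase i' := by rw [h2]; simp
  simp only [mem_erase] at hk hk'
  refine ⟨k, k', ?_, hii, hk.2.1.symm, hk'.2.1.symm, hk.1.symm, hk'.1.symm, hkk⟩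
  rw [← h2, insert_erase (mem_erase.2 ⟨hii.symm, hi'⟩), insert_erase hi]

namespace IsQuad

variable {x : Finset α} {i i' k k' : α} (Q : IsQuad x i i' k k')
include Q

theorem swap_mid : IsQuad x i k i' k' :=
  ⟨by rw [Q.eq]; ext a; simp only [mem_insert, mem_singleton]; tauto, Q.ne₁₃, Q.ne₁₂,
    Q.ne₁₄, Q.ne₂₃.symm, Q.ne₃₄, Q.ne₂₄⟩

theorem mem₁ : i ∈ x := by rw [Q.eq]; simp

theorem mem₂ : i' ∈ x := by rw [Q.eq]; simp

theorem mem₃ : k ∈ x := by rw [Q.eq]; simp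

theorem mem₄ : k' ∈ x := by rw [Q.eq]; simp

theorem sum (f : α → ℤ) : ∑ a ∈ x, f a = f i + f i' + f k + f k' := by
  rw [Q.eq, sum_insert, sum_insert, sum_pair Q.ne₃₄]
  · ring
  · simp [Q.ne₂₃, Q.ne₂₄]
  · simp [Q.ne₁₂, Q.ne₁₃, Q.ne₁₄]

/-- Trading one half of x for one half of its complement gives the complement of the set obtained by
trading the other halves. -/
theorem compl_opposite [Fintype α] {j j' l l' : α} (R : IsQuad xᶜ j j' l l') :
    (opposite x i i' j j')ᶜ = opposite x k k' l l' := by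
  have h1 : ∀ a, a ∈ x ↔ a = i ∨ a = i' ∨ a = k ∨ a = k' := fun a => by rw [Q.eq]; simp
  have h2 : ∀ a, a ∉ x ↔ a = j ∨ a = j' ∨ a = l ∨ a = l' := fun a => by
    rw [← mem_compl, R.eq]; simp
  obtain ⟨-, q1, q2, q3, q4, q5, q6⟩ := Q
  obtain ⟨-, r1, r2, r3, r4, r5, r6⟩ := R
  ext a
  rw [mem_compl, mem_opposite, mem_opposite]
  have h3 := h1 a
  have h4 := h2 a
  by_cases ha : a ∈ x <;> grind

end IsQuad

end Quad

/-- The rows `i, i'` are the positions of the zeros. -/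
structure ZeroRows {α : Type*} (A B : Finset α) (D : α → α → ℤ) (i i' : α) : Prop where
  mem : i ∈ A
  mem' : i' ∈ A
  ne : i ≠ i'
  iff : ∀ a ∈ A, ∀ b ∈ B, D a b = 0 ↔ a = i ∨ a = i'

theorem ZeroRows.swap {α : Type*} {A B : Finset α} {D : α → α → ℤ} {i i' : α}
    (R : ZeroRows A B D i i') : ZeroRows A B D i' i :=
  ⟨R.mem', R.mem, R.ne.symm, fun a ha b hb => by rw [R.iff a ha b hb, or_comm]⟩

/-! ### Zeros in four by four matrices -/

section FourByFour

variable {α : Type*} [DecidableEq α] {A B : Finset α} {D : α → α → ℤ} {c d : ℕ}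

/-- The full row gives every column c - 4 zeros. In a column with a nonzero entry this number is
even and strictly between 0 and 4, so it is 2. By the same rule each row containing a zero is full.
-/
theorem ZeroRows.exists_of_full (hB : B.card = 4)
    (hc : ∀ b ∈ B, Even (A.filter fun a => D a b = 0).card)
    (hA : A.card = 4) (hnz : ∃ p ∈ A, ∃ q ∈ B, D p q ≠ 0)
    (hz : ∀ a ∈ A, ∀ b ∈ B, D a b = 0 →
      (B.filter fun b => D a b = 0).card + (A.filter fun a => D a b = 0).card = c)
    {a : α} (ha : a ∈ A) (h4 : (B.filter fun b => D a b = 0).card = 4) :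
    ∃ i i', ZeroRows A B D i i' := by
  have full : ∀ a, (B.filter fun b => D a b = 0).card = 4 → ∀ b ∈ B, D a b = 0 := fun a h =>
    filter_eq_self.1 (eq_of_subset_of_card_le (filter_subset _ _) (by omega))
  have hcol : ∀ b ∈ B, (A.filter fun a => D a b = 0).card = c - 4 := fun b hb => by
    have := hz a ha b hb (full a h4 b hb); omega
  obtain ⟨p, hp, q, hq, hpq⟩ := hnz
  have h1 := hcol q hq
  have h2 : (A.filter fun a => D a q = 0).card = 2 := by
    have h5 : 0 < (A.filter fun a => D a q = 0).card :=
      card_pos.2 ⟨a, mem_filter.2 ⟨ha, full a h4 q hq⟩⟩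
    have h6 : (A.filter fun a => D a q = 0).card < 4 := by
      rw [← hA]; exact card_lt_card (filter_ssubset.2 ⟨p, hp, hpq⟩)
    have := hc q hq
    rw [Nat.even_iff] at this
    omega
  have hrow : ∀ a' ∈ A, ∀ b ∈ B, D a' b = 0 → (B.filter fun b => D a' b = 0).card = 4 := by
    intro a' ha' b hb h
    have h5 := hz a' ha' b hb h
    have h6 := hz a ha b hb (full a h4 b hb)
    omega
  obtain ⟨i, i', hii, h3⟩ := card_eq_two.1 h2
  have hmem : ∀ a, a ∈ A ∧ D a q = 0 ↔ a = i ∨ a = i' := fun a => by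
    rw [← mem_filter (p := fun a => D a q = 0), h3]; simp
  refine ⟨i, i', ((hmem i).2 (Or.inl rfl)).1, ((hmem i').2 (Or.inr rfl)).1, hii, fun a' ha' b hb =>
    ⟨fun h => (hmem a').1 ⟨ha', full a' (hrow a' ha' b hb h) q hq⟩, fun h => ?_⟩⟩
  exact full a' (hrow a' ha' q hq ((hmem a').2 h).2) b hb

omit [DecidableEq α] in
-- An empty row and a row with both kinds of entries cannot coexist: at a common column with nonzero
-- entries in both, the rule gives different totals. The even number of zeros in a row is then
-- neither 0 nor 4.
theorem card_zeros_eq_two (hB : B.card = 4)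
    (hr : ∀ a ∈ A, Even (B.filter fun b => D a b = 0).card)
    (hex : ∃ p ∈ A, ∃ q ∈ B, D p q = 0)
    (hz' : ∀ a ∈ A, ∀ b ∈ B, D a b ≠ 0 →
      (B.filter fun b => D a b = 0).card + (A.filter fun a => D a b = 0).card = d)
    (h4 : ∀ a ∈ A, (B.filter fun b => D a b = 0).card ≠ 4) :
    ∀ a ∈ A, (B.filter fun b => D a b = 0).card = 2 := by
  have hle : ∀ a, (B.filter fun b => D a b = 0).card ≤ 4 := fun a => hB ▸ card_filter_le _ _
  have hne : ∀ a ∈ A, (B.filter fun b => D a b = 0).card ≠ 0 := by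
    intro a ha h0
    rw [card_eq_zero, filter_eq_empty_iff] at h0
    obtain ⟨p, hp, q, hq, hpq⟩ := hex
    have h1 : 0 < (B.filter fun b => D p b = 0).card := card_pos.2 ⟨q, mem_filter.2 ⟨hq, hpq⟩⟩
    have h2 : ∃ b ∈ B, D p b ≠ 0 := by
      by_contra! h3
      exact h4 p hp (by rw [filter_true_of_mem h3, hB])
    obtain ⟨b, hb, hpb⟩ := h2
    have h3 := hz' a ha b hb (h0 hb)
    have h5 := hz' p hp b hb hpb
    rw [filter_eq_empty_iff.2 h0, card_empty] at h3
    omega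
  intro a ha
  have h1 := hr a ha
  have h2 := hne a ha
  have h3 := hle a
  have h5 := h4 a ha
  rw [Nat.even_iff] at h1
  omega

end FourByFour

/-! ### The folded graph on eight points -/

namespace Digraph

variable {V α : Type*} [DecidableEq α] [Fintype α] {Γ : Digraph V} {π : Finset α → V}

theorem twoWayDistance_of_sym (h : Γ.IsCWDR) {u v : V} (huv : Γ.sym u v = 1) :
    Γ.twoWayDistance u v = (1, 1) := by
  have h1 := (sym_eq_one h).1 huv
  rw [twoWayDistance, h.wdr.distance_eq_one.2 h1.1, h.wdr.distance_eq_one.2 h1.2]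

theorem twoWayDistance_of_strict (h : Γ.IsCWDR) (hΓ : ∀ a b, Γ.Adj a b → Γ.distance b a ≤ 2)
    {u v : V} (huv : Γ.strict u v = 1) : Γ.twoWayDistance u v = (1, 2) := by
  have h1 := (strict_eq_one h).1 huv
  have h2 := hΓ _ _ h1.1
  rw [twoWayDistance, h.wdr.distance_eq_one.2 h1.1]
  have h3 := mt h.wdr.distance_eq_one.1 h1.2
  have h4 := h.wdr.stronglyConnected.distance_eq_zero (x := v) (y := u)
  have h5 : Γ.distance v u ≠ 0 := fun h0 => by
    have := h4.1 h0; subst this; exact h.wdr.loopless _ h1.1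
  congr 1
  omega

/-- Covers of the folded Johnson graph on eight points with vanishing line sums. -/
structure OctadCover (Γ : Digraph V) (π : Finset α → V) : Prop where
  cwdr : Γ.IsCWDR
  cover : LocalCover Γ 4 π
  card : Fintype.card α = 8
  row : ∀ x : Finset α, x.card = 4 → ∀ i ∈ x, rowSum Γ.skew π x i = 0
  col : ∀ x : Finset α, x.card = 4 → ∀ j ∉ x, colSum Γ.skew π x j = 0
  compl : ∀ x : Finset α, x.card = 4 → π xᶜ = π x
  quad : ∀ x i i' j j', x.card = 4 → i ∈ x → i' ∈ x → i ≠ i' → j ∉ x → j' ∉ x → j ≠ j' →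
    ∀ a ∈ x, ∀ b ∉ x, Γ.adjm (π (exchange x a b)) (π (opposite x i i' j j')) = 1 →
      ((a = i ∨ a = i') ∧ (b = j ∨ b = j')) ∨ (a ≠ i ∧ a ≠ i') ∧ b ≠ j ∧ b ≠ j'

namespace OctadCover

variable (H : OctadCover Γ π)
include H

theorem card_compl {x : Finset α} (hx : x.card = 4) : (xᶜ).card = 4 := by
  rw [Finset.card_compl, H.card, hx]

theorem dual : OctadCover Γ fun x => π xᶜ where
  cwdr := H.cwdr
  cover := H.cover.dual_of_card (by rw [H.card])
  card := H.card
  row x hx i hi := by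
    have := H.col xᶜ (H.card_compl hx) i (by simpa using hi)
    rwa [← rowSum_dual _ (by simpa using hi), compl_compl] at this
  col x hx i hi := by
    have := H.row xᶜ (H.card_compl hx) i (by simpa using hi)
    rwa [← colSum_dual _ (by simpa using hi), compl_compl] at this
  compl x hx := H.compl xᶜ (H.card_compl hx)
  quad x i i' j j' hx hi hi' hii hj hj' hjj a ha b hb hab := by
    have h1 : (exchange x a b)ᶜ = exchange xᶜ b a := by
      rw [← compl_exchange (x := xᶜ) (by simpa using hb) (by simpa using ha), compl_compl]
    have h2 : (opposite x i i' j j')ᶜ = opposite xᶜ j j' i i' := by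
      ext c
      simp only [mem_compl, mem_opposite]
      grind
    rw [h1, h2] at hab
    have := H.quad xᶜ j j' i i' (H.card_compl hx) (by simpa using hj) (by simpa using hj')
      hjj (by simpa using hi) (by simpa using hi') hii b (by simpa using hb) a (by simpa using ha)
      hab
    tauto

variable [Fintype V]

section Block

variable {x : Finset α} (hx : x.card = 4) {i i' k k' j j' l l' : α} (Q : IsQuad x i i' k k')
  (R : IsQuad xᶜ j j' l l')
include hx Q R

omit [Fintype V] in
theorem opposite_eq : π (opposite x i i' j j') = π (opposite x k k' l l') := by
  rw [← Q.compl_opposite R, H.compl]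
  rw [card_opposite Q.mem₁ Q.mem₂ Q.ne₁₂ (mem_compl.1 R.mem₁) (mem_compl.1 R.mem₂) R.ne₁₂, hx]

/-- The far vertex is reached through the rows i, i' and columns j, j' and equally through the
complementary rows and columns. This makes eight common neighbours. -/
theorem conv_eq {φ ψ : V → V → ℤ} (hφ : Γ.Supported φ) (hψ : Γ.Supported ψ) :
    conv φ ψ (π x) (π (opposite x i i' j j')) =
      φ (π x) (π (exchange x i j)) * ψ (π (exchange x i j)) (π (opposite x i i' j j')) +
      φ (π x) (π (exchange x i j')) * ψ (π (exchange x i j')) (π (opposite x i i' j' j)) +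
      φ (π x) (π (exchange x i' j)) * ψ (π (exchange x i' j)) (π (opposite x i' i j j')) +
      φ (π x) (π (exchange x i' j')) * ψ (π (exchange x i' j')) (π (opposite x i' i j' j)) +
      φ (π x) (π (exchange x k l)) * ψ (π (exchange x k l)) (π (opposite x k k' l l')) +
      φ (π x) (π (exchange x k l')) * ψ (π (exchange x k l')) (π (opposite x k k' l' l)) +
      φ (π x) (π (exchange x k' l)) * ψ (π (exchange x k' l)) (π (opposite x k' k l l')) +
      φ (π x) (π (exchange x k' l')) * ψ (π (exchange x k' l')) (π (opposite x k' k l' l)) := by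
  have hj := mem_compl.1 R.mem₁
  have hj' := mem_compl.1 R.mem₂
  have hl := mem_compl.1 R.mem₃
  have hl' := mem_compl.1 R.mem₄
  rw [opposite_swap_right Q.mem₁ Q.mem₂ Q.ne₁₂ hj hj' R.ne₁₂,
    opposite_swap_left Q.mem₁ Q.mem₂ Q.ne₁₂ hj hj' R.ne₁₂,
    opposite_swap Q.mem₁ Q.mem₂ Q.ne₁₂ hj hj' R.ne₁₂,
    opposite_swap_right Q.mem₃ Q.mem₄ Q.ne₃₄ hl hl' R.ne₃₄,
    opposite_swap_left Q.mem₃ Q.mem₄ Q.ne₃₄ hl hl' R.ne₃₄,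
    opposite_swap Q.mem₃ Q.mem₄ Q.ne₃₄ hl hl' R.ne₃₄, ← H.opposite_eq hx Q R]
  have h0 : ∀ a ∈ x, ∀ b ∉ x, ¬ (((a = i ∨ a = i') ∧ (b = j ∨ b = j')) ∨
      (a ≠ i ∧ a ≠ i') ∧ b ≠ j ∧ b ≠ j') →
      ψ (π (exchange x a b)) (π (opposite x i i' j j')) = 0 := by
    intro a ha b hb hab
    rcases Γ.adjm_eq_or (π (exchange x a b)) (π (opposite x i i' j j')) with h1 | h1
    · rw [hψ, h1, zero_mul]
    · exact absurd (H.quad x i i' j j' hx Q.mem₁ Q.mem₂ Q.ne₁₂ hj hj' R.ne₁₂ a ha b hb h1) hab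
  rw [conv, H.cover.sum_cell x hx hφ fun v => ψ v (π (opposite x i i' j j')), Q.sum,
    R.sum, R.sum, R.sum, R.sum]
  rw [h0 i Q.mem₁ l hl (by simp [R.ne₁₃.symm, R.ne₂₃.symm]),
    h0 i Q.mem₁ l' hl' (by simp [R.ne₁₄.symm, R.ne₂₄.symm]),
    h0 i' Q.mem₂ l hl (by simp [R.ne₁₃.symm, R.ne₂₃.symm]),
    h0 i' Q.mem₂ l' hl' (by simp [R.ne₁₄.symm, R.ne₂₄.symm]),
    h0 k Q.mem₃ j hj (by simp [Q.ne₁₃.symm, Q.ne₂₃.symm]),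
    h0 k Q.mem₃ j' hj' (by simp [Q.ne₁₃.symm, Q.ne₂₃.symm]),
    h0 k' Q.mem₄ j hj (by simp [Q.ne₁₄.symm, Q.ne₂₄.symm]),
    h0 k' Q.mem₄ j' hj' (by simp [Q.ne₁₄.symm, Q.ne₂₄.symm])]
  ring

theorem conv_adjm_eq {φ : V → V → ℤ} (hφ : Γ.Supported φ) :
    conv φ Γ.adjm (π x) (π (opposite x i i' j j')) =
      φ (π x) (π (exchange x i j)) + φ (π x) (π (exchange x i j')) +
      φ (π x) (π (exchange x i' j)) + φ (π x) (π (exchange x i' j')) +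
      φ (π x) (π (exchange x k l)) + φ (π x) (π (exchange x k l')) +
      φ (π x) (π (exchange x k' l)) + φ (π x) (π (exchange x k' l')) := by
  have hj := mem_compl.1 R.mem₁
  have hj' := mem_compl.1 R.mem₂
  have hl := mem_compl.1 R.mem₃
  have hl' := mem_compl.1 R.mem₄
  rw [H.conv_eq hx Q R hφ supported_adjm,
    H.cover.adjm_cell hx Q.mem₁ Q.mem₂ Q.ne₁₂ hj hj' R.ne₁₂,
    H.cover.adjm_cell hx Q.mem₁ Q.mem₂ Q.ne₁₂ hj' hj R.ne₁₂.symm,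
    H.cover.adjm_cell hx Q.mem₂ Q.mem₁ Q.ne₁₂.symm hj hj' R.ne₁₂,
    H.cover.adjm_cell hx Q.mem₂ Q.mem₁ Q.ne₁₂.symm hj' hj R.ne₁₂.symm,
    H.cover.adjm_cell hx Q.mem₃ Q.mem₄ Q.ne₃₄ hl hl' R.ne₃₄,
    H.cover.adjm_cell hx Q.mem₃ Q.mem₄ Q.ne₃₄ hl' hl R.ne₃₄.symm,
    H.cover.adjm_cell hx Q.mem₄ Q.mem₃ Q.ne₃₄.symm hl hl' R.ne₃₄,
    H.cover.adjm_cell hx Q.mem₄ Q.mem₃ Q.ne₃₄.symm hl' hl R.ne₃₄.symm]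
  ring

theorem conv_sym_eq : conv Γ.sym Γ.adjm (π x) (π (opposite x i i' j j')) =
    zeroInd (grid Γ π x i j) + zeroInd (grid Γ π x i j') +
    zeroInd (grid Γ π x i' j) + zeroInd (grid Γ π x i' j') +
    zeroInd (grid Γ π x k l) + zeroInd (grid Γ π x k l') +
    zeroInd (grid Γ π x k' l) + zeroInd (grid Γ π x k' l') := by
  have hj := mem_compl.1 R.mem₁
  have hj' := mem_compl.1 R.mem₂
  have hl := mem_compl.1 R.mem₃
  have hl' := mem_compl.1 R.mem₄
  rw [H.conv_adjm_eq hx Q R supported_sym, H.cover.sym_cell hx Q.mem₁ hj,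
    H.cover.sym_cell hx Q.mem₁ hj', H.cover.sym_cell hx Q.mem₂ hj, H.cover.sym_cell hx Q.mem₂ hj',
    H.cover.sym_cell hx Q.mem₃ hl, H.cover.sym_cell hx Q.mem₃ hl', H.cover.sym_cell hx Q.mem₄ hl,
    H.cover.sym_cell hx Q.mem₄ hl']

omit [Fintype V] Q in
theorem grid_row {a : α} (ha : a ∈ x) :
    grid Γ π x a j + grid Γ π x a j' + grid Γ π x a l + grid Γ π x a l' = 0 := by
  have := H.row x hx a ha
  rwa [rowSum, R.sum] at this

omit [Fintype V] R in
theorem grid_col {b : α} (hb : b ∈ xᶜ) :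
    grid Γ π x i b + grid Γ π x i' b + grid Γ π x k b + grid Γ π x k' b = 0 := by
  have := H.col x hx b (mem_compl.1 hb)
  rwa [colSum, Q.sum] at this

/-- Vanishing row and column sums give the complementary block the same sum. -/
theorem conv_skew_eq : conv Γ.skew Γ.adjm (π x) (π (opposite x i i' j j')) =
    2 * (grid Γ π x i j + grid Γ π x i j' + grid Γ π x i' j + grid Γ π x i' j') := by
  rw [H.conv_adjm_eq hx Q R supported_skew]
  have h1 := H.grid_row hx R Q.mem₃
  have h2 := H.grid_row hx R Q.mem₄
  have h3 := H.grid_col hx Q R.mem₁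
  have h4 := H.grid_col hx Q R.mem₂
  simp only [grid] at *
  omega

end Block

omit [Fintype V] in
theorem distance_le_two {a b : V} (hab : Γ.Adj a b) : Γ.distance b a ≤ 2 :=
  H.cover.distance_le_two H.cwdr H.row hab

end OctadCover

end Digraph

namespace Digraph

variable {V α : Type*} [DecidableEq α] [Fintype α] {Γ : Digraph V} {π : Finset α → V}

theorem LocalCover.rowSum_sym {e : ℕ} (hπ : LocalCover Γ e π) {x : Finset α} (hx : x.card = e)
    {a : α} (ha : a ∈ x) :
    rowSum Γ.sym π x a = ((xᶜ).filter fun b => grid Γ π x a b = 0).card := by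
  rw [rowSum, card_filter]
  push_cast
  exact sum_congr rfl fun b hb => by rw [hπ.sym_cell hx ha (mem_compl.1 hb), zeroInd]

omit [Fintype α] in
theorem LocalCover.colSum_sym {e : ℕ} (hπ : LocalCover Γ e π) {x : Finset α} (hx : x.card = e)
    {b : α} (hb : b ∉ x) :
    colSum Γ.sym π x b = (x.filter fun a => grid Γ π x a b = 0).card := by
  rw [colSum, card_filter]
  push_cast
  exact sum_congr rfl fun a ha => by rw [hπ.sym_cell hx ha hb, zeroInd]

theorem sym_self (h : Γ.IsCWDR) (u : V) : Γ.sym u u = 0 := by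
  rcases Γ.sym_eq_or u u with h1 | h1
  · exact h1
  · exact absurd ((sym_eq_one h).1 h1).1 (h.wdr.loopless u)

omit [Fintype α] in
theorem grid_eq_or (x : Finset α) (a b : α) :
    grid Γ π x a b = 0 ∨ grid Γ π x a b = 1 ∨ grid Γ π x a b = -1 := Γ.skew_eq_or _ _

namespace OctadCover

variable (H : OctadCover Γ π)
include H

theorem even_row {x : Finset α} (hx : x.card = 4) {a : α} (ha : a ∈ x) :
    Even ((xᶜ).filter fun b => grid Γ π x a b = 0).card := by
  have := even_card_zeros_add_card (f := grid Γ π x a) (fun b _ => grid_eq_or x a b) (H.row x hx a ha)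
  rw [H.card_compl hx] at this
  rw [Nat.even_iff] at *
  omega

theorem even_col {x : Finset α} (hx : x.card = 4) {b : α} (hb : b ∉ x) :
    Even (x.filter fun a => grid Γ π x a b = 0).card := by
  have := even_card_zeros_add_card (s := x) (f := fun a => grid Γ π x a b)
    (fun a _ => grid_eq_or x a b)
    (H.col x hx b hb)
  rw [hx] at this
  rw [Nat.even_iff] at *
  omega

variable [Fintype V]

/-- The number of zeros in the two lines through a cell depends only on whether the cell is zero. -/
theorem exists_lines : ∃ c d : ℕ, ∀ x : Finset α, x.card = 4 → ∀ a ∈ x, ∀ b ∈ xᶜ,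
    (grid Γ π x a b = 0 → ((xᶜ).filter fun b => grid Γ π x a b = 0).card +
      (x.filter fun a => grid Γ π x a b = 0).card = c) ∧
    (grid Γ π x a b ≠ 0 → ((xᶜ).filter fun b => grid Γ π x a b = 0).card +
      (x.filter fun a => grid Γ π x a b = 0).card = d) := by
  have hc := isColor_lines H.cwdr (isColor_sym (Γ := Γ))
  obtain ⟨f, hf⟩ := hc.exists_eq
  refine ⟨(f (1, 1)).toNat, (f (1, 2)).toNat, fun x hx a ha b hb => ?_⟩
  rw [mem_compl] at hb
  have h1 := H.cover.lines_eq H.cwdr hx ha hb (supported_sym (Γ := Γ))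
  rw [H.cover.rowSum_sym hx ha, H.cover.colSum_sym hx hb] at h1
  refine ⟨fun h0 => ?_, fun h0 => ?_⟩
  · rw [hf, twoWayDistance_of_sym H.cwdr ((H.cover.grid_eq_zero hx ha hb).1 h0)] at h1
    omega
  · have h2 := H.cover.adj x a b hx ha hb
    rw [adjm_eq_sym_add] at h2
    have h3 := mt (H.cover.grid_eq_zero hx ha hb).2 h0
    have h4 := Γ.sym_eq_or (π x) (π (exchange x a b))
    rcases Γ.strict_eq_or (π x) (π (exchange x a b)) with h5 | h5
    · have h6 : Γ.strict (π (exchange x a b)) (π x) = 1 := by omega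
      rw [← one_mul (Γ.lines _ _ _), ← lines_swap H.cwdr isColor_sym (c := 1)
        (fun x y => by rw [sym_swap, one_mul]), hf,
        twoWayDistance_of_strict H.cwdr (fun a b => H.distance_le_two) h6] at h1
      omega
    · rw [hf, twoWayDistance_of_strict H.cwdr (fun a b => H.distance_le_two) h5] at h1
      omega

/-- Two zeros in each line give complementary blocks equally many zeros and equal sums. Halving the
law for eight common neighbours yields a `ZeroGrid`, to which `false_of_two_zeros` applies. -/
theorem false_of_all_two {x : Finset α} (hx : x.card = 4)
    (hr : ∀ a ∈ x, ((xᶜ).filter fun b => grid Γ π x a b = 0).card = 2)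
    (hc : ∀ b ∈ xᶜ, (x.filter fun a => grid Γ π x a b = 0).card = 2) : False := by
  obtain ⟨s₀, s₁, d₁, hlaw⟩ := exists_blockLaw H.cwdr fun a b => H.distance_le_two (a := a) (b := b)
  have G : ZeroGrid x xᶜ (grid Γ π x) (s₀ / 2) (s₁ / 2) (d₁ / 2) := by
    refine ⟨fun a _ b _ => grid_eq_or x a b, H.row x hx, fun b hb => H.col x hx b (mem_compl.1 hb),
      fun i hi i' hi' j hj j' hj' hii hjj => ?_⟩
    obtain ⟨k, k', Q⟩ := exists_isQuad hx hi hi' hii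
    obtain ⟨l, l', R⟩ := exists_isQuad (H.card_compl hx) hj hj' hjj
    have h1 := H.cover.opposite_ne hx hi hi' hii (mem_compl.1 hj) (mem_compl.1 hj') hjj
    have h2 := hlaw _ _ h1.1 h1.2
    rw [H.conv_sym_eq hx Q R, H.conv_skew_eq hx Q R] at h2
    have h3 : ∀ a ∈ x, zeroInd (grid Γ π x a j) + zeroInd (grid Γ π x a j') +
        zeroInd (grid Γ π x a l) + zeroInd (grid Γ π x a l') = 2 := by
      intro a ha
      have := hr a ha
      rw [card_filter] at this
      zify at this
      rw [R.sum] at this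
      exact this
    have h4 : ∀ b ∈ xᶜ, zeroInd (grid Γ π x i b) + zeroInd (grid Γ π x i' b) +
        zeroInd (grid Γ π x k b) + zeroInd (grid Γ π x k' b) = 2 := by
      intro b hb
      have := hc b hb
      rw [card_filter] at this
      zify at this
      rw [Q.sum] at this
      exact this
    have r1 := h3 i hi
    have r2 := h3 i' hi'
    have c1 := h4 l R.mem₃
    have c2 := h4 l' R.mem₄
    generalize hs : zeroInd (grid Γ π x i j) + zeroInd (grid Γ π x i j') +
      zeroInd (grid Γ π x i' j) + zeroInd (grid Γ π x i' j') = s at *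
    generalize hd : grid Γ π x i j + grid Γ π x i j' + grid Γ π x i' j + grid Γ π x i' j' = d at *
    have hss : s + zeroInd (grid Γ π x k l) + zeroInd (grid Γ π x k l') +
        zeroInd (grid Γ π x k' l) + zeroInd (grid Γ π x k' l') = 2 * s := by omega
    rw [hss] at h2
    clear hss r1 r2 c1 c2 h3 h4 hs hd
    rw [BlockLaw] at *
    omega
  exact G.false_of_two_zeros (by omega) (by rw [H.card_compl hx]; decide) hr hc

/-- The number of zeros in a line is even. A full line spreads to the asserted pattern, and without
full lines all counts are 2, which is excluded. -/
theorem zeroRows_or {u v : V} (huv : Γ.sym u v = 1) {x : Finset α} (hx : x.card = 4) :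
    (∃ i i', ZeroRows x xᶜ (grid Γ π x) i i') ∨
      ∃ j j', ZeroRows xᶜ x (fun b a => grid Γ π x a b) j j' := by
  obtain ⟨c, d, hl⟩ := H.exists_lines
  have hz := H.cover.exists_grid_eq_zero H.cwdr huv hx
  have hnz := H.cover.exists_grid_ne_zero H.cwdr hx
  by_cases h1 : ∃ a ∈ x, ((xᶜ).filter fun b => grid Γ π x a b = 0).card = 4
  · obtain ⟨a, ha, h2⟩ := h1
    exact Or.inl (ZeroRows.exists_of_full (H.card_compl hx) (fun b hb => H.even_col hx (mem_compl.1 hb))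
      hx hnz (fun a ha b hb => (hl x hx a ha b hb).1) ha h2)
  by_cases h2 : ∃ b ∈ xᶜ, (x.filter fun a => grid Γ π x a b = 0).card = 4
  · obtain ⟨b, hb, h3⟩ := h2
    refine Or.inr (ZeroRows.exists_of_full (c := c) hx (fun a ha => H.even_row hx ha)
      (H.card_compl hx) ?_ (fun b hb a ha h0 => ?_) hb h3)
    · obtain ⟨p, hp, q, hq, h⟩ := hnz; exact ⟨q, hq, p, hp, h⟩
    · rw [add_comm]; exact (hl x hx a ha b hb).1 h0
  push Not at h1 h2
  exfalso
  refine H.false_of_all_two hx (card_zeros_eq_two (d := d) (H.card_compl hx) (fun a ha => H.even_row hx ha) hz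
    (fun a ha b hb => (hl x hx a ha b hb).2) h1) (card_zeros_eq_two (d := d) hx
    (fun b hb => H.even_col hx (mem_compl.1 hb)) ?_ (fun b hb a ha h0 => ?_) h2)
  · obtain ⟨p, hp, q, hq, h⟩ := hz; exact ⟨q, hq, p, hp, h⟩
  · rw [add_comm]; exact (hl x hx a ha b hb).2 h0

omit [Fintype V] H in
theorem zeroRows_dual {x : Finset α} {j j' : α}
    (hR : ZeroRows xᶜ x (fun b a => grid Γ π x a b) j j') :
    ZeroRows xᶜ xᶜᶜ (grid Γ (fun y => π yᶜ) xᶜ) j j' := by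
  refine ⟨hR.mem, hR.mem', hR.ne, fun b hb a ha => ?_⟩
  rw [compl_compl] at ha
  rw [grid_dual ha (mem_compl.1 hb)]
  exact hR.iff b hb a ha

/-- The common neighbours along symmetric arcs of the ends of a symmetric arc. -/
theorem conv_edge {x : Finset α} (hx : x.card = 4) {i i' j j' l l' : α}
    (hR : ZeroRows x xᶜ (grid Γ π x) i i') (R : IsQuad xᶜ j j' l l') :
    conv Γ.sym Γ.sym (π x) (π (exchange x i j)) =
      zeroInd (grid Γ π (exchange x i j) j j') + zeroInd (grid Γ π (exchange x i j) j l) +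
      zeroInd (grid Γ π (exchange x i j) j l') + zeroInd (grid Γ π (exchange x i j) i' i) := by
  obtain ⟨k, k', Q⟩ := exists_isQuad hx hR.mem hR.mem' hR.ne
  have hj := mem_compl.1 R.mem₁
  have hy : (exchange x i j).card = 4 := by rw [card_exchange hR.mem hj, hx]
  have z1 : ∀ b ∈ xᶜ, Γ.sym (π x) (π (exchange x i b)) = 1 := fun b hb =>
    (H.cover.grid_eq_zero hx hR.mem (mem_compl.1 hb)).1 ((hR.iff i hR.mem b hb).2 (Or.inl rfl))
  have z2 : ∀ b ∈ xᶜ, Γ.sym (π x) (π (exchange x i' b)) = 1 := fun b hb =>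
    (H.cover.grid_eq_zero hx hR.mem' (mem_compl.1 hb)).1 ((hR.iff i' hR.mem' b hb).2 (Or.inr rfl))
  have z3 : ∀ a ∈ x, a ≠ i → a ≠ i' → ∀ b ∈ xᶜ, Γ.sym (π x) (π (exchange x a b)) = 0 := by
    intro a ha h1 h2 b hb
    have h3 := mt (H.cover.grid_eq_zero hx ha (mem_compl.1 hb)).2
      (fun h0 => by rcases (hR.iff a ha b hb).1 h0 with h | h; exacts [h1 h, h2 h])
    have := Γ.sym_eq_or (π x) (π (exchange x a b))
    omega
  have m1 : j ∈ exchange x i j := by rw [mem_exchange]; exact Or.inl rfl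
  have m2 : i ∉ exchange x i j := by
    rw [mem_exchange]; rintro (h | h); exacts [hj (h ▸ hR.mem), h.1 rfl]
  have w1 : ∀ b ∈ xᶜ, b ≠ j → Γ.sym (π (exchange x i b)) (π (exchange x i j)) =
      zeroInd (grid Γ π (exchange x i j) j b) := by
    intro b hb hbj
    rw [sym_swap, ← H.cover.sym_cell hy m1 (by
      rw [mem_exchange, not_or, not_and]; exact ⟨hbj, fun _ => mem_compl.1 hb⟩),
      exchange_exchange_same hj]
  have w2 : Γ.sym (π (exchange x i' j)) (π (exchange x i j)) =
      zeroInd (grid Γ π (exchange x i j) i' i) := by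
    rw [sym_swap, ← H.cover.sym_cell hy (by rw [mem_exchange]; exact Or.inr ⟨hR.ne.symm, hR.mem'⟩) m2,
      exchange_exchange_col hR.mem hR.mem' hR.ne.symm hj]
  have w3 : ∀ b ∈ xᶜ, b ≠ j → Γ.sym (π (exchange x i' b)) (π (exchange x i j)) = 0 := by
    intro b hb hbj
    rcases Γ.adjm_eq_or (π (exchange x i' b)) (π (exchange x i j)) with h1 | h1
    · rw [supported_sym, h1, zero_mul]
    · rcases H.cover.nonadj x i' b i j hx hR.mem' (mem_compl.1 hb) hR.mem hj h1 with h2 | h2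
      · exact absurd h2.symm hR.ne
      · exact absurd h2 hbj
  rw [conv, H.cover.sum_cell x hx supported_sym fun v => Γ.sym v (π (exchange x i j)), Q.sum,
    R.sum, R.sum, R.sum, R.sum]
  simp only [z1 _ R.mem₁, z1 _ R.mem₂, z1 _ R.mem₃, z1 _ R.mem₄, z2 _ R.mem₁, z2 _ R.mem₂,
    z2 _ R.mem₃, z2 _ R.mem₄, z3 _ Q.mem₃ Q.ne₁₃.symm Q.ne₂₃.symm _ R.mem₁,
    z3 _ Q.mem₃ Q.ne₁₃.symm Q.ne₂₃.symm _ R.mem₂, z3 _ Q.mem₃ Q.ne₁₃.symm Q.ne₂₃.symm _ R.mem₃,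
    z3 _ Q.mem₃ Q.ne₁₃.symm Q.ne₂₃.symm _ R.mem₄, z3 _ Q.mem₄ Q.ne₁₄.symm Q.ne₂₄.symm _ R.mem₁,
    z3 _ Q.mem₄ Q.ne₁₄.symm Q.ne₂₄.symm _ R.mem₂, z3 _ Q.mem₄ Q.ne₁₄.symm Q.ne₂₄.symm _ R.mem₃,
    z3 _ Q.mem₄ Q.ne₁₄.symm Q.ne₂₄.symm _ R.mem₄, w1 _ R.mem₂ R.ne₁₂.symm,
    w1 _ R.mem₃ R.ne₁₃.symm, w1 _ R.mem₄ R.ne₁₄.symm, w2, w3 _ R.mem₂ R.ne₁₂.symm,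
    w3 _ R.mem₃ R.ne₁₃.symm, w3 _ R.mem₄ R.ne₁₄.symm, sym_self H.cwdr]
  ring

omit [Fintype V] H in
/-- The zero rows at the far end of a symmetric arc. -/
theorem zeroRows_of_exchange {x : Finset α} {i j r r' : α} (hi : i ∈ x)
    (hj : j ∉ x) (h0 : grid Γ π x i j = 0)
    (hy : ZeroRows (exchange x i j) (exchange x i j)ᶜ (grid Γ π (exchange x i j)) r r') :
    ∃ r, ZeroRows (exchange x i j) (exchange x i j)ᶜ (grid Γ π (exchange x i j)) j r := by
  have m1 : j ∈ exchange x i j := by rw [mem_exchange]; exact Or.inl rfl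
  have m2 : i ∈ (exchange x i j)ᶜ := by
    rw [mem_compl, mem_exchange]; rintro (h | h); exacts [hj (h ▸ hi), h.1 rfl]
  rcases (hy.iff j m1 i m2).1 (grid_back hi hj h0) with rfl | rfl
  · exact ⟨_, hy⟩
  · exact ⟨_, hy.swap⟩

/-- The edge count along a symmetric arc between vertices with zero rows. -/
theorem conv_edge_of_zeroRows {x : Finset α} (hx : x.card = 4) {i i' j r : α}
    (hR : ZeroRows x xᶜ (grid Γ π x) i i') (hj : j ∉ x)
    (hy : ZeroRows (exchange x i j) (exchange x i j)ᶜ (grid Γ π (exchange x i j)) j r) :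
    conv Γ.sym Γ.sym (π x) (π (exchange x i j)) =
      3 + zeroInd (grid Γ π (exchange x i j) i' i) := by
  obtain ⟨j', hj', hjj⟩ := exists_mem_ne (show 1 < (xᶜ).card by rw [H.card_compl hx]; decide) j
  obtain ⟨l, l', R⟩ := exists_isQuad (H.card_compl hx) (mem_compl.2 hj) hj' hjj.symm
  rw [H.conv_edge hx hR R]
  have z : ∀ b ∈ xᶜ, b ≠ j → grid Γ π (exchange x i j) j b = 0 := fun b hb hbj =>
    (hy.iff j hy.mem b (by
      rw [mem_compl] at hb ⊢
      rw [mem_exchange, not_or, not_and]; exact ⟨hbj, fun _ => hb⟩)).2 (Or.inl rfl)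
  rw [z _ R.mem₂ R.ne₁₂.symm, z _ R.mem₃ R.ne₁₃.symm, z _ R.mem₄ R.ne₁₄.symm]
  simp only [zeroInd, if_true]
  ring

theorem exists_conv_sym_sym : ∃ c, ∀ u v, Γ.sym u v = 1 → conv Γ.sym Γ.sym u v = c := by
  obtain ⟨f, hf⟩ := (H.cwdr.isColor_conv (isColor_sym (Γ := Γ)) isColor_sym).exists_eq
  exact ⟨f (1, 1), fun u v huv => by rw [hf, twoWayDistance_of_sym H.cwdr huv]⟩

/-- Symmetric arcs preserve the property of having zero rows. -/
theorem exists_zeroRows_exchange {x : Finset α} (hx : x.card = 4) {i i' j : α}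
    (hR : ZeroRows x xᶜ (grid Γ π x) i i') (hj : j ∉ x) :
    ∃ r, ZeroRows (exchange x i j) (exchange x i j)ᶜ (grid Γ π (exchange x i j)) j r := by
  obtain ⟨c, hc⟩ := H.exists_conv_sym_sym
  have hjc := mem_compl.2 hj
  have h0 := (hR.iff i hR.mem j hjc).2 (Or.inl rfl)
  have h0' := (hR.iff i' hR.mem' j hjc).2 (Or.inr rfl)
  have s1 := (H.cover.grid_eq_zero hx hR.mem hj).1 h0
  have s2 := (H.cover.grid_eq_zero hx hR.mem' hj).1 h0'
  have hy : (exchange x i j).card = 4 := by rw [card_exchange hR.mem hj, hx]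
  have hy' : (exchange x i' j).card = 4 := by rw [card_exchange hR.mem' hj, hx]
  rcases H.zeroRows_or s1 hy with ⟨r, r', hyR⟩ | ⟨r, r', hyC⟩
  · exact zeroRows_of_exchange hR.mem hj h0 hyR
  exfalso
  have m1 : j ∈ exchange x i j := by rw [mem_exchange]; exact Or.inl rfl
  have m2 : i ∈ (exchange x i j)ᶜ := by
    rw [mem_compl, mem_exchange]; rintro (h | h); exacts [hj (h ▸ hR.mem), h.1 rfl]
  have m3 : i' ∈ exchange x i j := by rw [mem_exchange]; exact Or.inr ⟨hR.ne.symm, hR.mem'⟩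
  obtain ⟨t, hyC⟩ : ∃ t, ZeroRows (exchange x i j)ᶜ (exchange x i j)
      (fun b a => grid Γ π (exchange x i j) a b) i t := by
    rcases (hyC.iff i m2 j m1).1 (grid_back hR.mem hj h0) with rfl | rfl
    · exact ⟨_, hyC⟩
    · exact ⟨_, hyC.swap⟩
  have z1 := (hyC.iff i m2 i' m3).2 (Or.inl rfl)
  have htx : t ∈ xᶜ ∧ j ≠ t := by
    have h1 := hyC.mem'
    have h2 := hyC.ne
    simp only [mem_compl, mem_exchange, not_or, not_and] at h1 ⊢
    exact ⟨h1.2 h2.symm, Ne.symm h1.1⟩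
  obtain ⟨l, l', R⟩ := exists_isQuad (H.card_compl hx) hjc htx.1 htx.2
  have z2 : ∀ b ∈ xᶜ, b ≠ j → (grid Γ π (exchange x i j) j b = 0 ↔ b = t) := by
    intro b hb hbj
    have hb' : b ∈ (exchange x i j)ᶜ := by
      rw [mem_compl] at hb ⊢
      rw [mem_exchange, not_or, not_and]; exact ⟨hbj, fun _ => hb⟩
    have h1 := hyC.iff b hb' j m1
    rw [h1, or_iff_right]
    rintro rfl
    exact (mem_compl.1 hb) hR.mem
  have h2 : conv Γ.sym Γ.sym (π x) (π (exchange x i j)) = 2 := by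
    rw [H.conv_edge hx hR R]
    have y1 := (z2 t R.mem₂ R.ne₁₂.symm).2 rfl
    have y2 := mt (z2 l R.mem₃ R.ne₁₃.symm).1 R.ne₂₃.symm
    have y3 := mt (z2 l' R.mem₄ R.ne₁₄.symm).1 R.ne₂₄.symm
    simp only [zeroInd, y1, y2, y3, z1, if_true, if_false]
    rfl
  -- If the neighbour had zero columns i and t, only the cells (j, t) and (i', i) would contribute
  -- to `conv_edge`.
  have hc2 : c = 2 := (hc _ _ s1).symm.trans h2
  have e1 := exchange_exchange_col hR.mem hR.mem' hR.ne.symm hj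
  have s3 : Γ.sym (π (exchange x i j)) (π (exchange x i' j)) = 1 := by
    have := (H.cover.grid_eq_zero hy m3 (mem_compl.1 m2)).1 z1
    rwa [e1] at this
  have e2 : (exchange x i' j)ᶜ = exchange (exchange x i j)ᶜ i i' := by
    rw [← e1, ← compl_exchange m3 (mem_compl.1 m2), compl_compl]
  -- The third corner `exchange x i' j` yields a symmetric edge between two vertices of the same
  -- kind, whichever kind it has, and `conv_edge_of_zeroRows` or its dual counts at least 3 there.
  rcases H.zeroRows_or s1 hy' with ⟨q, q', hqR⟩ | ⟨q, q', hqC⟩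
  · obtain ⟨r, hr⟩ := zeroRows_of_exchange hR.mem' hj h0' hqR
    have h3 := H.conv_edge_of_zeroRows hx hR.swap hj hr
    have h4 := zeroInd_spec (grid_eq_or (Γ := Γ) (π := π) (exchange x i' j) i i')
    have h5 := hc _ _ s2
    omega
  · have hyc := H.card_compl hy
    have hd := zeroRows_dual hyC
    have hd' := zeroRows_dual hqC
    rw [e2] at hd'
    have m3' : i' ∉ (exchange x i j)ᶜ := by simpa using m3
    obtain ⟨r, hr⟩ := zeroRows_of_exchange m2 m3' (by
      rw [grid_dual m3 (mem_compl.1 m2)]; exact z1) hd'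
    have h3 := H.dual.conv_edge_of_zeroRows hyc hd m3' hr
    rw [← e2] at h3
    simp only [compl_compl] at h3
    have h4 := zeroInd_spec (grid_eq_or (Γ := Γ) (π := fun x => π xᶜ)
      (exchange (exchange x i j)ᶜ i i') t i)
    have h5 := hc _ _ s3
    rw [← e2] at h4
    omega

omit [Fintype V] in
theorem sym_opposite_eq_one {x : Finset α} (hx : x.card = 4) {i j k j' r : α}
    (hi : i ∈ x) (hj : j ∉ x) (hk : k ∈ x) (hki : k ≠ i) (hj' : j' ∉ x) (hjj : j' ≠ j)
    (hy : ZeroRows (exchange x i j) (exchange x i j)ᶜ (grid Γ π (exchange x i j)) j r) :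
    Γ.sym (π (exchange x i j)) (π (opposite x i k j j')) = 1 ↔ k = r := by
  have m1 : k ∈ exchange x i j := by rw [mem_exchange]; exact Or.inr ⟨hki, hk⟩
  have m2 : j' ∉ exchange x i j := by
    rw [mem_exchange, not_or, not_and]; exact ⟨hjj, fun _ => hj'⟩
  rw [opposite, ← H.cover.grid_eq_zero (by rw [card_exchange hi hj, hx]) m1 m2,
    hy.iff k m1 j' (mem_compl.2 m2), or_iff_right]
  rintro rfl
  exact hj hk

/-- After a symmetric step from x the zero rows are j and r, and r = i' exactly when the constant c
of symmetric edges is 4. This confines the symmetric paths of length two that leave x. A block of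
the other kind with four zeros and sum 0 is a (2,2) pair without such a path, although every (2,2)
pair has one. -/
theorem false_of_zeroRows {x : Finset α} (hx : x.card = 4) {i i' : α}
    (hR : ZeroRows x xᶜ (grid Γ π x) i i') : False := by
  obtain ⟨c, hc⟩ := H.exists_conv_sym_sym
  have hr : ∀ {i i' : α}, ZeroRows x xᶜ (grid Γ π x) i i' → ∀ j ∉ x, ∃ r, ZeroRows (exchange x i j)
      (exchange x i j)ᶜ (grid Γ π (exchange x i j)) j r ∧ (i' = r ↔ c = 4) := by
    intro i i' hR j hj
    obtain ⟨r, hr⟩ := H.exists_zeroRows_exchange hx hR hj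
    refine ⟨r, hr, ?_⟩
    have h1 := H.conv_edge_of_zeroRows hx hR hj hr
    rw [hc _ _ ((H.cover.grid_eq_zero hx hR.mem hj).1
      ((hR.iff i hR.mem j (mem_compl.2 hj)).2 (Or.inl rfl)))] at h1
    have h2 := hr.iff i' (by rw [mem_exchange]; exact Or.inr ⟨hR.ne.symm, hR.mem'⟩) i (by
      rw [mem_compl, mem_exchange]; rintro (h | h); exacts [hj (h ▸ hR.mem), h.1 rfl])
    rw [or_iff_right (by rintro rfl; exact hj hR.mem')] at h2
    rw [← h2]
    have h3 := zeroInd_spec (grid_eq_or (Γ := Γ) (π := π) (exchange x i j) i' i)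
    omega
  obtain ⟨j, hj, j', hj', hjj⟩ := one_lt_card.1
    (show 1 < (xᶜ).card by rw [H.card_compl hx]; decide)
  have hpos : ∀ u v, Γ.twoWayDistance u v = (2, 2) → 0 < conv Γ.sym Γ.sym u v := by
    intro u v huv
    obtain ⟨r, hy, -⟩ := hr hR j (mem_compl.1 hj)
    have h1 := hy.mem'
    rw [mem_exchange, or_iff_right hy.ne.symm] at h1
    rw [mem_compl] at hj hj'
    have h2 := (H.sym_opposite_eq_one hx hR.mem hj h1.2 h1.1 hj' hjj.symm hy).2 rfl
    have h3 := (H.cover.grid_eq_zero hx hR.mem hj).1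
      ((hR.iff i hR.mem j (mem_compl.2 hj)).2 (Or.inl rfl))
    have h4 := H.cover.opposite_ne hx hR.mem h1.2 h1.1.symm hj hj' hjj
    have h5 := twoWayDistance_of_sym_sym H.cwdr h4.1 h4.2 h3 h2
    rw [H.cwdr.isColor_conv (isColor_sym (Γ := Γ)) isColor_sym _ _ _ _ (huv.trans h5.symm)]
    exact conv_sym_sym_pos h3 h2
  have hno : ∀ {i i' : α}, ZeroRows x xᶜ (grid Γ π x) i i' → ∀ k ∈ x, k ≠ i → (k = i' ↔ c ≠ 4) →
      ∀ j ∈ xᶜ, ∀ j' ∈ xᶜ, j' ≠ j →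
      Γ.sym (π (exchange x i j)) (π (opposite x i k j j')) = 0 := by
    intro i i' hR k hk hki hkc j hj j' hj' hjj
    rw [mem_compl] at hj hj'
    obtain ⟨r, hy, hrc⟩ := hr hR j hj
    have h1 := mt (H.sym_opposite_eq_one hx hR.mem hj hk hki hj' hjj hy).1 (by
      rintro rfl
      by_cases h4 : c = 4
      · exact (hkc.1 (hrc.2 h4).symm) h4
      · exact h4 (hrc.1 (hkc.2 h4).symm))
    have h2 := Γ.sym_eq_or (π (exchange x i j)) (π (opposite x i k j j'))
    omega
  have hz : ∀ b ∈ xᶜ, grid Γ π x i b = 0 ∧ grid Γ π x i' b = 0 := fun b hb =>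
    ⟨(hR.iff i hR.mem b hb).2 (Or.inl rfl), (hR.iff i' hR.mem' b hb).2 (Or.inr rfl)⟩
  have hnz : ∀ a ∈ x, a ≠ i → a ≠ i' → ∀ b ∈ xᶜ, grid Γ π x a b ≠ 0 := fun a ha h1 h2 b hb h0 =>
    ((hR.iff a ha b hb).1 h0).elim h1 h2
  have fin : ∀ {a a' b b' m m' n n' : α} (Q : IsQuad x a a' b b') (R : IsQuad xᶜ m m' n n'),
      conv Γ.sym Γ.adjm (π x) (π (opposite x a a' m m')) = 4 →
      conv Γ.skew Γ.adjm (π x) (π (opposite x a a' m m')) = 0 →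
      conv Γ.sym Γ.sym (π x) (π (opposite x a a' m m')) ≠ 0 := by
    intro a a' b b' m m' n n' Q R h1 h2
    have h3 := H.cover.opposite_ne hx Q.mem₁ Q.mem₂ Q.ne₁₂ (mem_compl.1 R.mem₁)
      (mem_compl.1 R.mem₂) R.ne₁₂
    refine (hpos _ _ ?_).ne'
    rcases twoWayDistance_cases H.cwdr (fun a b => H.distance_le_two) h3.1 h3.2 (by omega) with
      h | h | h
    · exact h
    · have := h.2; omega
    · have := h.2; omega
  obtain ⟨k, k', Q⟩ := exists_isQuad hx hR.mem hR.mem' hR.ne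
  have zk : ∀ b ∈ xᶜ, grid Γ π x k b ≠ 0 := hnz k Q.mem₃ Q.ne₁₃.symm Q.ne₂₃.symm
  have zk' : ∀ b ∈ xᶜ, grid Γ π x k' b ≠ 0 := hnz k' Q.mem₄ Q.ne₁₄.symm Q.ne₂₄.symm
  have hcell : ∀ a ∈ x, ∀ b ∈ xᶜ, Γ.sym (π x) (π (exchange x a b)) = zeroInd (grid Γ π x a b) :=
    fun a ha b hb => H.cover.sym_cell hx ha (mem_compl.1 hb)
  by_cases h4 : c = 4
  -- Row k consists of 1 and -1 with sum 0, so column j has a partner column of opposite sign.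
  · obtain ⟨j, j', l, l', R, hsum⟩ : ∃ j j' l l', IsQuad xᶜ j j' l l' ∧
        grid Γ π x k j + grid Γ π x k j' = 0 := by
      obtain ⟨l, l', R⟩ := exists_isQuad (H.card_compl hx) hj hj' hjj
      have h1 := H.grid_row hx R Q.mem₃
      have v1 := zk j R.mem₁
      have v2 := zk j' R.mem₂
      have v3 := zk l R.mem₃
      have v4 := zk l' R.mem₄
      have u1 := grid_eq_or (Γ := Γ) (π := π) x k j
      have u2 := grid_eq_or (Γ := Γ) (π := π) x k j'
      have u3 := grid_eq_or (Γ := Γ) (π := π) x k l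
      have u4 := grid_eq_or (Γ := Γ) (π := π) x k l'
      by_cases h2 : grid Γ π x k j + grid Γ π x k j' = 0
      · exact ⟨j, j', l, l', R, h2⟩
      · exact ⟨j, l, j', l', R.swap_mid, by omega⟩
    have Q' := Q.swap_mid
    refine fin Q' R ?_ ?_ ?_
    · rw [H.conv_sym_eq hx Q' R]
      simp only [zeroInd, (hz _ R.mem₁).1, (hz _ R.mem₂).1, (hz _ R.mem₃).2, (hz _ R.mem₄).2,
        zk _ R.mem₁, zk _ R.mem₂, zk' _ R.mem₃, zk' _ R.mem₄, if_true, if_false]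
      rfl
    · rw [H.conv_skew_eq hx Q' R, (hz _ R.mem₁).1, (hz _ R.mem₂).1]
      omega
    · have c1 : k = i' ↔ c ≠ 4 := ⟨fun h => absurd h Q.ne₂₃.symm, fun h => absurd h4 h⟩
      have c2 : k' = i ↔ c ≠ 4 := ⟨fun h => absurd h Q.ne₁₄.symm, fun h => absurd h4 h⟩
      rw [H.conv_eq hx Q' R supported_sym supported_sym,
        hno hR k Q.mem₃ Q.ne₁₃.symm c1 j R.mem₁ j' R.mem₂ R.ne₁₂.symm,
        hno hR k Q.mem₃ Q.ne₁₃.symm c1 j' R.mem₂ j R.mem₁ R.ne₁₂,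
        hno hR.swap k' Q.mem₄ Q.ne₂₄.symm c2 l R.mem₃ l' R.mem₄ R.ne₃₄.symm,
        hno hR.swap k' Q.mem₄ Q.ne₂₄.symm c2 l' R.mem₄ l R.mem₃ R.ne₃₄,
        hcell k Q.mem₃ j R.mem₁, hcell k Q.mem₃ j' R.mem₂, hcell k' Q.mem₄ l R.mem₃,
        hcell k' Q.mem₄ l' R.mem₄]
      simp only [zeroInd, zk _ R.mem₁, zk _ R.mem₂, zk' _ R.mem₃, zk' _ R.mem₄, if_false]
      ring
  · obtain ⟨l, l', R⟩ := exists_isQuad (H.card_compl hx) hj hj' hjj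
    refine fin Q R ?_ ?_ ?_
    · rw [H.conv_sym_eq hx Q R]
      simp only [zeroInd, (hz _ R.mem₁).1, (hz _ R.mem₂).1, (hz _ R.mem₁).2, (hz _ R.mem₂).2,
        zk _ R.mem₃, zk _ R.mem₄, zk' _ R.mem₃, zk' _ R.mem₄, if_true, if_false]
      rfl
    · rw [H.conv_skew_eq hx Q R, (hz _ R.mem₁).1, (hz _ R.mem₂).1, (hz _ R.mem₁).2,
        (hz _ R.mem₂).2]
      rfl
    · have c1 : i' = i' ↔ c ≠ 4 := ⟨fun _ => h4, fun _ => rfl⟩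
      have c2 : i = i ↔ c ≠ 4 := ⟨fun _ => h4, fun _ => rfl⟩
      rw [H.conv_eq hx Q R supported_sym supported_sym,
        hno hR i' Q.mem₂ Q.ne₁₂.symm c1 j R.mem₁ j' R.mem₂ R.ne₁₂.symm,
        hno hR i' Q.mem₂ Q.ne₁₂.symm c1 j' R.mem₂ j R.mem₁ R.ne₁₂,
        hno hR.swap i Q.mem₁ Q.ne₁₂ c2 j R.mem₁ j' R.mem₂ R.ne₁₂.symm,
        hno hR.swap i Q.mem₁ Q.ne₁₂ c2 j' R.mem₂ j R.mem₁ R.ne₁₂,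
        hcell k Q.mem₃ l R.mem₃, hcell k Q.mem₃ l' R.mem₄, hcell k' Q.mem₄ l R.mem₃,
        hcell k' Q.mem₄ l' R.mem₄]
      simp only [zeroInd, zk _ R.mem₃, zk _ R.mem₄, zk' _ R.mem₃, zk' _ R.mem₄, if_false]
      ring

/-- There are no symmetric arcs. -/
theorem sym_ne_one (u v : V) : Γ.sym u v ≠ 1 := by
  intro huv
  obtain ⟨x, hx, -⟩ := H.cover.surj u
  rcases H.zeroRows_or huv hx with ⟨i, i', hR⟩ | ⟨j, j', hR⟩
  · exact H.false_of_zeroRows hx hR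
  · exact H.dual.false_of_zeroRows (H.card_compl hx) (zeroRows_dual hR)

end OctadCover

end Digraph

/-! ### Intersections of exchanged sets -/

section CardInter

variable {α : Type*} [DecidableEq α] {x y : Finset α} {i i' j j' a b : α}

theorem card_inter_exchange (hi : i ∈ x) (hj : j ∉ x) : (x ∩ exchange x i j).card + 1 = x.card := by
  rw [show x ∩ exchange x i j = x.erase i by
    ext c; simp only [mem_inter, mem_exchange, mem_erase]; grind]
  exact card_erase_add_one hi

theorem exists_exchange_of_card_inter (h : (x ∩ y).card + 1 = x.card) (hxy : y.card = x.card) :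
    ∃ i ∈ x, ∃ j ∉ x, exchange x i j = y := by
  have h1 : (x \ y).card = 1 := by have := card_sdiff_add_card_inter x y; omega
  have h2 : (y \ x).card = 1 := by
    have := card_sdiff_add_card_inter y x; rw [inter_comm] at this; omega
  obtain ⟨i, hi⟩ := card_eq_one.1 h1
  obtain ⟨j, hj⟩ := card_eq_one.1 h2
  have hi' : ∀ c, c ∈ x ∧ c ∉ y ↔ c = i := fun c => by rw [← mem_sdiff, hi, mem_singleton]
  have hj' : ∀ c, c ∈ y ∧ c ∉ x ↔ c = j := fun c => by rw [← mem_sdiff, hj, mem_singleton]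
  refine ⟨i, ((hi' i).2 rfl).1, j, ((hj' j).2 rfl).2, ?_⟩
  ext c
  have h3 := hi' c
  have h4 := hj' c
  rw [mem_exchange]
  grind

theorem exchange_inj (hi : i ∈ x) (hj : j ∉ x) (hj' : j' ∉ x)
    (h : exchange x i j = exchange x i' j') : i = i' ∧ j = j' := by
  have h1 : ∀ c, c ∈ exchange x i j ↔ c ∈ exchange x i' j' := fun c => by rw [h]
  have h2 := h1 i
  have h3 := h1 j
  simp only [mem_exchange] at h2 h3
  grind

theorem card_le_of_sdiff_subset (s : Finset α) {n : ℕ} (hs : s.card ≤ n) (h : x \ s ⊆ y) :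
    x.card ≤ y.card + n := by
  have h1 := card_le_card h
  have h2 := le_card_sdiff s x
  omega

theorem card_add_two_le (hij : i ≠ i') (hi : i ∈ x) (hi' : i' ∈ x) (h : y ⊆ x \ {i, i'}) :
    y.card + 2 ≤ x.card := by
  have h1 := card_le_card h
  rw [card_sdiff_of_subset (by simp [insert_subset_iff, hi, hi']), card_pair hij] at h1
  have h2 := card_le_card (show {i, i'} ⊆ x by simp [insert_subset_iff, hi, hi'])
  rw [card_pair hij] at h2
  omega

theorem card_le_card_inter_exchange :
    x.card ≤ (exchange x i j ∩ exchange x i' j').card + 2 :=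
  card_le_of_sdiff_subset {i, i'} card_le_two fun c hc => by
    simp only [mem_sdiff, mem_insert, mem_singleton, mem_inter, mem_exchange] at *
    tauto

theorem eq_or_eq_of_card_inter_exchange (hi : i ∈ x) (hj : j ∉ x) (hi' : i' ∈ x) (hj' : j' ∉ x)
    (h : (exchange x i j ∩ exchange x i' j').card + 1 = x.card) : i = i' ∨ j = j' := by
  by_contra! hne
  have := card_add_two_le (y := exchange x i j ∩ exchange x i' j') hne.1 hi hi' fun c hc => by
    simp only [mem_sdiff, mem_insert, mem_singleton, mem_inter, mem_exchange] at *
    grind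
  omega

theorem card_le_card_inter_opposite :
    x.card ≤ (exchange x a b ∩ opposite x i i' j j').card + 3 :=
  card_le_of_sdiff_subset {i, i', a} card_le_three fun c hc => by
    simp only [mem_sdiff, mem_insert, mem_singleton, mem_inter, mem_exchange, mem_opposite] at *
    tauto

theorem card_le_card_inter_opposite_of_mem (ha : a = i ∨ a = i') :
    x.card ≤ (exchange x a b ∩ opposite x i i' j j').card + 2 :=
  card_le_of_sdiff_subset {i, i'} card_le_two fun c hc => by
    simp only [mem_sdiff, mem_insert, mem_singleton, mem_inter, mem_exchange, mem_opposite] at *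
    grind

theorem card_le_card_inter_opposite_of_notMem (hb : b ∉ x)
    (hbj : b = j ∨ b = j') : x.card ≤ (exchange x a b ∩ opposite x i i' j j').card + 2 := by
  have h1 : x.card + 1 ≤ (exchange x a b ∩ opposite x i i' j j').card + 3 := by
    rw [← card_insert_of_notMem hb]
    refine card_le_of_sdiff_subset {i, i', a} card_le_three fun c hc => ?_
    simp only [mem_sdiff, mem_insert, mem_singleton, mem_inter, mem_exchange, mem_opposite] at *
    grind
  omega

/-- If b is outside the block, the intersection avoids i and i' and lies in x. If a is outside, then
apart from b it lies in x and misses the three elements a, i, i'. Either way it is too small. -/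
theorem mem_block_of_card_inter (hi : i ∈ x) (hi' : i' ∈ x) (hii : i ≠ i')
    (hj : j ∉ x) (hj' : j' ∉ x) (ha : a ∈ x)
    (h : (exchange x a b ∩ opposite x i i' j j').card + 1 = x.card) :
    (a = i ∨ a = i') ∧ (b = j ∨ b = j') := by
  have hbj : b = j ∨ b = j' := by
    by_contra! hne
    have := card_add_two_le (y := exchange x a b ∩ opposite x i i' j j') hii hi hi' fun c hc => by
      simp only [mem_sdiff, mem_insert, mem_singleton, mem_inter, mem_exchange, mem_opposite] at *
      grind
    omega
  refine ⟨?_, hbj⟩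
  by_contra! hne
  have h1 : (exchange x a b ∩ opposite x i i' j j').erase b ⊆ (x.erase a) \ {i, i'} := fun c hc => by
    simp only [mem_sdiff, mem_insert, mem_singleton, mem_inter, mem_exchange, mem_opposite,
      mem_erase] at *
    grind
  have h2 := card_add_two_le hii (mem_erase.2 ⟨hne.1.symm, hi⟩) (mem_erase.2 ⟨hne.2.symm, hi'⟩) h1
  have h3 := card_erase_add_one ha
  have h4 := pred_card_le_card_erase (s := exchange x a b ∩ opposite x i i' j j') (a := b)
  omega

theorem card_inter_compl [Fintype α] (x y : Finset α) :
    (x ∩ y).card + (x ∩ yᶜ).card = x.card := by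
  rw [← card_inter_add_card_sdiff x y, sdiff_eq_inter_compl]

end CardInter

namespace Digraph

variable {V : Type*} {Γ : Digraph V}

/-! ### Local covers from the two graph families -/

section Covers

variable {α : Type*} [DecidableEq α] {e : ℕ} {π : Finset α → V}

theorem LocalCover.of_johnson (hs : ∀ v, ∃ x : Finset α, x.card = e ∧ π x = v)
    (ha : ∀ x y : Finset α, x.card = e → y.card = e →
      (Γ.adjm (π x) (π y) = 1 ↔ (x ∩ y).card + 1 = e))
    (hi : ∀ x y : Finset α, x.card = e → y.card = e → π x = π y → x = y) : LocalCover Γ e π where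
  surj := hs
  adj x i j hx hxi hxj := by
    rw [ha _ _ hx (by rw [card_exchange hxi hxj, hx]), card_inter_exchange hxi hxj, hx]
  lift x v hx hv := by
    obtain ⟨y, hy, rfl⟩ := hs v
    rw [ha _ _ hx hy] at hv
    obtain ⟨i, hxi, j, hxj, rfl⟩ := exists_exchange_of_card_inter (hv.trans hx.symm)
      (hy.trans hx.symm)
    exact ⟨i, hxi, j, hxj, rfl⟩
  inj x i j i' j' hx hxi hxj hxi' hxj' h := exchange_inj hxi hxj hxj'
    (hi _ _ (by rw [card_exchange hxi hxj, hx]) (by rw [card_exchange hxi' hxj', hx]) h)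
  nonadj x i j i' j' hx hxi hxj hxi' hxj' h := by
    rw [ha _ _ (by rw [card_exchange hxi hxj, hx]) (by rw [card_exchange hxi' hxj', hx])] at h
    exact eq_or_eq_of_card_inter_exchange hxi hxj hxi' hxj' (h.trans hx.symm)

/-- Two exchanges of one set meet in at least e - 2 ≥ 2 elements, so within a neighbourhood neither
complementary sets nor intersections of size 1 occur. -/
theorem LocalCover.of_folded [Fintype α] (he : 4 ≤ e) (hα : Fintype.card α = 2 * e)
    (hs : ∀ v, ∃ x : Finset α, x.card = e ∧ π x = v)
    (ha : ∀ x y : Finset α, x.card = e → y.card = e →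
      (Γ.adjm (π x) (π y) = 1 ↔ (x ∩ y).card + 1 = e ∨ (x ∩ y).card = 1))
    (hi : ∀ x y : Finset α, x.card = e → y.card = e → (π x = π y ↔ x = y ∨ x = yᶜ)) :
    LocalCover Γ e π where
  surj := hs
  adj x i j hx hxi hxj := by
    rw [ha _ _ hx (by rw [card_exchange hxi hxj, hx]), card_inter_exchange hxi hxj, hx]
    exact Or.inl rfl
  lift x v hx hv := by
    obtain ⟨y, hy, rfl⟩ := hs v
    rw [ha _ _ hx hy] at hv
    have hyc : (yᶜ).card = e := by rw [card_compl]; omega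
    rcases hv with hv | hv
    · obtain ⟨i, hxi, j, hxj, rfl⟩ := exists_exchange_of_card_inter (hv.trans hx.symm)
        (hy.trans hx.symm)
      exact ⟨i, hxi, j, hxj, rfl⟩
    · have h1 := card_inter_compl x y
      obtain ⟨i, hxi, j, hxj, h⟩ := exists_exchange_of_card_inter (x := x) (y := yᶜ) (by omega)
        (hyc.trans hx.symm)
      exact ⟨i, hxi, j, hxj, by rw [h]; exact (hi _ _ hyc hy).2 (Or.inr rfl)⟩
  inj x i j i' j' hx hxi hxj hxi' hxj' h := by
    rcases (hi _ _ (by rw [card_exchange hxi hxj, hx]) (by rw [card_exchange hxi' hxj', hx])).1 h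
      with h1 | h1
    · exact exchange_inj hxi hxj hxj' h1
    · have h2 := card_le_card_inter_exchange (x := x) (i := i) (j := j) (i' := i') (j' := j')
      rw [h1, inter_comm, inter_compl, card_empty] at h2
      omega
  nonadj x i j i' j' hx hxi hxj hxi' hxj' h := by
    rw [ha _ _ (by rw [card_exchange hxi hxj, hx]) (by rw [card_exchange hxi' hxj', hx])] at h
    rcases h with h | h
    · exact eq_or_eq_of_card_inter_exchange hxi hxj hxi' hxj' (h.trans hx.symm)
    · have h2 := card_le_card_inter_exchange (x := x) (i := i) (j := j) (i' := i') (j' := j')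
      omega

end Covers

/-! ### Arc types in the two cases -/

section Conclusion

/-- The case without symmetric arcs in which each arc lies in a directed triangle. -/
theorem arcTypeSet_of_distance_le_two [Fintype V] (h : Γ.IsCWDR)
    (hΓ : ∀ a b, Γ.Adj a b → Γ.distance b a ≤ 2) (hs : ∀ u v, Γ.sym u v ≠ 1) :
    intersectionNumber Γ.twoWayRel (1, 2) (1, 3) (1, 3) = 0 ∧ Γ.arcTypeSet = {3} := by
  have key : ∀ x y q, Γ.twoWayDistance x y = (1, q) → q = 2 := by
    intro x y q hxy
    rw [twoWayDistance, Prod.mk.injEq, h.wdr.distance_eq_one] at hxy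
    obtain ⟨h1, rfl⟩ := hxy
    have h2 := hΓ x y h1
    have h3 : Γ.distance y x ≠ 0 := fun h0 => by
      have := h.wdr.stronglyConnected.distance_eq_zero.1 h0
      subst this
      exact h.wdr.loopless _ h1
    have h4 : Γ.distance y x ≠ 1 := fun h0 =>
      hs x y ((sym_eq_one h).2 ⟨h1, h.wdr.distance_eq_one.1 h0⟩)
    omega
  constructor
  -- The infimum is 0 if the value 0 is attained or if there is no (1,2) pair at all.
  · rw [intersectionNumber, Nat.sInf_eq_zero]
    by_cases hex : ∃ x y, (x, y) ∈ Γ.twoWayRel (1, 2)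
    · obtain ⟨x, y, hxy⟩ := hex
      refine Or.inl ⟨x, y, hxy, ?_⟩
      exact (Set.ncard_eq_zero (Set.toFinite _)).2 (Set.eq_empty_of_forall_notMem fun z hz =>
        absurd (key _ _ _ hz.1) (by decide))
    · right
      exact Set.eq_empty_of_forall_notMem fun p ⟨x, y, hxy, _⟩ => hex ⟨x, y, hxy⟩
  · ext t
    rw [Set.mem_singleton_iff]
    constructor
    · rintro ⟨q, ⟨x, y, hxy⟩, rfl⟩
      rw [key x y q hxy]
    · rintro rfl
      obtain ⟨a, b, hab⟩ := exists_strict_arc h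
      exact ⟨2, ⟨a, b, twoWayDistance_of_strict h hΓ hab⟩, rfl⟩

/-- The case with arcs of type `(1, 3)`. -/
theorem arcTypeSet_of_distance_le_three [Fintype V] (h : Γ.IsCWDR)
    (hΓ : ∀ a b, Γ.Adj a b → Γ.distance b a ≤ 3) {a b c : V} (hab : Γ.twoWayDistance a b = (1, 2))
    (hac : Γ.twoWayDistance a c = (1, 3)) (hcb : Γ.twoWayDistance c b = (1, 3)) :
    intersectionNumber Γ.twoWayRel (1, 2) (1, 3) (1, 3) ≠ 0 ∧
      (Γ.arcTypeSet = {3, 4} ∨ Γ.arcTypeSet = {2, 3, 4}) := by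
  constructor
  · obtain ⟨x, y, hxy, hp⟩ := Nat.sInf_mem (s := {p | ∃ x y, (x, y) ∈ Γ.twoWayRel (1, 2) ∧
      {z | (x, z) ∈ Γ.twoWayRel (1, 3) ∧ (z, y) ∈ Γ.twoWayRel (1, 3)}.ncard = p})
      ⟨_, a, b, hab, rfl⟩
    rw [intersectionNumber, ← hp, ← Nat.card_coe_set_eq]
    have h1 := h.card_eq (hab.trans (show Γ.twoWayDistance x y = _ from hxy).symm) (1, 3) (1, 3)
    rw [← Nat.card_eq_fintype_card, ← Nat.card_eq_fintype_card] at h1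
    intro h0
    have h2 := h1.trans h0
    rw [Nat.card_eq_zero] at h2
    rcases h2 with h2 | h2
    · exact h2.false ⟨c, hac, hcb⟩
    · exact not_finite_iff_infinite.2 h2 inferInstance
  · have h3 : 3 ∈ Γ.arcTypeSet := ⟨2, ⟨a, b, hab⟩, rfl⟩
    have h4 : 4 ∈ Γ.arcTypeSet := ⟨3, ⟨a, c, hac⟩, rfl⟩
    have hsub : ∀ t ∈ Γ.arcTypeSet, t = 2 ∨ t = 3 ∨ t = 4 := by
      rintro t ⟨q, ⟨x, y, hxy⟩, rfl⟩
      rw [twoWayDistance, Prod.mk.injEq, h.wdr.distance_eq_one] at hxy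
      obtain ⟨h1, rfl⟩ := hxy
      have h2 := hΓ x y h1
      have h3 : Γ.distance y x ≠ 0 := fun h0 => by
        have := h.wdr.stronglyConnected.distance_eq_zero.1 h0
        subst this
        exact h.wdr.loopless _ h1
      omega
    by_cases h2 : 2 ∈ Γ.arcTypeSet
    · right
      ext t
      simp only [Set.mem_insert_iff, Set.mem_singleton_iff]
      exact ⟨hsub t, by rintro (rfl | rfl | rfl) <;> assumption⟩
    · left
      ext t
      simp only [Set.mem_insert_iff, Set.mem_singleton_iff]
      refine ⟨fun ht => (hsub t ht).resolve_left ?_, by rintro (rfl | rfl) <;> assumption⟩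
      rintro rfl
      exact h2 ht

/-- The dichotomy between vanishing and nonvanishing line sums. -/
theorem LocalCover.arcTypeSet_cases {α : Type*} [DecidableEq α] [Fintype α] [Fintype V] {e : ℕ}
    {π : Finset α → V} (hπ : LocalCover Γ e π) (h : Γ.IsCWDR) (he : 2 ≤ e)
    (hα : 2 * e ≤ Fintype.card α)
    (hs : (∀ x : Finset α, x.card = e → ∀ i ∈ x, rowSum Γ.skew π x i = 0) →
      (∀ x : Finset α, x.card = e → ∀ j ∉ x, colSum Γ.skew π x j = 0) → ∀ u v, Γ.sym u v ≠ 1) :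
    (intersectionNumber Γ.twoWayRel (1, 2) (1, 3) (1, 3) = 0 ∧ Γ.arcTypeSet = {3}) ∨
    (intersectionNumber Γ.twoWayRel (1, 2) (1, 3) (1, 3) ≠ 0 ∧
      (Γ.arcTypeSet = {3, 4} ∨ Γ.arcTypeSet = {2, 3, 4})) := by
  by_cases h0 : ∀ x : Finset α, x.card = e →
      (∀ i ∈ x, rowSum Γ.skew π x i = 0) ∧ ∀ j ∉ x, colSum Γ.skew π x j = 0
  · left
    have hrow := fun x hx => (h0 x hx).1
    exact arcTypeSet_of_distance_le_two h (fun a b => hπ.distance_le_two h hrow)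
      (hs hrow fun x hx => (h0 x hx).2)
  · right
    have hα' : Fintype.card α = 2 * e := by
      by_contra hne
      exact h0 fun x hx => hπ.skew_sums_eq_zero_of_ne h he (by omega) hne hx
    obtain ⟨h1, a, b, c, h2, h3, h4⟩ := hπ.structure_of_ne_zero h hα' he h0
    exact arcTypeSet_of_distance_le_three h h1 h2 h3 h4

end Conclusion

/-! ### Johnson graphs -/

section Johnson

variable {n e : ℕ}

/-- Outside the e-subsets the map takes an arbitrary value `v₀`, which plays no role. -/
theorem exists_johnson (h : Γ.IsCWDR) (φ : Γ.toSimpleGraphInclusive ≃g johnsonGraph n e) :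
    ∃ π : Finset (Fin n) → V, (∀ v, ∃ x, x.card = e ∧ π x = v) ∧
      (∀ x y, x.card = e → y.card = e → (Γ.adjm (π x) (π y) = 1 ↔ (x ∩ y).card + 1 = e)) ∧
      ∀ x y, x.card = e → y.card = e → π x = π y → x = y := by
  classical
  obtain ⟨v₀⟩ := h.wdr.nonempty
  refine ⟨fun x => if hx : x.card = e then φ.symm ⟨x, hx⟩ else v₀, fun v => ?_,
    fun x y hx hy => ?_, fun x y hx hy hxy => ?_⟩
  · refine ⟨(φ v).1, (φ v).2, ?_⟩
    beta_reduce
    rw [dif_pos (φ v).2]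
    exact φ.symm_apply_apply v
  · beta_reduce
    rw [dif_pos hx, dif_pos hy, adjm_eq_one_iff h, φ.symm.map_adj_iff]
    rfl
  · beta_reduce at hxy
    rw [dif_pos hx, dif_pos hy] at hxy
    exact congrArg Subtype.val (φ.symm.injective hxy)

theorem arcTypeSet_of_johnson [Fintype V] (h : Γ.IsCWDR) (he : 2 ≤ e) (hn : 2 * e ≤ n)
    (φ : Γ.toSimpleGraphInclusive ≃g johnsonGraph n e) :
    (intersectionNumber Γ.twoWayRel (1, 2) (1, 3) (1, 3) = 0 ∧ Γ.arcTypeSet = {3}) ∨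
    (intersectionNumber Γ.twoWayRel (1, 2) (1, 3) (1, 3) ≠ 0 ∧
      (Γ.arcTypeSet = {3, 4} ∨ Γ.arcTypeSet = {2, 3, 4})) := by
  obtain ⟨π, hs, ha, hi⟩ := exists_johnson h φ
  have hπ := LocalCover.of_johnson hs ha hi
  refine hπ.arcTypeSet_cases h he (by simpa using hn) fun hr hc => ?_
  refine BalancedCover.sym_ne_one (e := e) (π := π) ⟨h, hπ, he, ?_, hr, hc, ?_⟩
  · rw [Fintype.card_fin]; omega
  · intro x i i' j j' hx hxi hxi' hii hxj hxj' hjj a hxa b hxb hab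
    rw [ha _ _ (by rw [card_exchange hxa hxb, hx])
      (by rw [card_opposite hxi hxi' hii hxj hxj' hjj, hx])] at hab
    exact mem_block_of_card_inter hxi hxi' hii hxj hxj' hxa (hab.trans hx.symm)

end Johnson

/-! ### Folded Johnson graphs -/

section Folded

variable {e : ℕ}

theorem pair_compl_eq_iff {α : Type*} [Fintype α] [DecidableEq α] {x y : Finset α} :
    ({x, xᶜ} : Finset (Finset α)) = {y, yᶜ} ↔ x = y ∨ x = yᶜ := by
  constructor
  · intro h
    have : x ∈ ({y, yᶜ} : Finset (Finset α)) := by rw [← h]; simp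
    simpa using this
  · rintro (rfl | rfl)
    · rfl
    · rw [compl_compl, pair_comm]

/-- With k the size of x ∩ y, the four intersections of parts have sizes k and e - k, each twice. -/
theorem foldedJohnsonGraph_adj_iff (he : 4 ≤ e) {x y : Finset (Fin (2 * e))} (hx : x.card = e)
    (hy : y.card = e) :
    (foldedJohnsonGraph e).Adj ⟨{x, xᶜ}, x, hx, rfl⟩ ⟨{y, yᶜ}, y, hy, rfl⟩ ↔
      (x ∩ y).card + 1 = e ∨ (x ∩ y).card = 1 := by
  have h1 := card_inter_compl x y
  have h2 := card_inter_compl y x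
  have h3 := card_inter_compl xᶜ y
  have hxc : (xᶜ).card = e := by rw [card_compl, Fintype.card_fin]; omega
  rw [inter_comm y x, inter_comm y xᶜ] at h2
  simp only [foldedJohnsonGraph, mem_insert, mem_singleton, exists_eq_or_imp, exists_eq_left]
  constructor
  · rintro ⟨-, h | h⟩ <;> omega
  · intro h
    refine ⟨fun h0 => ?_, ?_⟩
    · rw [Subtype.mk.injEq, pair_compl_eq_iff] at h0
      rcases h0 with rfl | rfl
      · rw [inter_self] at h; omega
      · rw [inter_comm, inter_compl, card_empty] at h; omega
    · omega

theorem exists_folded (he : 4 ≤ e) (h : Γ.IsCWDR)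
    (φ : Γ.toSimpleGraphInclusive ≃g foldedJohnsonGraph e) :
    ∃ π : Finset (Fin (2 * e)) → V, (∀ v, ∃ x, x.card = e ∧ π x = v) ∧
      (∀ x y, x.card = e → y.card = e →
        (Γ.adjm (π x) (π y) = 1 ↔ (x ∩ y).card + 1 = e ∨ (x ∩ y).card = 1)) ∧
      ∀ x y, x.card = e → y.card = e → (π x = π y ↔ x = y ∨ x = yᶜ) := by
  classical
  obtain ⟨v₀⟩ := h.wdr.nonempty
  refine ⟨fun x => if hx : x.card = e then φ.symm ⟨{x, xᶜ}, x, hx, rfl⟩ else v₀, fun v => ?_,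
    fun x y hx hy => ?_, fun x y hx hy => ?_⟩
  · obtain ⟨x, hx, hv⟩ := (φ v).2
    refine ⟨x, hx, ?_⟩
    beta_reduce
    rw [dif_pos hx, show (⟨{x, xᶜ}, x, hx, rfl⟩ : {P : Finset (Finset (Fin (2 * e))) //
      ∃ x : Finset (Fin (2 * e)), x.card = e ∧ P = {x, xᶜ}}) = φ v from Subtype.ext hv.symm]
    exact φ.symm_apply_apply v
  · beta_reduce
    rw [dif_pos hx, dif_pos hy, adjm_eq_one_iff h, φ.symm.map_adj_iff,
      foldedJohnsonGraph_adj_iff he hx hy]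
  · beta_reduce
    rw [dif_pos hx, dif_pos hy, φ.symm.injective.eq_iff, Subtype.mk.injEq, pair_compl_eq_iff]

theorem arcTypeSet_of_folded [Fintype V] (h : Γ.IsCWDR) (he : 4 ≤ e)
    (φ : Γ.toSimpleGraphInclusive ≃g foldedJohnsonGraph e) :
    (intersectionNumber Γ.twoWayRel (1, 2) (1, 3) (1, 3) = 0 ∧ Γ.arcTypeSet = {3}) ∨
    (intersectionNumber Γ.twoWayRel (1, 2) (1, 3) (1, 3) ≠ 0 ∧
      (Γ.arcTypeSet = {3, 4} ∨ Γ.arcTypeSet = {2, 3, 4})) := by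
  obtain ⟨π, hs, ha, hi⟩ := exists_folded he h φ
  have hα : Fintype.card (Fin (2 * e)) = 2 * e := Fintype.card_fin _
  have hπ := LocalCover.of_folded he hα hs ha hi
  refine hπ.arcTypeSet_cases h (by omega) hα.ge fun hr hc => ?_
  -- The sets in question meet in at least e - 3 elements. For e > 4 this rules out an intersection
  -- of size 1, so only the four cells of the block remain; for e = 4 the complementary cells also
  -- occur.
  rcases he.lt_or_eq with he' | rfl
  · refine BalancedCover.sym_ne_one (e := e) (π := π) ⟨h, hπ, by omega, by omega, hr, hc, ?_⟩
    intro x i i' j j' hx hxi hxi' hii hxj hxj' hjj a hxa b hxb hab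
    rw [ha _ _ (by rw [card_exchange hxa hxb, hx])
      (by rw [card_opposite hxi hxi' hii hxj hxj' hjj, hx])] at hab
    have h1 := card_le_card_inter_opposite (x := x) (a := a) (b := b) (i := i) (i' := i') (j := j)
      (j' := j')
    exact mem_block_of_card_inter hxi hxi' hii hxj hxj' hxa (by omega)
  · refine OctadCover.sym_ne_one (π := π) ⟨h, hπ, hα, hr, hc, fun x hx => ?_, ?_⟩
    · exact (hi _ _ (by rw [card_compl]; omega) hx).2 (Or.inr rfl)
    intro x i i' j j' hx hxi hxi' hii hxj hxj' hjj a hxa b hxb hab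
    rw [ha _ _ (by rw [card_exchange hxa hxb, hx])
      (by rw [card_opposite hxi hxi' hii hxj hxj' hjj, hx])] at hab
    rcases hab with hab | hab
    · exact Or.inl (mem_block_of_card_inter hxi hxi' hii hxj hxj' hxa (hab.trans hx.symm))
    · right
      rw [← not_or, ← not_or]
      refine ⟨fun h1 => ?_, fun h1 => ?_⟩
      · have := card_le_card_inter_opposite_of_mem (x := x) (b := b) (j := j) (j' := j') h1
        omega
      · have := card_le_card_inter_opposite_of_notMem (a := a) (i := i) (i' := i') hxb h1
        omega

end Folded

end Digraph

theorem proposition4p1 {V : Type*} (Γ : Digraph V)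
    (hΓ : Γ.IsWeaklyDistanceRegular) (hcomm : Γ.IsCommutative)
    (hunder :
      (∃ n e : ℕ, 2 ≤ e ∧ 2 * e ≤ n ∧ Nonempty (Γ.toSimpleGraphInclusive ≃g johnsonGraph n e)) ∨
      (∃ e : ℕ, 4 ≤ e ∧ Nonempty (Γ.toSimpleGraphInclusive ≃g foldedJohnsonGraph e))) :
    (intersectionNumber Γ.twoWayRel (1, 2) (1, 3) (1, 3) = 0 → Γ.arcTypeSet = {3}) ∧
    (intersectionNumber Γ.twoWayRel (1, 2) (1, 3) (1, 3) ≠ 0 →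
      Γ.arcTypeSet = {3, 4} ∨ Γ.arcTypeSet = {2, 3, 4}) := by
  have := hΓ.finite
  have := Fintype.ofFinite V
  have h : Γ.IsCWDR := ⟨hΓ, hcomm⟩
  have key : (intersectionNumber Γ.twoWayRel (1, 2) (1, 3) (1, 3) = 0 ∧ Γ.arcTypeSet = {3}) ∨
      (intersectionNumber Γ.twoWayRel (1, 2) (1, 3) (1, 3) ≠ 0 ∧
        (Γ.arcTypeSet = {3, 4} ∨ Γ.arcTypeSet = {2, 3, 4})) := by
    rcases hunder with ⟨n, e, he, hn, ⟨φ⟩⟩ | ⟨e, he, ⟨φ⟩⟩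
    · exact Digraph.arcTypeSet_of_johnson h he hn φ
    · exact Digraph.arcTypeSet_of_folded h he φ
  rcases key with ⟨h1, h2⟩ | ⟨h1, h2⟩
  · exact ⟨fun _ => h2, fun h0 => absurd h1 h0⟩
  · exact ⟨fun h0 => absurd h0 h1, fun _ => h2⟩
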